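/- Let $N,n\ge 1$. Let $\mathcal A_0$ be the space of families $(G_k,L_k)_{k=1}^N$ with $G_k\in SL(n,\mathbb C)$ and $L_k=\mathrm{diag}(\lambda^{(k)}_1,\dots,\lambda^{(k)}_n)$ traceless with pairwise distinct eigenvalues, with the Poisson structure $$\{\overset{1}{G_j},\overset{2}{G_k}\}=-\overset{1}{G_j}\overset{2}{G_k}\,r(L_k)\,\delta_{jk},\qquad \{\overset{1}{G_j},\overset{2}{L_k}\}=-\overset{1}{G_k}\,\Omega\,\delta_{jk},\qquad \{\overset{1}{L_j},\overset{2}{L_k}\}=0,$$ where $\overset{1}{M}=M\otimes 1$, $\overset{2}{M}=1\otimes M$, and $$r(L)=\sum_{i<l}\frac{E_{il}\otimes E_{li}-E_{li}\otimes E_{il}}{\lambda_i-\lambda_l},\qquad \Omega=\sum_{i}E_{ii}\otimes E_{ii}-\tfrac1n\,1\otimes 1 .$$ The map $\mathfrak m=\sum_{k=1}^N G_kL_kG_k^{-1}$ is the moment map of the action $G_k\mapsto SG_k$, $L_k\mapsto L_k$ of $SL(n,\mathbb C)$ on $\mathcal A_0$: $\mathfrak m$ is equivariant, and for every $X\in\mathfrak{sl}(n)$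 and every holomorphic $F$, $\{\mathrm{tr}(X\mathfrak m),F\}$ is the derivative of $F$ along the vector field $(XG_k,0)_k$. Let $Z\subset\mathcal A_0$ be the set of points with $\mathfrak m=0$ for which, moreover, no two eigenvalues of the same $L_k$ differ by an integer. Let $\mathcal A=Z/SL(n,\mathbb C)$ and let $\pi:Z\to\mathcal A$ be the projection. Then $\mathcal A$ is a (Hausdorff, second countable) complex manifold on whose open sets the holomorphic functions are exactly those whose pullback by $\pi$ is holomorphic on $Z$. There is a unique field of bilinear forms on the cotangent spaces of $\mathcal A$ whose bracket is induced by the one on $\mathcal A_0$ in the following sense: if the pullbacks to $Z$ of functions $f,h$ on $\mathcal A$ are locally the restrictions of $SL(n,\mathbb C)$-invariant holomorphic functions $F,H$ on $\mathcal A_0$, then the pullback of $\{f,h\}_{\mathcal A}$ is locally the restriction of $\{F,H\}$. It is a holomorphic Poisson structure, and it is non-degenerate. The corresponding form $\omega_{\mathcal A}$ (that is, $\omega_{\mathcal A}(X_f,X_h)=\{f,h\}_{\mathcal A}$ for the Hamiltonian vector fields $X_f=\{f,\cdot\}_{\mathcal A}$, $X_h=\{h,\cdot\}_{\mathcal A}$)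 is a holomorphic symplectic form, and its pullback to $Z$ is $$\pi^*\omega_{\mathcal A}=\sum_{k=1}^N\Big(-\mathrm{tr}\big(L_kG_k^{-1}dG_k\wedge G_k^{-1}dG_k\big)+\mathrm{tr}\big(dL_k\wedge G_k^{-1}dG_k\big)\Big)\Big|_Z .$$ Moreover there is a holomorphic $1$-form $\theta_{\mathcal A}$ on $\mathcal A$ with $$\pi^*\theta_{\mathcal A}=\sum_{k=1}^N\mathrm{tr}\big(L_kG_k^{-1}dG_k\big)\Big|_Z\qquad\text{and}\qquad d\theta_{\mathcal A}=\omega_{\mathcal A}.$$ -/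

import Mathlib

open scoped ContDiff Manifold Kronecker Topology

noncomputable section

namespace GLReduction

/-! ### Pairs `(G_k, L_k)` and the ambient vector space

A point of the ambient space is a family of pairs (entries of `G_k`, diagonal entries of `L_k`),
so that all spaces of the construction are subsets of a finite dimensional normed space. -/

abbrev Ambient (N n : ℕ) : Type := Fin N → (Fin n → Fin n → ℂ) × (Fin n → ℂ)

variable {N n : ℕ}

/-- The matrix `G_k`. -/
def matG (x : Ambient N n) (k : Fin N) : Matrix (Fin n) (Fin n) ℂ := Matrix.of (x k).1

/-- The eigenvalues `λ_1, …, λ_n` of `L_k`. -/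
def eig (x : Ambient N n) (k : Fin N) : Fin n → ℂ := (x k).2

/-- The diagonal matrix `L_k`. -/
def matL (x : Ambient N n) (k : Fin N) : Matrix (Fin n) (Fin n) ℂ := Matrix.diagonal (eig x k)

/-- The space `𝒜₀`: `det G_k = 1`, and `L_k` is diagonal and traceless with distinct eigenvalues. -/
def phaseSpace (N n : ℕ) : Set (Ambient N n) :=
  {x | ∀ k, (matG x k).det = 1 ∧ (∑ i, eig x k i) = 0 ∧ Function.Injective (eig x k)}

/-- The eigenvalues of every `L_k` do not differ by integers. -/
def NonResonant (x : Ambient N n) : Prop :=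
  ∀ k, ∀ i j, i ≠ j → ∀ m : ℤ, eig x k i - eig x k j ≠ (m : ℂ)

/-- `∑ G_k L_k G_k⁻¹`. -/
def moment (x : Ambient N n) : Matrix (Fin n) (Fin n) ℂ :=
  ∑ k, matG x k * matL x k * (matG x k)⁻¹

/-- Left multiplication `G_k ↦ S G_k`, `L_k ↦ L_k` by one matrix `S` for all `k`. -/
def leftMul (S : Matrix (Fin n) (Fin n) ℂ) (x : Ambient N n) : Ambient N n :=
  fun k => (fun i j => (S * matG x k) i j, eig x k)

/-- The infinitesimal action of `X ∈ sl(n)`: the vector field `(X G_k, 0)`. -/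
def infAction (X : Matrix (Fin n) (Fin n) ℂ) (x : Ambient N n) : Ambient N n :=
  fun k => (fun i j => (X * matG x k) i j, 0)

/-! ### The Poisson structure on `𝒜₀` given by the dynamical `r`-matrix

Rows and columns of an `n² × n²` matrix are indexed by pairs, and
`{A¹, B²}` is the matrix with entry `{A b j, B c l}` in row `(b, c)` and column `(j, l)`. -/

/-- The dynamical `r`-matrix
`r(L) = ∑_{i<j} (E_ij ⊗ E_ji - E_ji ⊗ E_ij) / (λ_i - λ_j)`. -/
def dynR (lam : Fin n → ℂ) : Matrix (Fin n × Fin n) (Fin n × Fin n) ℂ :=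
  ∑ i, ∑ j, if i < j then
    (1 / (lam i - lam j)) •
      (Matrix.single i j (1 : ℂ) ⊗ₖ Matrix.single j i (1 : ℂ)
        - Matrix.single j i (1 : ℂ) ⊗ₖ Matrix.single i j (1 : ℂ))
    else 0

/-- `Ω = ∑ E_ii ⊗ E_ii - (1/n) 1 ⊗ 1`. -/
def Omega (n : ℕ) : Matrix (Fin n × Fin n) (Fin n × Fin n) ℂ :=
  (∑ i, Matrix.single i i (1 : ℂ) ⊗ₖ Matrix.single i i (1 : ℂ))
    - (1 / (n : ℂ)) • ((1 : Matrix (Fin n) (Fin n) ℂ) ⊗ₖ (1 : Matrix (Fin n) (Fin n) ℂ))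

/-- `{G_j¹, G_k²} = - G_j¹ G_k² r(L_k) δ_jk`. -/
def bracketGG (x : Ambient N n) (j k : Fin N) : Matrix (Fin n × Fin n) (Fin n × Fin n) ℂ :=
  if j = k then
    -((matG x j ⊗ₖ (1 : Matrix (Fin n) (Fin n) ℂ)) * ((1 : Matrix (Fin n) (Fin n) ℂ) ⊗ₖ matG x k)
      * dynR (eig x k))
  else 0

/-- `{G_j¹, L_k²} = - G_k¹ Ω δ_jk`. -/
def bracketGL (x : Ambient N n) (j k : Fin N) : Matrix (Fin n × Fin n) (Fin n × Fin n) ℂ :=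
  if j = k then -((matG x k ⊗ₖ (1 : Matrix (Fin n) (Fin n) ℂ)) * Omega n) else 0

/-- The coordinate vector of the entry `(a, b)` of `G_k`. -/
def unitG (k : Fin N) (a b : Fin n) : Ambient N n :=
  Pi.single k (Pi.single a (Pi.single b 1), 0)

/-- The coordinate vector of the `i`-th eigenvalue of `L_k`. -/
def unitL (k : Fin N) (i : Fin n) : Ambient N n := Pi.single k (0, Pi.single i 1)

/-- The Poisson bivector at `x`, evaluated on two covectors: the sum over all pairs of coordinates
of the bracket of the coordinates times the corresponding components of the covectors. The
coordinates of the `L_k` Poisson commute. -/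
def bivector (x : Ambient N n) (α β : Ambient N n →L[ℂ] ℂ) : ℂ :=
  ∑ j, ∑ k,
    ((∑ a, ∑ b, ∑ c, ∑ d, bracketGG x j k (a, c) (b, d) * (α (unitG j a b) * β (unitG k c d)))
      + ∑ a, ∑ b, ∑ i, bracketGL x j k (a, i) (b, i) *
          (α (unitG j a b) * β (unitL k i) - β (unitG j a b) * α (unitL k i)))

/-- The bracket `{F, H}` on `𝒜₀`. At points of `𝒜₀` all `det G_k` and `tr L_k` are Casimirs, so there
the value depends only on the restrictions of `F` and `H` to `𝒜₀`. -/
def bracket (F H : Ambient N n → ℂ) (x : Ambient N n) : ℂ :=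
  bivector x (fderiv ℂ F x) (fderiv ℂ H x)

/-- `∑ G_k L_k G_k⁻¹` is the moment map of the action `G_k ↦ S G_k` on `𝒜₀`: for each `X ∈ sl(n)`
the Hamiltonian `tr (X m)` generates the infinitesimal action of `X`, and `m` is equivariant. -/
def IsMomentMap (N n : ℕ) : Prop :=
  (∀ x ∈ phaseSpace N n, ∀ X : Matrix (Fin n) (Fin n) ℂ, X.trace = 0 →
    ∀ F : Ambient N n → ℂ, AnalyticAt ℂ F x →
      bracket (fun y => (X * moment y).trace) F x = fderiv ℂ F x (infAction X x)) ∧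
  (∀ x ∈ phaseSpace N n, ∀ S : Matrix.SpecialLinearGroup (Fin n) ℂ,
    leftMul (S : Matrix (Fin n) (Fin n) ℂ) x ∈ phaseSpace N n ∧
    moment (leftMul (S : Matrix (Fin n) (Fin n) ℂ) x)
      = (S : Matrix (Fin n) (Fin n) ℂ) * moment x * (S : Matrix (Fin n) (Fin n) ℂ)⁻¹)

/-! ### The reduced space `𝒜` -/

/-- The points of `𝒜₀` with non-resonant `L_k` in the zero level set of the moment map. -/
abbrev ZeroLevel (N n : ℕ) : Type :=
  {x : Ambient N n // x ∈ phaseSpace N n ∧ NonResonant x ∧ moment x = 0}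

theorem leftMul_one (x : Ambient N n) : leftMul 1 x = x := by
  funext k
  simp [leftMul, matG, eig]

theorem leftMul_leftMul (S T : Matrix (Fin n) (Fin n) ℂ) (x : Ambient N n) :
    leftMul S (leftMul T x) = leftMul (S * T) x := by
  funext k
  refine Prod.ext ?_ rfl
  funext i j
  have h : matG (leftMul T x) k = T * matG x k := rfl
  show (S * matG (leftMul T x) k) i j = (S * T * matG x k) i j
  rw [h, Matrix.mul_assoc]

/-- Two points are equivalent if `G_k' = S G_k` and `L_k' = L_k` for all `k`, for one `S ∈ SL(n)`. -/
instance orbitSetoid (N n : ℕ) : Setoid (ZeroLevel N n) where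
  r x y := ∃ S : Matrix.SpecialLinearGroup (Fin n) ℂ,
    (y : Ambient N n) = leftMul (S : Matrix (Fin n) (Fin n) ℂ) x
  iseqv :=
    { refl := fun x => ⟨1, by simp [leftMul_one]⟩
      symm := by
        rintro x y ⟨S, h⟩
        refine ⟨S⁻¹, ?_⟩
        rw [h, leftMul_leftMul, ← Matrix.SpecialLinearGroup.coe_mul, inv_mul_cancel,
          Matrix.SpecialLinearGroup.coe_one, leftMul_one]
      trans := by
        rintro x y z ⟨S, h⟩ ⟨T, h'⟩
        refine ⟨T * S, ?_⟩
        rw [h', h, leftMul_leftMul, Matrix.SpecialLinearGroup.coe_mul] }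

/-- The space `𝒜` of orbits, with the quotient topology. -/
def Reduced (N n : ℕ) : Type := Quotient (orbitSetoid N n)

instance (N n : ℕ) : TopologicalSpace (Reduced N n) :=
  inferInstanceAs (TopologicalSpace (Quotient (orbitSetoid N n)))

/-- The projection of the zero level set onto `𝒜`. -/
def proj (x : ZeroLevel N n) : Reduced N n := Quotient.mk (orbitSetoid N n) x

/-- The function `f` on the zero level set is holomorphic at `x`: near `x` it is the restriction of
a holomorphic function on an open set of the ambient space. -/
def HolomorphicAtLevel (f : ZeroLevel N n → ℂ) (x : ZeroLevel N n) : Prop :=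
  ∃ F : Ambient N n → ℂ, AnalyticAt ℂ F (x : Ambient N n) ∧ ∀ᶠ z in 𝓝 x, f z = F (z : Ambient N n)

/-- The atlas makes `𝒜` a complex manifold (Hausdorff, second countable) of dimension `d`, the
quotient of the zero level set: a function on an open set of `𝒜` is holomorphic if and only if its
pullback to the zero level set is. -/
def IsQuotientManifold (N n d : ℕ) [ChartedSpace (Fin d → ℂ) (Reduced N n)] : Prop :=
  T2Space (Reduced N n) ∧ SecondCountableTopology (Reduced N n) ∧
  IsManifold 𝓘(ℂ, Fin d → ℂ) ω (Reduced N n) ∧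
  ∀ U : Set (Reduced N n), IsOpen U → ∀ f : Reduced N n → ℂ,
    ContMDiffOn 𝓘(ℂ, Fin d → ℂ) 𝓘(ℂ, ℂ) ω f U ↔
      ∀ x : ZeroLevel N n, proj x ∈ U → HolomorphicAtLevel (fun z => f (proj z)) x

/-! ### Poisson structures and differential forms on a complex manifold `M` of dimension `d` -/

section Manifold

variable (d : ℕ) (M : Type) [TopologicalSpace M] [ChartedSpace (Fin d → ℂ) M]

/-- A field of bilinear forms on the cotangent spaces. -/
abbrev CotangentPairing : Type :=
  ∀ p : M, (TangentSpace 𝓘(ℂ, Fin d → ℂ) p →L[ℂ] ℂ) →ₗ[ℂ]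
    (TangentSpace 𝓘(ℂ, Fin d → ℂ) p →L[ℂ] ℂ) →ₗ[ℂ] ℂ

/-- A field of alternating `k`-forms on the tangent spaces. -/
abbrev FormField (k : ℕ) : Type :=
  ∀ p : M, TangentSpace 𝓘(ℂ, Fin d → ℂ) p [⋀^Fin k]→L[ℂ] ℂ

variable {d M}

/-- The differential of a function at `p`, as a covector. -/
def dAt (f : M → ℂ) (p : M) : TangentSpace 𝓘(ℂ, Fin d → ℂ) p →L[ℂ] ℂ :=
  mfderiv 𝓘(ℂ, Fin d → ℂ) 𝓘(ℂ, ℂ) f p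

/-- The bracket of two functions defined by a field of bilinear forms on the cotangent spaces. -/
def pbracket (P : CotangentPairing d M) (f g : M → ℂ) (p : M) : ℂ := P p (dAt f p) (dAt g p)

/-- `P` is a holomorphic Poisson structure: it is skew-symmetric, the bracket of two holomorphic
functions on an open set is holomorphic, and the Jacobi identity holds. (Bilinearity and the
Leibniz rule hold as `P` is a field of bilinear forms on cotangent spaces.) -/
def IsPoisson (P : CotangentPairing d M) : Prop :=
  (∀ p α, P p α α = 0) ∧
  (∀ U : Set M, IsOpen U → ∀ f g : M → ℂ,
    ContMDiffOn 𝓘(ℂ, Fin d → ℂ) 𝓘(ℂ, ℂ) ω f U → ContMDiffOn 𝓘(ℂ, Fin d → ℂ) 𝓘(ℂ, ℂ) ω g U →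
    ContMDiffOn 𝓘(ℂ, Fin d → ℂ) 𝓘(ℂ, ℂ) ω (pbracket P f g) U) ∧
  (∀ U : Set M, IsOpen U → ∀ f g h : M → ℂ,
    ContMDiffOn 𝓘(ℂ, Fin d → ℂ) 𝓘(ℂ, ℂ) ω f U → ContMDiffOn 𝓘(ℂ, Fin d → ℂ) 𝓘(ℂ, ℂ) ω g U →
    ContMDiffOn 𝓘(ℂ, Fin d → ℂ) 𝓘(ℂ, ℂ) ω h U → ∀ p ∈ U,
    pbracket P f (pbracket P g h) p + pbracket P g (pbracket P h f) p
      + pbracket P h (pbracket P f g) p = 0)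

/-- Non-degeneracy of a Poisson structure: at each point only the zero covector pairs to zero with
all covectors. -/
def PoissonNondegenerate (P : CotangentPairing d M) : Prop :=
  ∀ p α, (∀ β, P p α β = 0) → α = 0

/-- The expression of a form in the chart `e`, that is, its pullback by the inverse of `e`. -/
def chartForm {k : ℕ} (η : FormField d M k) (e : OpenPartialHomeomorph M (Fin d → ℂ))
    (u : Fin d → ℂ) : (Fin d → ℂ) [⋀^Fin k]→L[ℂ] ℂ :=
  (η (e.symm u)).compContinuousLinearMap
    (mfderiv 𝓘(ℂ, Fin d → ℂ) 𝓘(ℂ, Fin d → ℂ) e.symm u)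

/-- A holomorphic differential form: holomorphic in each chart. -/
def IsHolomorphicForm {k : ℕ} (η : FormField d M k) : Prop :=
  ∀ e ∈ atlas (Fin d → ℂ) M, AnalyticOnNhd ℂ (chartForm η e) e.target

/-- `dη = ζ`, in each chart. -/
def IsExteriorDerivative {k : ℕ} (η : FormField d M k) (ζ : FormField d M (k + 1)) : Prop :=
  ∀ e ∈ atlas (Fin d → ℂ) M, ∀ u ∈ e.target, extDeriv (chartForm η e) u = chartForm ζ e u

/-- A holomorphic symplectic form: holomorphic, closed and non-degenerate. -/
def IsSymplecticForm (sigma : FormField d M 2) : Prop :=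
  IsHolomorphicForm sigma ∧ IsExteriorDerivative sigma (fun _ => 0) ∧
  ∀ (p : M) (v : TangentSpace 𝓘(ℂ, Fin d → ℂ) p), (∀ w, sigma p ![v, w] = 0) → v = 0

/-- The Poisson structure `P` and the non-degenerate form `σ` correspond to each other:
`P (σ(v, ·), σ(w, ·)) = σ(v, w)`. -/
def Corresponds (P : CotangentPairing d M) (sigma : FormField d M 2) : Prop :=
  ∀ (p : M) (v w : TangentSpace 𝓘(ℂ, Fin d → ℂ) p)
    (α β : TangentSpace 𝓘(ℂ, Fin d → ℂ) p →L[ℂ] ℂ),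
    (∀ u, α u = sigma p ![v, u]) → (∀ u, β u = sigma p ![w, u]) → P p α β = sigma p ![v, w]

end Manifold

/-! ### The reduction -/

/-- `F` is an `SL(n)`-invariant holomorphic function on the open part `W ∩ 𝒜₀` of `𝒜₀` (given with a
holomorphic extension to the open set `W` of the ambient space). -/
def IsInvariantHolomorphic (W : Set (Ambient N n)) (F : Ambient N n → ℂ) : Prop :=
  AnalyticOnNhd ℂ F W ∧
  ∀ x ∈ phaseSpace N n, ∀ S : Matrix.SpecialLinearGroup (Fin n) ℂ, x ∈ W →
    leftMul (S : Matrix (Fin n) (Fin n) ℂ) x ∈ W →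
    F (leftMul (S : Matrix (Fin n) (Fin n) ℂ) x) = F x

/-- `P` is induced by the bracket on `𝒜₀` via the reduction: if `f`, `h` are functions on `𝒜` whose
pullbacks to the zero level set are the restrictions of invariant functions `F`, `H` on `𝒜₀`, then
the pullback of `{f, h}` to the zero level set is the restriction of `{F, H}`. -/
def IsReducedPoisson {d : ℕ} [ChartedSpace (Fin d → ℂ) (Reduced N n)]
    (P : CotangentPairing d (Reduced N n)) : Prop :=
  ∀ W : Set (Ambient N n), IsOpen W → ∀ F H : Ambient N n → ℂ,
    IsInvariantHolomorphic W F → IsInvariantHolomorphic W H →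
    ∀ f h : Reduced N n → ℂ,
    (∀ z : ZeroLevel N n, (z : Ambient N n) ∈ W → f (proj z) = F z) →
    (∀ z : ZeroLevel N n, (z : Ambient N n) ∈ W → h (proj z) = H z) →
    ∀ x : ZeroLevel N n, (x : Ambient N n) ∈ W → pbracket P f h (proj x) = bracket F H x

/-- The pullback of the form `η` on `𝒜` to the zero level set is the restriction of the form `ηhat`
on the ambient space: they have the same pullback under every holomorphic map `φ` from an open set
of some `ℂ^m` to the zero level set. -/
def PullsBackTo {d k : ℕ} [ChartedSpace (Fin d → ℂ) (Reduced N n)]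
    (η : FormField d (Reduced N n) k) (ηhat : Ambient N n → (Fin k → Ambient N n) → ℂ) : Prop :=
  ∀ (m : ℕ) (V : Set (Fin m → ℂ)), IsOpen V → ∀ φ : (Fin m → ℂ) → ZeroLevel N n,
    AnalyticOnNhd ℂ (fun u => (φ u : Ambient N n)) V → ∀ u ∈ V, ∀ v : Fin k → (Fin m → ℂ),
    η (proj (φ u))
        (fun i => mfderiv 𝓘(ℂ, Fin m → ℂ) 𝓘(ℂ, Fin d → ℂ) (fun u' => proj (φ u')) u (v i))
      = ηhat (φ u) (fun i => fderiv ℂ (fun u' => (φ u' : Ambient N n)) u (v i))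

/-- `∑ tr (L_k G_k⁻¹ dG_k)`. -/
def thetaHat (x : Ambient N n) (v : Fin 1 → Ambient N n) : ℂ :=
  ∑ k, (matL x k * ((matG x k)⁻¹ * matG (v 0) k)).trace

/-- `∑ (- tr (L_k G_k⁻¹ dG_k ∧ G_k⁻¹ dG_k) + tr (dL_k ∧ G_k⁻¹ dG_k))`, where
`(α ∧ β)(v, w) = α(v) β(w) - α(w) β(v)`. -/
def omegaHat (x : Ambient N n) (v : Fin 2 → Ambient N n) : ℂ :=
  ∑ k,
    (-(matL x k * (((matG x k)⁻¹ * matG (v 0) k) * ((matG x k)⁻¹ * matG (v 1) k)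
          - ((matG x k)⁻¹ * matG (v 1) k) * ((matG x k)⁻¹ * matG (v 0) k))).trace
      + (matL (v 0) k * ((matG x k)⁻¹ * matG (v 1) k)
          - matL (v 1) k * ((matG x k)⁻¹ * matG (v 0) k)).trace)

end GLReduction

end

open GLReduction

/-! # Reduction of the space of families `(G_k, L_k)` by `SL(n)`

On the phase space the bivector is inverse to the two-form `omegaHat`: the Hamiltonian vector
`sharp x α` of a covector `α` (`bivector_eq_sharp`) satisfies `omegaHat (sharp α, W) = -α W` for all
tangent vectors `W` of the phase space (`omegaHat_sharp`). Moreover `omegaHat` is the exterior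
derivative of `thetaHat` (`extDeriv_thetaForm`). A short computation shows that contraction of
`omegaHat` with the infinitesimal action of `X` is minus the differential of `tr (X m)`
(`omegaHat_infAction`), so the moment map property follows.

The group acts freely on the zero level set and the action has a global slice: every orbit contains
exactly one point with `G_0 = 1`. Thus `𝒜` embeds into the ambient vector space by `sliceIncl`, with
image the non-resonant part of the zero set of `sliceEq`. At its points the equations are
independent (`dSliceEq_surjective`), because commutators with a diagonal matrix with distinct
eigenvalues and diagonal matrices span all matrices. The implicit function theorem gives charts
(`exists_analyticChart`); the atlas consists of all charts that are analytic with respect to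
`sliceIncl`. The projection, seen in the ambient space, is the map `gauge`, which multiplies by
`G_0⁻¹`.

The forms on `𝒜` are the pullbacks by `sliceIncl` of `thetaHat` and its exterior derivative. Their
pullbacks to the zero level set are as claimed, as the derivative of `gauge` is a left translation
up to an infinitesimal action (`fderiv_gauge`), and the latter lies in the kernel of the restricted
forms. Every tangent vector of the zero level set is the sum of a translate of a tangent vector of
the slice and of a vector tangent to the orbit (`exists_sliceDeriv_add_infAction`). Applied to the
Hamiltonian vector of an invariant function, which is tangent to the level set
(`dMoment_sharp_eq_zero`), this yields the Hamiltonian vector of the induced function with respect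
to the reduced form (`exists_reduced_sharp`). This gives the non-degeneracy of the reduced form, and
it identifies its inverse with the reduced bracket. The bracket is unique because the functions
`l ∘ sliceIncl` with `l` linear are induced by invariant functions, and their differentials exhaust
the cotangent spaces. The Jacobi identity holds for the inverse of any closed non-degenerate
two-form (`isPoisson_poissonOfForm`).
-/

noncomputable section

namespace GLReduction

variable {N n : ℕ}

/-! ### Coordinates of the ambient space -/

/-- The ambient point with prescribed matrices and eigenvalues. -/
def mkAmbient (A : Fin N → Matrix (Fin n) (Fin n) ℂ) (l : Fin N → Fin n → ℂ) : Ambient N n :=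
  fun k => (A k, l k)

@[simp] theorem matG_mkAmbient (A : Fin N → Matrix (Fin n) (Fin n) ℂ) (l : Fin N → Fin n → ℂ)
    (k : Fin N) : matG (mkAmbient A l) k = A k := rfl

@[simp] theorem eig_mkAmbient (A : Fin N → Matrix (Fin n) (Fin n) ℂ) (l : Fin N → Fin n → ℂ)
    (k : Fin N) : eig (mkAmbient A l) k = l k := rfl

@[simp] theorem matL_mkAmbient (A : Fin N → Matrix (Fin n) (Fin n) ℂ) (l : Fin N → Fin n → ℂ)
    (k : Fin N) : matL (mkAmbient A l) k = Matrix.diagonal (l k) := rfl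

theorem ambient_ext {x y : Ambient N n} (h₁ : ∀ k, matG x k = matG y k)
    (h₂ : ∀ k, eig x k = eig y k) : x = y := by
  funext k
  exact Prod.ext (h₁ k) (h₂ k)

@[simp] theorem matG_leftMul (S : Matrix (Fin n) (Fin n) ℂ) (x : Ambient N n) (k : Fin N) :
    matG (leftMul S x) k = S * matG x k := rfl

@[simp] theorem eig_leftMul (S : Matrix (Fin n) (Fin n) ℂ) (x : Ambient N n) (k : Fin N) :
    eig (leftMul S x) k = eig x k := rfl

@[simp] theorem matL_leftMul (S : Matrix (Fin n) (Fin n) ℂ) (x : Ambient N n) (k : Fin N) :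
    matL (leftMul S x) k = matL x k := rfl

@[simp] theorem matG_infAction (X : Matrix (Fin n) (Fin n) ℂ) (x : Ambient N n) (k : Fin N) :
    matG (infAction X x) k = X * matG x k := rfl

@[simp] theorem eig_infAction (X : Matrix (Fin n) (Fin n) ℂ) (x : Ambient N n) (k : Fin N) :
    eig (infAction X x) k = 0 := rfl

@[simp] theorem matL_infAction (X : Matrix (Fin n) (Fin n) ℂ) (x : Ambient N n) (k : Fin N) :
    matL (infAction X x) k = 0 := by
  simp [matL]

@[simp] theorem matG_add (x y : Ambient N n) (k : Fin N) :
    matG (x + y) k = matG x k + matG y k := rfl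

@[simp] theorem eig_add (x y : Ambient N n) (k : Fin N) : eig (x + y) k = eig x k + eig y k := rfl

@[simp] theorem matG_smul (c : ℂ) (x : Ambient N n) (k : Fin N) :
    matG (c • x) k = c • matG x k := rfl

@[simp] theorem eig_smul (c : ℂ) (x : Ambient N n) (k : Fin N) : eig (c • x) k = c • eig x k := rfl

@[simp] theorem matG_sub (x y : Ambient N n) (k : Fin N) :
    matG (x - y) k = matG x k - matG y k := rfl

@[simp] theorem eig_sub (x y : Ambient N n) (k : Fin N) : eig (x - y) k = eig x k - eig y k := rfl

@[simp] theorem matG_zero (k : Fin N) : matG (0 : Ambient N n) k = 0 := rfl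

@[simp] theorem eig_zero (k : Fin N) : eig (0 : Ambient N n) k = 0 := rfl

@[simp] theorem matL_add (x y : Ambient N n) (k : Fin N) :
    matL (x + y) k = matL x k + matL y k := by
  simp only [matL, eig_add, Matrix.diagonal_add]; rfl

@[simp] theorem matL_smul (c : ℂ) (x : Ambient N n) (k : Fin N) :
    matL (c • x) k = c • matL x k := by
  simp [matL]

/-! ### The bivector and its sharp map -/

/-- The two terms of each summand of the `r`-matrix contribute entries given by the same formula, so
that the order of the indices drops out. -/
theorem dynR_apply (lam : Fin n → ℂ) (p q b d : Fin n) :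
    dynR lam (p, q) (b, d) = if p = d ∧ q = b ∧ p ≠ q then 1 / (lam p - lam q) else 0 := by
  have key : ∀ i j, (if i < j then (1 / (lam i - lam j)) •
      (Matrix.single i j (1 : ℂ) ⊗ₖ Matrix.single j i (1 : ℂ)
        - Matrix.single j i (1 : ℂ) ⊗ₖ Matrix.single i j (1 : ℂ)) else 0) (p, q) (b, d)
      = if i < j then (1 / (lam i - lam j)) *
        ((if i = p ∧ j = b then (if j = q ∧ i = d then 1 else 0) else 0)
          - (if j = p ∧ i = b then (if i = q ∧ j = d then 1 else 0) else 0)) else 0 := by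
    intro i j
    by_cases hij : i < j
    · simp only [if_pos hij, Matrix.smul_apply, Matrix.sub_apply, Matrix.kroneckerMap_apply,
        Matrix.single_apply, smul_eq_mul]
      grind
    · simp only [if_neg hij, Matrix.zero_apply]
  simp only [dynR, Matrix.sum_apply, key]
  by_cases h : p = d ∧ q = b ∧ p ≠ q
  · rw [if_pos h]
    obtain ⟨rfl, rfl, hne⟩ := h
    rcases lt_or_gt_of_ne hne with hlt | hlt
    · rw [Finset.sum_eq_single p, Finset.sum_eq_single q]
      · simp [hlt, hne.symm, hne]
      · intro j _ hj; simp [hj, hne]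
      · simp
      · intro i _ hi
        refine Finset.sum_eq_zero fun j _ => ?_
        split_ifs with h1 <;> simp_all
        omega
      · simp
    · rw [Finset.sum_eq_single q, Finset.sum_eq_single p]
      · simp [hlt, hne.symm]
        rw [← neg_sub, inv_neg, neg_neg]
      · intro j _ hj; simp [hj, hne.symm]
      · simp
      · intro i _ hi
        refine Finset.sum_eq_zero fun j _ => ?_
        split_ifs with h1 <;> simp_all
        omega
      · simp
  · rw [if_neg h]
    refine Finset.sum_eq_zero fun i _ => Finset.sum_eq_zero fun j _ => ?_
    grind

theorem Omega_apply (p q b d : Fin n) :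
    Omega n (p, q) (b, d) = (if p = q ∧ q = b ∧ b = d then 1 else 0)
      - (1 / (n : ℂ)) * (if p = b ∧ q = d then 1 else 0) := by
  simp only [Omega, Matrix.sub_apply, Matrix.sum_apply, Matrix.kroneckerMap_apply,
    Matrix.single_apply, Matrix.smul_apply, Matrix.one_apply, smul_eq_mul]
  congr 1
  · by_cases h : p = q ∧ q = b ∧ b = d
    · obtain ⟨rfl, rfl, rfl⟩ := h
      simp
    · rw [if_neg h]
      refine Finset.sum_eq_zero fun i _ => ?_
      grind
  · grind

theorem bracketGG_self_apply (x : Ambient N n) (k : Fin N) (a c b d : Fin n) :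
    bracketGG x k k (a, c) (b, d)
      = if d = b then 0 else -(matG x k a d * matG x k c b / (eig x k d - eig x k b)) := by
  rw [bracketGG, if_pos rfl, ← Matrix.mul_kronecker_mul, Matrix.neg_apply, Matrix.mul_apply,
    Fintype.sum_prod_type]
  simp only [Matrix.mul_one, Matrix.one_mul, Matrix.kroneckerMap_apply, dynR_apply]
  rw [Finset.sum_eq_single d, Finset.sum_eq_single b]
  · split_ifs <;> simp_all [div_eq_mul_inv]
  · intro j _ hj; simp [hj]
  · simp
  · intro j _ hj; simp [hj]
  · simp

theorem bracketGL_self_apply (x : Ambient N n) (k : Fin N) (a i b : Fin n) :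
    bracketGL x k k (a, i) (b, i)
      = matG x k a b / n - (if b = i then matG x k a i else 0) := by
  rw [bracketGL, if_pos rfl, Matrix.neg_apply, Matrix.mul_apply, Fintype.sum_prod_type]
  simp only [Matrix.kroneckerMap_apply, Omega_apply, Matrix.one_apply]
  have : ∀ p, ∑ q, (matG x k a p * if i = q then 1 else 0) *
      ((if p = q ∧ q = b ∧ b = i then 1 else 0) - 1 / (n : ℂ) * if p = b ∧ q = i then 1 else 0)
      = matG x k a p * ((if p = i ∧ i = b then 1 else 0) - 1 / (n : ℂ) * if p = b then 1 else 0) := by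
    intro p
    rw [Finset.sum_eq_single i]
    · grind
    · intro j _ hj; simp [hj.symm]
    · simp
  simp only [this]
  simp only [mul_sub, Finset.sum_sub_distrib]
  have h2 : ∑ p, matG x k a p * (1 / (n : ℂ) * if p = b then 1 else 0) = matG x k a b / n := by
    simp [div_eq_mul_inv]
  have h1 : ∑ p, (matG x k a p * if p = i ∧ i = b then (1 : ℂ) else 0)
      = if b = i then matG x k a i else 0 := by
    by_cases h : i = b
    · subst h; simp
    · simp [h, Ne.symm h]
  rw [h1, h2]
  ring

/-- The components of a covector along the entries of `G_k`. -/
def covG (α : Ambient N n →L[ℂ] ℂ) (k : Fin N) : Matrix (Fin n) (Fin n) ℂ :=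
  Matrix.of fun a b => α (unitG k a b)

/-- The components of a covector along the eigenvalues of `L_k`. -/
def covL (α : Ambient N n →L[ℂ] ℂ) (k : Fin N) (i : Fin n) : ℂ := α (unitL k i)

theorem covector_apply (α : Ambient N n →L[ℂ] ℂ) (V : Ambient N n) :
    α V = ∑ k, ((∑ a, ∑ b, covG α k a b * matG V k a b) + ∑ i, covL α k i * eig V k i) := by
  have hV : V = ∑ k, ((∑ a, ∑ b, (V k).1 a b • unitG k a b) + ∑ i, (V k).2 i • unitL k i) := by
    refine funext fun l => Prod.ext (funext fun c => funext fun d => ?_) (funext fun c => ?_)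
    · have h1 : ∀ k a b, (unitG k a b l).1 c d
          = if l = k then (if c = a then (if d = b then (1 : ℂ) else 0) else 0) else 0 := by
        intro k a b
        simp only [unitG, Pi.single_apply]
        split_ifs <;> simp_all
      have h2 : ∀ k i, (unitL k i l).1 c d = (0 : ℂ) := by
        intro k i
        simp only [unitL, Pi.single_apply]
        split_ifs <;> simp
      simp only [Finset.sum_apply, Prod.fst_sum, Prod.fst_add, Pi.add_apply,
        Pi.smul_apply, Prod.smul_fst, h1, h2]
      simp
    · have h1 : ∀ k i, (unitL k i l).2 c = if l = k then (if c = i then (1 : ℂ) else 0) else 0 := by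
        intro k i
        simp only [unitL, Pi.single_apply]
        split_ifs <;> simp_all
      have h2 : ∀ k a b, (unitG k a b l).2 c = (0 : ℂ) := by
        intro k a b
        simp only [unitG, Pi.single_apply]
        split_ifs <;> simp
      simp only [Finset.sum_apply, Prod.snd_sum, Prod.snd_add, Pi.add_apply,
        Pi.smul_apply, Prod.smul_snd, h1, h2]
      simp
  conv_lhs => rw [hV]
  simp only [map_sum, map_add, map_smul, smul_eq_mul, covG, covL, Matrix.of_apply]
  simp only [mul_comm]
  rfl

/-- The matrix `A_k` for which `tr (A_k g)` is the value of the covector on the tangent vector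
`dG_k = G_k g`. -/
def bodyCov (x : Ambient N n) (α : Ambient N n →L[ℂ] ℂ) (k : Fin N) :
    Matrix (Fin n) (Fin n) ℂ := (covG α k).transpose * matG x k

theorem bodyCov_apply (x : Ambient N n) (α : Ambient N n →L[ℂ] ℂ) (k : Fin N) (i j : Fin n) :
    bodyCov x α k i j = ∑ a, covG α k a i * matG x k a j := by
  simp [bodyCov, Matrix.mul_apply]

/-- The left-trivialised `G_k`-component of the Hamiltonian vector of a covector. Subtracting the
mean makes it trace free. -/
def sharpBody (x : Ambient N n) (α : Ambient N n →L[ℂ] ℂ) (k : Fin N) :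
    Matrix (Fin n) (Fin n) ℂ :=
  Matrix.of fun i j => if i = j then covL α k i - (∑ p, covL α k p) / n
    else bodyCov x α k i j / (eig x k i - eig x k j)

/-- The `L_k`-component of the Hamiltonian vector of a covector. -/
def sharpEig (x : Ambient N n) (α : Ambient N n →L[ℂ] ℂ) (k : Fin N) : Fin n → ℂ :=
  fun i => -(bodyCov x α k i i - (∑ p, bodyCov x α k p p) / n)

/-- The Hamiltonian vector of a covector `α`: the vector on which covectors `β` take the value
`bivector x α β`. -/
def sharp (x : Ambient N n) (α : Ambient N n →L[ℂ] ℂ) : Ambient N n :=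
  mkAmbient (fun k => matG x k * sharpBody x α k) (sharpEig x α)

/-- The value of a covector on a tangent vector in left trivialisation, `dG_k = G_k g_k`. -/
theorem covector_mkAmbient (x : Ambient N n) (α : Ambient N n →L[ℂ] ℂ)
    (g : Fin N → Matrix (Fin n) (Fin n) ℂ) (l : Fin N → Fin n → ℂ) :
    α (mkAmbient (fun k => matG x k * g k) l)
      = ∑ k, ((bodyCov x α k * g k).trace + ∑ i, covL α k i * l k i) := by
  rw [covector_apply]
  refine Finset.sum_congr rfl fun k _ => ?_
  congr 1
  rw [bodyCov, Matrix.mul_assoc, Matrix.trace]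
  simp only [matG_mkAmbient, Matrix.diag, Matrix.mul_apply (M := (covG α k).transpose),
    Matrix.transpose_apply]
  exact Finset.sum_comm

theorem eq_mkAmbient {x : Ambient N n} (hx : ∀ k, (matG x k).det ≠ 0) (V : Ambient N n) :
    V = mkAmbient (fun k => matG x k * ((matG x k)⁻¹ * matG V k)) (eig V) := by
  refine ambient_ext (fun k => ?_) fun _ => rfl
  rw [matG_mkAmbient, Matrix.mul_nonsing_inv_cancel_left _ _ (isUnit_iff_ne_zero.mpr (hx k))]

theorem covector_apply_body {x : Ambient N n} (hx : ∀ k, (matG x k).det ≠ 0)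
    (α : Ambient N n →L[ℂ] ℂ) (V : Ambient N n) :
    α V = ∑ k, ((bodyCov x α k * ((matG x k)⁻¹ * matG V k)).trace
      + ∑ i, covL α k i * eig V k i) := by
  conv_lhs => rw [eq_mkAmbient hx V]
  exact covector_mkAmbient x α _ _

theorem sum_sum_sum_sum_comm (T : Fin n → Fin n → Fin n → Fin n → ℂ) :
    ∑ a, ∑ b, ∑ c, ∑ d, T a b c d = ∑ d, ∑ b, ∑ a, ∑ c, T a b c d :=
  calc ∑ a, ∑ b, ∑ c, ∑ d, T a b c d
      = ∑ a, ∑ b, ∑ d, ∑ c, T a b c d :=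
        Finset.sum_congr rfl fun _ _ => Finset.sum_congr rfl fun _ _ => Finset.sum_comm
    _ = ∑ a, ∑ d, ∑ b, ∑ c, T a b c d := Finset.sum_congr rfl fun _ _ => Finset.sum_comm
    _ = ∑ d, ∑ a, ∑ b, ∑ c, T a b c d := Finset.sum_comm
    _ = ∑ d, ∑ b, ∑ a, ∑ c, T a b c d := Finset.sum_congr rfl fun _ _ => Finset.sum_comm

/-- The contribution of the brackets of entries of `G_k` to the bivector. -/
theorem sum_bracketGG (x : Ambient N n) (α β : Ambient N n →L[ℂ] ℂ) (k : Fin N) :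
    ∑ a, ∑ b, ∑ c, ∑ d, bracketGG x k k (a, c) (b, d) * (α (unitG k a b) * β (unitG k c d))
      = ∑ d, ∑ b, if d = b then 0 else
          bodyCov x β k d b * (bodyCov x α k b d / (eig x k b - eig x k d)) := by
  have h1 : ∀ b d, (if d = b then 0 else
          bodyCov x β k d b * (bodyCov x α k b d / (eig x k b - eig x k d)))
      = ∑ a, ∑ c, bracketGG x k k (a, c) (b, d) * (α (unitG k a b) * β (unitG k c d)) := by
    intro b d
    simp only [bracketGG_self_apply]
    split_ifs with h
    · simp
    · rw [bodyCov_apply, bodyCov_apply, Finset.sum_div, Finset.sum_mul_sum, Finset.sum_comm]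
      refine Finset.sum_congr rfl fun a _ => Finset.sum_congr rfl fun c _ => ?_
      simp only [covG, Matrix.of_apply]
      rw [← neg_sub (eig x k d), div_neg]
      ring
  simp only [h1]
  exact sum_sum_sum_sum_comm fun a b c d =>
    bracketGG x k k (a, c) (b, d) * (α (unitG k a b) * β (unitG k c d))

/-- The contribution of the brackets of entries of `G_k` and eigenvalues of `L_k` to the
bivector. -/
theorem sum_bracketGL (x : Ambient N n) (α : Ambient N n →L[ℂ] ℂ) (u : Fin n → ℂ) (k : Fin N) :
    ∑ a, ∑ b, ∑ i, bracketGL x k k (a, i) (b, i) * (α (unitG k a b) * u i)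
      = -∑ i, bodyCov x α k i i * (u i - (∑ p, u p) / n) := by
  simp only [bracketGL_self_apply]
  have h1 : ∀ a b, ∑ i, (matG x k a b / n - if b = i then matG x k a i else 0)
      * (α (unitG k a b) * u i)
      = -(covG α k a b * matG x k a b) * (u b - (∑ p, u p) / n) := by
    intro a b
    simp only [sub_mul, Finset.sum_sub_distrib, ite_mul, zero_mul, Finset.sum_ite_eq,
      Finset.mem_univ, if_true, ← Finset.mul_sum, covG, Matrix.of_apply]
    ring
  simp only [h1]
  rw [Finset.sum_comm, ← Finset.sum_neg_distrib]
  refine Finset.sum_congr rfl fun b _ => ?_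
  rw [bodyCov_apply, ← Finset.sum_mul, Finset.sum_neg_distrib, neg_mul]

/-- Removing the mean is self-adjoint for the standard pairing. -/
theorem sum_mul_sub_mean (a u : Fin n → ℂ) :
    ∑ i, a i * (u i - (∑ p, u p) / n) = ∑ i, u i * (a i - (∑ p, a p) / n) := by
  simp only [mul_sub, Finset.sum_sub_distrib, ← Finset.sum_mul]
  simp only [mul_comm (a _)]
  ring

theorem bivector_eq_sharp (x : Ambient N n) (α β : Ambient N n →L[ℂ] ℂ) :
    bivector x α β = β (sharp x α) := by
  rw [sharp, covector_mkAmbient, bivector]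
  refine Finset.sum_congr rfl fun k _ => ?_
  -- different sites Poisson commute
  rw [Finset.sum_eq_single k]
  · rw [sum_bracketGG]
    simp only [mul_sub, Finset.sum_sub_distrib]
    have e1 : ∑ a, ∑ b, ∑ i, bracketGL x k k (a, i) (b, i) * (α (unitG k a b) * β (unitL k i)) = _ :=
      sum_bracketGL x α (covL β k) k
    have e2 : ∑ a, ∑ b, ∑ i, bracketGL x k k (a, i) (b, i) * (β (unitG k a b) * α (unitL k i)) = _ :=
      sum_bracketGL x β (covL α k) k
    rw [e1, e2]
    have h : (bodyCov x β k * sharpBody x α k).trace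
        = (∑ d, ∑ b, if d = b then 0 else
          bodyCov x β k d b * (bodyCov x α k b d / (eig x k b - eig x k d)))
          + ∑ i, bodyCov x β k i i * (covL α k i - (∑ p, covL α k p) / n) := by
      rw [Matrix.trace, ← Finset.sum_add_distrib]
      refine Finset.sum_congr rfl fun d _ => ?_
      rw [Matrix.diag, Matrix.mul_apply,
        ← Finset.sum_erase_add _ _ (Finset.mem_univ d),
        ← Finset.sum_erase_add (f := fun b => if d = b then 0 else _) _ (Finset.mem_univ d)]
      simp only [sharpBody, Matrix.of_apply, if_true, add_zero]
      congr 1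
      refine Finset.sum_congr rfl fun b hb => ?_
      have : b ≠ d := Finset.ne_of_mem_erase hb
      rw [if_neg this, if_neg this.symm]
    rw [h, sum_mul_sub_mean (fun i => bodyCov x α k i i)]
    simp only [sharpEig, mul_neg, Finset.sum_neg_distrib]
    ring
  · intro j _ hj
    simp [bracketGG, bracketGL, hj.symm]
  · simp

theorem bivector_neg_symm (x : Ambient N n) (α β : Ambient N n →L[ℂ] ℂ) :
    bivector x α β = -bivector x β α := by
  have h : ∀ γ δ : Ambient N n →L[ℂ] ℂ, ∀ k, (bodyCov x γ k * sharpBody x δ k).trace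
      = -(bodyCov x δ k * sharpBody x γ k).trace
        + ∑ i, bodyCov x γ k i i * (covL δ k i - (∑ p, covL δ k p) / n)
        + ∑ i, bodyCov x δ k i i * (covL γ k i - (∑ p, covL γ k p) / n) := by
    intro γ δ k
    simp only [Matrix.trace, Matrix.diag, Matrix.mul_apply]
    rw [Finset.sum_comm (f := fun i j => bodyCov x δ k i j * sharpBody x γ k j i)]
    rw [← Finset.sum_neg_distrib, ← Finset.sum_add_distrib, ← Finset.sum_add_distrib]
    refine Finset.sum_congr rfl fun i _ => ?_
    rw [← Finset.sum_erase_add _ _ (Finset.mem_univ i),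
        ← Finset.sum_erase_add (f := fun b => _ * sharpBody x γ k i b) _ (Finset.mem_univ i)]
    have : ∀ j ∈ Finset.univ.erase i, bodyCov x γ k i j * sharpBody x δ k j i
        = -(bodyCov x δ k j i * sharpBody x γ k i j) := by
      intro j hj
      have hj : j ≠ i := Finset.ne_of_mem_erase hj
      simp only [sharpBody, Matrix.of_apply, if_neg hj, if_neg hj.symm]
      rw [← neg_sub (eig x k i), div_neg]
      ring
    rw [Finset.sum_congr rfl this, Finset.sum_neg_distrib]
    simp only [sharpBody, Matrix.of_apply, if_true]
    ring
  rw [bivector_eq_sharp, bivector_eq_sharp, sharp, sharp, covector_mkAmbient, covector_mkAmbient,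
    ← Finset.sum_neg_distrib]
  refine Finset.sum_congr rfl fun k _ => ?_
  rw [h β α k]
  simp only [sharpEig, mul_neg, Finset.sum_neg_distrib]
  rw [sum_mul_sub_mean (fun i => bodyCov x β k i i), sum_mul_sub_mean (fun i => bodyCov x α k i i)]
  ring

/-! ### The two-form inverse to the bivector -/

/-- The vector `V` is tangent to the phase space at `x`: it is annihilated by the differentials of
`det G_k` (in left trivialisation) and of `tr L_k`. -/
def PhaseTangent (x V : Ambient N n) : Prop :=
  ∀ k, ((matG x k)⁻¹ * matG V k).trace = 0 ∧ ∑ i, eig V k i = 0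

theorem sum_sub_mean (hn : 1 ≤ n) (u : Fin n → ℂ) : ∑ i, (u i - (∑ p, u p) / n) = 0 := by
  have : (n : ℂ) ≠ 0 := by exact_mod_cast (by omega : n ≠ 0)
  rw [Finset.sum_sub_distrib, Finset.sum_const, Finset.card_univ, Fintype.card_fin, nsmul_eq_mul,
    mul_div_cancel₀ _ this, sub_self]

theorem body_sharp {x : Ambient N n} (hx : ∀ k, (matG x k).det ≠ 0) (α : Ambient N n →L[ℂ] ℂ)
    (k : Fin N) : (matG x k)⁻¹ * matG (sharp x α) k = sharpBody x α k := by
  rw [sharp, matG_mkAmbient, Matrix.nonsing_inv_mul_cancel_left _ _ (isUnit_iff_ne_zero.mpr (hx k))]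

theorem phaseTangent_sharp (hn : 1 ≤ n) {x : Ambient N n} (hx : ∀ k, (matG x k).det ≠ 0)
    (α : Ambient N n →L[ℂ] ℂ) : PhaseTangent x (sharp x α) := by
  intro k
  rw [body_sharp hx]
  constructor
  · simp only [Matrix.trace, Matrix.diag, sharpBody, Matrix.of_apply, if_true]
    exact sum_sub_mean hn _
  · simp only [sharp, eig_mkAmbient, sharpEig, Finset.sum_neg_distrib]
    rw [sum_sub_mean hn (fun i => bodyCov x α k i i), neg_zero]

theorem trace_mul_sub_mean (A g : Matrix (Fin n) (Fin n) ℂ) (c : ℂ) (hg : g.trace = 0) :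
    ∑ i, (A i i - c) * g i i = ∑ i, A i i * g i i := by
  have : ∑ i, g i i = 0 := hg
  simp only [sub_mul, Finset.sum_sub_distrib, ← Finset.mul_sum, this, mul_zero, sub_zero]

theorem trace_matL_mul (x : Ambient N n) (k : Fin N) (M : Matrix (Fin n) (Fin n) ℂ) :
    (matL x k * M).trace = ∑ i, eig x k i * M i i := by
  simp only [Matrix.trace, Matrix.diag, matL, Matrix.diagonal_mul]

/-- The form `omegaHat` and the bivector are inverse to each other on the phase space. -/
theorem omegaHat_sharp {x : Ambient N n} (hx : ∀ k, (matG x k).det ≠ 0)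
    (hinj : ∀ k, Function.Injective (eig x k)) (α : Ambient N n →L[ℂ] ℂ) {W : Ambient N n}
    (hW : PhaseTangent x W) : omegaHat x ![sharp x α, W] = -α W := by
  rw [covector_apply_body hx, omegaHat, ← Finset.sum_neg_distrib]
  refine Finset.sum_congr rfl fun k _ => ?_
  simp only [Matrix.cons_val_zero, Matrix.cons_val_one]
  rw [body_sharp hx]
  set g := (matG x k)⁻¹ * matG W k with hg
  -- the trace conditions on `W` absorb the means subtracted in `sharpBody` and `sharpEig`
  obtain ⟨h1, h2⟩ := hW k
  rw [← hg] at h1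
  have e1 : (matL x k * (sharpBody x α k * g - g * sharpBody x α k)).trace
      = ∑ i, ∑ j, (eig x k i - eig x k j) * sharpBody x α k i j * g j i := by
    rw [trace_matL_mul]
    simp only [Matrix.sub_apply, Matrix.mul_apply, mul_sub, sub_mul, Finset.sum_sub_distrib,
      Finset.mul_sum]
    congr 1
    · simp only [mul_assoc]
    · rw [Finset.sum_comm]
      refine Finset.sum_congr rfl fun i _ => Finset.sum_congr rfl fun j _ => ?_
      ring
  have e2 : (matL (sharp x α) k * g).trace = ∑ i, sharpEig x α k i * g i i := by
    simp only [Matrix.trace, Matrix.diag, matL, Matrix.diagonal_mul]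
    rfl
  have e3 : (matL W k * sharpBody x α k).trace = ∑ i, covL α k i * eig W k i := by
    simp only [Matrix.trace, Matrix.diag, matL, Matrix.diagonal_mul, sharpBody, Matrix.of_apply,
      if_true]
    simp only [mul_sub, Finset.sum_sub_distrib, ← Finset.sum_mul, h2, zero_mul, sub_zero]
    simp only [mul_comm]
  have e4 : (bodyCov x α k * g).trace
      = ∑ i, ∑ j, (eig x k i - eig x k j) * sharpBody x α k i j * g j i
        + ∑ i, bodyCov x α k i i * g i i := by
    simp only [Matrix.trace, Matrix.diag, Matrix.mul_apply]
    rw [← Finset.sum_add_distrib]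
    refine Finset.sum_congr rfl fun i _ => ?_
    rw [← Finset.sum_erase_add _ _ (Finset.mem_univ i),
      ← Finset.sum_erase_add (f := fun j => (eig x k i - eig x k j) * _ * _) _
        (Finset.mem_univ i)]
    simp only [sub_self, zero_mul, add_zero]
    congr 1
    refine Finset.sum_congr rfl fun j hj => ?_
    have hj : i ≠ j := (Finset.ne_of_mem_erase hj).symm
    have : eig x k i - eig x k j ≠ 0 := sub_ne_zero.mpr fun h => hj (hinj k h)
    simp only [sharpBody, Matrix.of_apply, if_neg hj]
    field_simp
  have e5 := trace_mul_sub_mean (bodyCov x α k) g ((∑ p, bodyCov x α k p p) / n) h1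
  rw [Matrix.trace_sub, e1, e2, e3, e4]
  simp only [sharpEig, neg_mul, Finset.sum_neg_distrib]
  rw [e5]
  ring

theorem omegaHat_swap (x V W : Ambient N n) : omegaHat x ![V, W] = -omegaHat x ![W, V] := by
  rw [omegaHat, omegaHat, ← Finset.sum_neg_distrib]
  refine Finset.sum_congr rfl fun k _ => ?_
  simp only [Matrix.cons_val_zero, Matrix.cons_val_one, Matrix.mul_sub, Matrix.trace_sub]
  ring

/-! ### Calculus on the ambient space -/

section Calculus

attribute [local instance] Matrix.linftyOpNormedRing Matrix.linftyOpNormedAlgebra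

/-- `matG` as a continuous linear map. -/
def matGL (k : Fin N) : Ambient N n →L[ℂ] Matrix (Fin n) (Fin n) ℂ :=
  LinearMap.toContinuousLinearMap
    { toFun := fun x => matG x k
      map_add' := fun _ _ => rfl
      map_smul' := fun _ _ => rfl }

/-- `matL` as a continuous linear map. -/
def matLL (k : Fin N) : Ambient N n →L[ℂ] Matrix (Fin n) (Fin n) ℂ :=
  LinearMap.toContinuousLinearMap
    { toFun := fun x => matL x k
      map_add' := fun x y => matL_add x y k
      map_smul' := fun c x => matL_smul c x k }

/-- The trace as a continuous linear map. -/
def traceCLM (n : ℕ) : Matrix (Fin n) (Fin n) ℂ →L[ℂ] ℂ :=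
  LinearMap.toContinuousLinearMap (Matrix.traceLinearMap (Fin n) ℂ ℂ)

theorem hasDerivAt_matG {γ : ℂ → Ambient N n} {V : Ambient N n} {t : ℂ} (h : HasDerivAt γ V t)
    (k : Fin N) : HasDerivAt (fun s => matG (γ s) k) (matG V k) t :=
  (matGL k).hasFDerivAt.comp_hasDerivAt t h

theorem hasDerivAt_matL {γ : ℂ → Ambient N n} {V : Ambient N n} {t : ℂ} (h : HasDerivAt γ V t)
    (k : Fin N) : HasDerivAt (fun s => matL (γ s) k) (matL V k) t :=
  (matLL k).hasFDerivAt.comp_hasDerivAt t h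

theorem hasDerivAt_trace {A : ℂ → Matrix (Fin n) (Fin n) ℂ} {A' : Matrix (Fin n) (Fin n) ℂ} {t : ℂ}
    (h : HasDerivAt A A' t) : HasDerivAt (fun s => (A s).trace) A'.trace t :=
  (traceCLM n).hasFDerivAt.comp_hasDerivAt t h

theorem analyticAt_matG (x : Ambient N n) (k : Fin N) : AnalyticAt ℂ (fun y => matG y k) x :=
  (matGL k).analyticAt _

theorem analyticAt_matL (x : Ambient N n) (k : Fin N) : AnalyticAt ℂ (fun y => matL y k) x :=
  (matLL k).analyticAt _

theorem analyticAt_trace {E : Type*} [NormedAddCommGroup E] [NormedSpace ℂ E]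
    {A : E → Matrix (Fin n) (Fin n) ℂ} {u : E} (h : AnalyticAt ℂ A u) :
    AnalyticAt ℂ (fun v => (A v).trace) u :=
  ((traceCLM n).analyticAt _).comp h

theorem analyticAt_matrix_inv {A : Matrix (Fin n) (Fin n) ℂ} (hA : A.det ≠ 0) :
    AnalyticAt ℂ (fun B : Matrix (Fin n) (Fin n) ℂ => B⁻¹) A := by
  have hu : IsUnit A := (Matrix.isUnit_iff_isUnit_det A).mpr (isUnit_iff_ne_zero.mpr hA)
  have := analyticAt_inverse (𝕜 := ℂ) hu.unit
  have h : (fun B : Matrix (Fin n) (Fin n) ℂ => B⁻¹) = Ring.inverse :=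
    funext Matrix.nonsing_inv_eq_ringInverse
  rw [h]
  exact this

theorem hasDerivAt_matrix_inv {A : ℂ → Matrix (Fin n) (Fin n) ℂ} {A' : Matrix (Fin n) (Fin n) ℂ}
    {t : ℂ} (hA : (A t).det ≠ 0) (h : HasDerivAt A A' t) :
    HasDerivAt (fun s => (A s)⁻¹) (-((A t)⁻¹ * A' * (A t)⁻¹)) t := by
  have hu : IsUnit (A t) := (Matrix.isUnit_iff_isUnit_det _).mpr (isUnit_iff_ne_zero.mpr hA)
  have h1 := (hasFDerivAt_ringInverse (𝕜 := ℂ) hu.unit).comp_hasDerivAt t h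
  have h2 : ((hu.unit⁻¹ : (Matrix (Fin n) (Fin n) ℂ)ˣ) : Matrix (Fin n) (Fin n) ℂ) = (A t)⁻¹ := by
    rw [← Ring.inverse_unit, Matrix.nonsing_inv_eq_ringInverse]; rfl
  have h3 : (fun s => (A s)⁻¹) = Ring.inverse ∘ A :=
    funext fun s => Matrix.nonsing_inv_eq_ringInverse _
  rw [h3, ← h2]
  exact h1

/-- The directional derivative of the moment map at `x` in the direction `V`. -/
def dMoment (x V : Ambient N n) : Matrix (Fin n) (Fin n) ℂ :=
  ∑ k, (matG V k * matL x k * (matG x k)⁻¹ + matG x k * matL V k * (matG x k)⁻¹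
    - matG x k * matL x k * ((matG x k)⁻¹ * matG V k * (matG x k)⁻¹))

theorem hasDerivAt_moment {γ : ℂ → Ambient N n} {V : Ambient N n} {t : ℂ}
    (hγ : HasDerivAt γ V t) (hx : ∀ k, (matG (γ t) k).det ≠ 0) :
    HasDerivAt (fun s => moment (γ s)) (dMoment (γ t) V) t := by
  refine HasDerivAt.fun_sum fun k _ => ?_
  have := ((hasDerivAt_matG hγ k).mul (hasDerivAt_matL hγ k)).mul
      (hasDerivAt_matrix_inv (hx k) (hasDerivAt_matG hγ k))
  rw [mul_neg, ← sub_eq_add_neg, add_mul] at this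
  exact this

theorem analyticAt_moment {x : Ambient N n} (hx : ∀ k, (matG x k).det ≠ 0) :
    AnalyticAt ℂ (fun y : Ambient N n => moment y) x :=
  Finset.analyticAt_fun_sum _ fun k _ => ((analyticAt_matG x k).mul (analyticAt_matL x k)).mul
    ((analyticAt_matrix_inv (hx k)).comp_of_eq (analyticAt_matG x k) rfl)

theorem hasDerivAt_line (x V : Ambient N n) : HasDerivAt (fun t : ℂ => x + t • V) V 0 := by
  simpa using ((hasDerivAt_id (0 : ℂ)).smul_const V).const_add x

/-- Directional derivatives compute the Fréchet derivative. -/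
theorem fderiv_apply_of_hasDerivAt {E F : Type*} [NormedAddCommGroup E] [NormedSpace ℂ E]
    [NormedAddCommGroup F] [NormedSpace ℂ F] {f : E → F} {γ : ℂ → E} {x V : E} {t : ℂ} {c : F}
    (hf : DifferentiableAt ℂ f x) (ht : γ t = x) (hγ : HasDerivAt γ V t)
    (h : HasDerivAt (fun s => f (γ s)) c t) : fderiv ℂ f x V = c := by
  subst ht
  exact (hf.hasFDerivAt.comp_hasDerivAt t hγ).unique h

theorem analyticAt_trace_mul_moment {x : Ambient N n} (hx : ∀ k, (matG x k).det ≠ 0)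
    (X : Matrix (Fin n) (Fin n) ℂ) :
    AnalyticAt ℂ (fun y : Ambient N n => (X * moment y).trace) x :=
  analyticAt_trace (analyticAt_const.mul (analyticAt_moment hx))

theorem fderiv_trace_mul_moment {x : Ambient N n} (hx : ∀ k, (matG x k).det ≠ 0)
    (X : Matrix (Fin n) (Fin n) ℂ) (V : Ambient N n) :
    fderiv ℂ (fun y : Ambient N n => (X * moment y).trace) x V = (X * dMoment x V).trace := by
  refine fderiv_apply_of_hasDerivAt (analyticAt_trace_mul_moment hx X).differentiableAt
    (by simp : x + (0 : ℂ) • V = x) (hasDerivAt_line x V) ?_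
  have := hasDerivAt_moment (hasDerivAt_line x V) (by simpa using hx)
  simp only [zero_smul, add_zero] at this
  exact hasDerivAt_trace (this.const_mul X)

/-- The derivative of a function with values in matrices is computed entry by entry. -/
theorem hasDerivAt_matrix_iff {A : ℂ → Matrix (Fin n) (Fin n) ℂ} {A' : Matrix (Fin n) (Fin n) ℂ}
    {t : ℂ} : HasDerivAt A A' t ↔ ∀ i j, HasDerivAt (fun s => A s i j) (A' i j) t := by
  constructor
  · intro h i j
    exact (LinearMap.toContinuousLinearMap
      (Matrix.entryLinearMap ℂ ℂ i j)).hasFDerivAt.comp_hasDerivAt t h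
  · intro h
    have h1 : HasDerivAt (fun s => (fun i j => A s i j : Fin n → Fin n → ℂ)) (fun i j => A' i j) t :=
      hasDerivAt_pi.mpr fun i => hasDerivAt_pi.mpr fun j => h i j
    exact (LinearMap.toContinuousLinearMap
      ((Matrix.ofLinearEquiv ℂ).toLinearMap :
        (Fin n → Fin n → ℂ) →ₗ[ℂ] Matrix (Fin n) (Fin n) ℂ)).hasFDerivAt.comp_hasDerivAt t h1

theorem hasDerivAt_ambient {γ : ℂ → Ambient N n} {V : Ambient N n} {t : ℂ}
    (h₁ : ∀ k, HasDerivAt (fun s => matG (γ s) k) (matG V k) t)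
    (h₂ : ∀ k, HasDerivAt (fun s => eig (γ s) k) (eig V k) t) : HasDerivAt γ V t :=
  hasDerivAt_pi.mpr fun k => (hasDerivAt_pi.mpr fun i => hasDerivAt_pi.mpr fun j =>
    hasDerivAt_matrix_iff.mp (h₁ k) i j).prodMk (h₂ k)

theorem hasDerivAt_eig {γ : ℂ → Ambient N n} {V : Ambient N n} {t : ℂ} (h : HasDerivAt γ V t)
    (k : Fin N) : HasDerivAt (fun s => eig (γ s) k) (eig V k) t :=
  ((ContinuousLinearMap.snd ℂ _ _).comp (ContinuousLinearMap.proj k :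
    Ambient N n →L[ℂ] _)).hasFDerivAt.comp_hasDerivAt t h

theorem hasDerivAt_leftMul {S : ℂ → Matrix (Fin n) (Fin n) ℂ} {S' : Matrix (Fin n) (Fin n) ℂ}
    {γ : ℂ → Ambient N n} {V : Ambient N n} {t : ℂ} (hS : HasDerivAt S S' t)
    (hγ : HasDerivAt γ V t) :
    HasDerivAt (fun s => leftMul (S s) (γ s))
      (mkAmbient (fun k => S' * matG (γ t) k + S t * matG V k) (eig V)) t :=
  hasDerivAt_ambient (fun k => hS.mul (hasDerivAt_matG hγ k)) (fun k => hasDerivAt_eig hγ k)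

theorem analyticAt_ambient {E : Type*} [NormedAddCommGroup E] [NormedSpace ℂ E]
    {φ : E → Ambient N n} {u : E}
    (h₁ : ∀ k, AnalyticAt ℂ (fun s => matG (φ s) k) u)
    (h₂ : ∀ k, AnalyticAt ℂ (fun s => eig (φ s) k) u) : AnalyticAt ℂ φ u :=
  analyticAt_pi_iff.mpr fun k => AnalyticAt.prod (analyticAt_pi_iff.mpr fun i =>
    analyticAt_pi_iff.mpr fun j => ((LinearMap.toContinuousLinearMap
      (Matrix.entryLinearMap ℂ ℂ i j)).analyticAt _).comp (h₁ k)) (h₂ k)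

theorem analyticAt_det (A : Matrix (Fin n) (Fin n) ℂ) :
    AnalyticAt ℂ (fun A : Matrix (Fin n) (Fin n) ℂ => A.det) A := by
  simp only [Matrix.det_apply]
  refine Finset.analyticAt_fun_sum _ fun σ _ => AnalyticAt.const_smul ?_
  refine Finset.analyticAt_fun_prod (A := ℂ) _ fun i _ => ?_
  exact (LinearMap.toContinuousLinearMap (Matrix.entryLinearMap ℂ ℂ (σ i) i)).analyticAt _

/-- The derivative of the determinant at an invertible matrix, from
`det (A + t V) = det A * det (1 + t A⁻¹ V)` and the expansion of the second factor in powers of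
`t`. -/
theorem fderiv_det {A : Matrix (Fin n) (Fin n) ℂ} (hA : A.det ≠ 0) (V : Matrix (Fin n) (Fin n) ℂ) :
    fderiv ℂ (fun A : Matrix (Fin n) (Fin n) ℂ => A.det) A V = A.det * (A⁻¹ * V).trace := by
  have h1 : HasDerivAt (fun t : ℂ => A + t • V) V 0 := by
    have := ((hasDerivAt_id (0 : ℂ)).smul_const V).const_add A
    rw [one_smul] at this
    exact this
  refine fderiv_apply_of_hasDerivAt (analyticAt_det A).differentiableAt
    (by simp : A + (0 : ℂ) • V = A) h1 ?_
  have h2 : ∀ t : ℂ, (A + t • V).det = A.det * (1 + (A⁻¹ * V).trace * t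
      + ((Matrix.det (1 + (Polynomial.X : Polynomial ℂ) •
        (A⁻¹ * V).map Polynomial.C)).divX.divX).eval t * t ^ 2) := by
    intro t
    rw [← Matrix.det_one_add_smul, ← Matrix.det_mul, mul_add, mul_one, Matrix.mul_smul,
      Matrix.mul_nonsing_inv_cancel_left _ _ (isUnit_iff_ne_zero.mpr hA)]
  simp only [h2]
  have h3 := ((Polynomial.hasDerivAt ((Matrix.det (1 + (Polynomial.X : Polynomial ℂ) •
    (A⁻¹ * V).map Polynomial.C)).divX.divX) (0 : ℂ)).mul (hasDerivAt_pow 2 (0 : ℂ)))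
  have h4 := (((hasDerivAt_id (0 : ℂ)).const_mul (A⁻¹ * V).trace).const_add 1).add h3
  have h5 := h4.const_mul A.det
  simpa using h5

theorem hasDerivAt_det {A : ℂ → Matrix (Fin n) (Fin n) ℂ} {A' : Matrix (Fin n) (Fin n) ℂ} {t : ℂ}
    (hA : (A t).det ≠ 0) (h : HasDerivAt A A' t) :
    HasDerivAt (fun s => (A s).det) ((A t).det * ((A t)⁻¹ * A').trace) t := by
  rw [← fderiv_det hA]
  exact (analyticAt_det _).differentiableAt.hasFDerivAt.comp_hasDerivAt t h

end Calculus

/-! ### Invariance of the canonical forms and the moment map property -/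

theorem det_ne_zero_of_mem {x : Ambient N n} (hx : x ∈ phaseSpace N n) (k : Fin N) :
    (matG x k).det ≠ 0 := by
  rw [(hx k).1]; exact one_ne_zero

theorem det_inv_ne_zero_of_mem {x : Ambient N n} (hx : x ∈ phaseSpace N n) (k : Fin N) :
    ((matG x k)⁻¹).det ≠ 0 := by
  rw [Matrix.det_nonsing_inv, (hx k).1, Ring.inverse_one]
  exact one_ne_zero

theorem covector_separates {V W : Ambient N n} (h : ∀ β : Ambient N n →L[ℂ] ℂ, β V = β W) :
    V = W :=
  (SeparatingDual.eq_iff_forall_dual_eq (R := ℂ)).mpr h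

/-- Non-degeneracy of `omegaHat` on the tangent spaces of the phase space. -/
theorem eq_of_omegaHat_eq (hn : 1 ≤ n) {x : Ambient N n} (hx : ∀ k, (matG x k).det ≠ 0)
    (hinj : ∀ k, Function.Injective (eig x k)) {V₁ V₂ : Ambient N n} (h₁ : PhaseTangent x V₁)
    (h₂ : PhaseTangent x V₂)
    (h : ∀ W, PhaseTangent x W → omegaHat x ![V₁, W] = omegaHat x ![V₂, W]) : V₁ = V₂ := by
  refine covector_separates fun β => ?_
  rw [← neg_neg (β V₁), ← omegaHat_sharp hx hinj β h₁, ← omegaHat_swap,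
    h _ (phaseTangent_sharp hn hx β), omegaHat_swap, omegaHat_sharp hx hinj β h₂, neg_neg]

/-- The defining identity of a moment map, in terms of `omegaHat`. -/
theorem omegaHat_infAction (X : Matrix (Fin n) (Fin n) ℂ) {x : Ambient N n}
    (hx : ∀ k, (matG x k).det ≠ 0) (W : Ambient N n) :
    omegaHat x ![infAction X x, W] = -(X * dMoment x W).trace := by
  rw [omegaHat, dMoment, Matrix.mul_sum, Matrix.trace_sum, ← Finset.sum_neg_distrib]
  refine Finset.sum_congr rfl fun k _ => ?_
  simp only [Matrix.cons_val_zero, Matrix.cons_val_one, matG_infAction, matL_infAction, zero_mul,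
    Matrix.trace_sub, Matrix.trace_add, Matrix.mul_add, Matrix.mul_sub, Matrix.trace_zero]
  set G := matG x k
  set H := G⁻¹
  set L := matL x k
  set w := matG W k
  set l := matL W k
  have hGH : G * (H * w) = w := Matrix.mul_nonsing_inv_cancel_left _ _ (isUnit_iff_ne_zero.mpr (hx k))
  have e1 : (L * (H * (X * G) * (H * w))).trace = (X * (w * L * H)).trace := by
    rw [show L * (H * (X * G) * (H * w)) = (L * H) * (X * (G * (H * w))) by
      simp only [Matrix.mul_assoc], hGH, Matrix.trace_mul_comm]
    simp only [Matrix.mul_assoc]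
  have e2 : (L * (H * w * (H * (X * G)))).trace = (X * (G * L * (H * w * H))).trace := by
    rw [show L * (H * w * (H * (X * G))) = (L * H * w * H) * (X * G) by
      simp only [Matrix.mul_assoc], Matrix.trace_mul_comm]
    simp only [Matrix.mul_assoc]
  have e3 : (l * (H * (X * G))).trace = (X * (G * l * H)).trace := by
    rw [← Matrix.mul_assoc, Matrix.trace_mul_comm]
    simp only [Matrix.mul_assoc]
  rw [e1, e2, e3]
  ring

theorem phaseTangent_infAction {X : Matrix (Fin n) (Fin n) ℂ} (hX : X.trace = 0) {x : Ambient N n}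
    (hx : ∀ k, (matG x k).det ≠ 0) : PhaseTangent x (infAction X x) := by
  intro k
  constructor
  · rw [matG_infAction, Matrix.trace_mul_comm, Matrix.mul_assoc,
      Matrix.mul_nonsing_inv _ (isUnit_iff_ne_zero.mpr (hx k)), mul_one, hX]
  · simp

/-- The Hamiltonian vector of `tr (X m)` is the infinitesimal action of `X`. -/
theorem sharp_fderiv_moment (hn : 1 ≤ n) {x : Ambient N n} (hx : x ∈ phaseSpace N n)
    {X : Matrix (Fin n) (Fin n) ℂ} (hX : X.trace = 0) :
    sharp x (fderiv ℂ (fun y : Ambient N n => (X * moment y).trace) x) = infAction X x := by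
  have hd := det_ne_zero_of_mem hx
  have hinj := fun k => (hx k).2.2
  refine eq_of_omegaHat_eq hn hd hinj (phaseTangent_sharp hn hd _)
    (phaseTangent_infAction hX hd) fun W hW => ?_
  rw [omegaHat_sharp hd hinj _ hW, omegaHat_infAction _ hd, fderiv_trace_mul_moment hd]

theorem moment_leftMul (S : Matrix.SpecialLinearGroup (Fin n) ℂ) (x : Ambient N n) :
    moment (leftMul (S : Matrix (Fin n) (Fin n) ℂ) x)
      = (S : Matrix (Fin n) (Fin n) ℂ) * moment x * (S : Matrix (Fin n) (Fin n) ℂ)⁻¹ := by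
  simp only [moment, Matrix.mul_sum, Matrix.sum_mul, matG_leftMul, matL_leftMul,
    Matrix.mul_inv_rev, Matrix.mul_assoc]

theorem leftMul_mem_phaseSpace {x : Ambient N n} (hx : x ∈ phaseSpace N n)
    (S : Matrix.SpecialLinearGroup (Fin n) ℂ) :
    leftMul (S : Matrix (Fin n) (Fin n) ℂ) x ∈ phaseSpace N n := by
  intro k
  refine ⟨?_, (hx k).2.1, (hx k).2.2⟩
  rw [matG_leftMul, Matrix.det_mul, S.det_coe, (hx k).1, one_mul]

theorem isMomentMap (hn : 1 ≤ n) : IsMomentMap N n := by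
  refine ⟨fun x hx X hX F _ => ?_, fun x hx S => ⟨leftMul_mem_phaseSpace hx S, moment_leftMul S x⟩⟩
  rw [bracket, bivector_eq_sharp, sharp_fderiv_moment hn hx hX]

theorem dMoment_infAction (X : Matrix (Fin n) (Fin n) ℂ) {x : Ambient N n}
    (hx : ∀ k, (matG x k).det ≠ 0) :
    dMoment x (infAction X x) = X * moment x - moment x * X := by
  simp only [dMoment, moment, Matrix.mul_sum, Matrix.sum_mul, ← Finset.sum_sub_distrib]
  refine Finset.sum_congr rfl fun k _ => ?_
  have h : X * matG x k * (matG x k)⁻¹ = X := by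
    rw [Matrix.mul_assoc, Matrix.mul_nonsing_inv _ (isUnit_iff_ne_zero.mpr (hx k)), mul_one]
  rw [matG_infAction, matL_infAction, mul_zero, zero_mul, add_zero, Matrix.mul_assoc (matG x k)⁻¹,
    h]
  simp only [Matrix.mul_assoc]

/-- The trace of the moment map is the sum of all traces `tr L_k`; this is the infinitesimal
version. -/
theorem trace_dMoment {x : Ambient N n} (hx : ∀ k, (matG x k).det ≠ 0) (V : Ambient N n) :
    (dMoment x V).trace = ∑ k, ∑ i, eig V k i := by
  rw [dMoment, Matrix.trace_sum]
  refine Finset.sum_congr rfl fun k _ => ?_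
  have hu := isUnit_iff_ne_zero.mpr (hx k)
  have h1 : (matG x k * matL x k * ((matG x k)⁻¹ * matG V k * (matG x k)⁻¹)).trace
      = (matG V k * matL x k * (matG x k)⁻¹).trace := by
    rw [Matrix.trace_mul_comm, Matrix.mul_assoc _ (matG x k)⁻¹,
      Matrix.nonsing_inv_mul_cancel_left _ _ hu, Matrix.mul_assoc, Matrix.trace_mul_comm]
  have h2 : (matG x k * matL V k * (matG x k)⁻¹).trace = ∑ i, eig V k i := by
    rw [Matrix.trace_mul_comm, Matrix.nonsing_inv_mul_cancel_left _ _ hu, matL,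
      Matrix.trace_diagonal]
  rw [Matrix.trace_sub, Matrix.trace_add, h1, h2]
  ring

/-- The differential of an invariant function vanishes on the infinitesimal action. The curve in
`SL(n)` with velocity `X` is obtained from `1 + t X` by dividing the first row by the
determinant. -/
theorem fderiv_infAction_eq_zero (hn : 1 ≤ n) {W : Set (Ambient N n)} (hW : IsOpen W)
    {F : Ambient N n → ℂ} (hF : IsInvariantHolomorphic W F) {x : Ambient N n} (hxW : x ∈ W)
    (hx : x ∈ phaseSpace N n) {X : Matrix (Fin n) (Fin n) ℂ} (hX : X.trace = 0) :
    fderiv ℂ F x (infAction X x) = 0 := by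
  let i₀ : Fin n := ⟨0, hn⟩
  let A : ℂ → Matrix (Fin n) (Fin n) ℂ := fun t => 1 + t • X
  have hA0 : A 0 = 1 := by simp [A]
  have hA : HasDerivAt A X 0 := by
    refine hasDerivAt_matrix_iff.mpr fun i j => ?_
    simpa [A] using ((hasDerivAt_id (0 : ℂ)).mul_const (X i j)).const_add
      ((1 : Matrix (Fin n) (Fin n) ℂ) i j)
  have hd : HasDerivAt (fun t => (A t).det) 0 0 := by
    have := hasDerivAt_det (by simp [hA0]) hA
    simpa [hA0, hX] using this
  have hdi : HasDerivAt (fun t => ((A t).det)⁻¹) 0 0 := by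
    have := hd.fun_inv (by simp [hA0])
    simpa using this
  let S : ℂ → Matrix (Fin n) (Fin n) ℂ := fun t =>
    (A t).updateRow i₀ (((A t).det)⁻¹ • A t i₀)
  have hS0 : S 0 = 1 := by
    simp only [S, hA0, Matrix.det_one, inv_one, one_smul, Matrix.updateRow_eq_self]
  have hS : HasDerivAt S X 0 := by
    refine hasDerivAt_matrix_iff.mpr fun i j => ?_
    have hij := hasDerivAt_matrix_iff.mp hA i j
    by_cases hi : i = i₀
    · subst hi
      have := hdi.mul hij
      simp only [hA0, Matrix.det_one, inv_one, zero_mul, one_mul, zero_add] at this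
      refine this.congr_of_eventuallyEq (Filter.Eventually.of_forall fun t => ?_)
      simp [S]
    · refine hij.congr_of_eventuallyEq (Filter.Eventually.of_forall fun t => ?_)
      simp [S, Matrix.updateRow_ne hi]
  have hcurve : HasDerivAt (fun t => leftMul (S t) x) (infAction X x) 0 := by
    have := hasDerivAt_leftMul hS (hasDerivAt_const (0 : ℂ) x)
    convert this using 1
    refine ambient_ext (fun k => ?_) (fun k => ?_) <;> simp
  have hx0 : leftMul (S 0) x = x := by rw [hS0, leftMul_one]
  have hdet : ∀ᶠ t in 𝓝 (0 : ℂ), (A t).det ≠ 0 :=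
    hd.continuousAt.eventually_ne (by simp [hA0])
  have hmem : ∀ᶠ t in 𝓝 (0 : ℂ), leftMul (S t) x ∈ W :=
    hcurve.continuousAt.eventually_mem (by rw [hx0]; exact hW.mem_nhds hxW)
  refine fderiv_apply_of_hasDerivAt (hF.1 x hxW).differentiableAt hx0 hcurve ?_
  refine (hasDerivAt_const (0 : ℂ) (F x)).congr_of_eventuallyEq ?_
  filter_upwards [hdet, hmem] with t ht htW
  have hSd : (S t).det = 1 := by
    simp only [S]
    rw [Matrix.det_updateRow_smul, Matrix.updateRow_eq_self, inv_mul_cancel₀ ht]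
  exact hF.2 x hx ⟨S t, hSd⟩ hxW htW

/-- The moment map is the contraction of `thetaHat` with the infinitesimal action. -/
theorem thetaHat_infAction (X : Matrix (Fin n) (Fin n) ℂ) (x : Ambient N n) :
    thetaHat x ![infAction X x] = (X * moment x).trace := by
  rw [thetaHat, moment, Matrix.mul_sum, Matrix.trace_sum]
  refine Finset.sum_congr rfl fun k _ => ?_
  rw [Matrix.cons_val_zero, matG_infAction, Matrix.trace_mul_comm X, ← Matrix.mul_assoc,
    ← Matrix.mul_assoc, Matrix.trace_mul_comm _ (matG x k)]
  simp only [Matrix.mul_assoc]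

/-- Left multiplication does not change velocities in left trivialisation. -/
theorem body_leftMul {S : Matrix (Fin n) (Fin n) ℂ} (hS : S.det ≠ 0) (x V : Ambient N n)
    (k : Fin N) : (matG (leftMul S x) k)⁻¹ * matG (leftMul S V) k = (matG x k)⁻¹ * matG V k := by
  rw [matG_leftMul, matG_leftMul, Matrix.mul_inv_rev, Matrix.mul_assoc,
    Matrix.nonsing_inv_mul_cancel_left _ _ (isUnit_iff_ne_zero.mpr hS)]

theorem thetaHat_leftMul {S : Matrix (Fin n) (Fin n) ℂ} (hS : S.det ≠ 0) (x : Ambient N n)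
    (v : Fin 1 → Ambient N n) :
    thetaHat (leftMul S x) (fun i => leftMul S (v i)) = thetaHat x v := by
  simp only [thetaHat, body_leftMul hS, matL_leftMul]

theorem omegaHat_leftMul {S : Matrix (Fin n) (Fin n) ℂ} (hS : S.det ≠ 0) (x : Ambient N n)
    (v : Fin 2 → Ambient N n) :
    omegaHat (leftMul S x) (fun i => leftMul S (v i)) = omegaHat x v := by
  simp only [omegaHat, body_leftMul hS, matL_leftMul]

/-! ### The canonical one-form and its exterior derivative -/

/-- `thetaHat` as a field of covectors. -/
def thetaCLM (x : Ambient N n) : Ambient N n →L[ℂ] ℂ :=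
  LinearMap.toContinuousLinearMap
    { toFun := fun V => thetaHat x ![V]
      map_add' := fun V W => by
        simp [thetaHat, mul_add, Finset.sum_add_distrib]
      map_smul' := fun c V => by
        simp [thetaHat, Finset.mul_sum] }

theorem thetaCLM_apply (x V : Ambient N n) : thetaCLM x V = thetaHat x ![V] := rfl

/-- `thetaHat` as a differential form. -/
def thetaForm (x : Ambient N n) : Ambient N n [⋀^Fin 1]→L[ℂ] ℂ :=
  ContinuousAlternatingMap.ofSubsingleton ℂ (Ambient N n) ℂ 0 (thetaCLM x)

theorem thetaForm_apply (x : Ambient N n) (v : Fin 1 → Ambient N n) :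
    thetaForm x v = thetaHat x v := by
  rw [thetaForm, ContinuousAlternatingMap.ofSubsingleton_apply_apply, thetaCLM_apply]
  congr 1
  funext i
  fin_cases i
  rfl

theorem isOpen_det_matG_ne_zero (k : Fin N) : IsOpen {x : Ambient N n | (matG x k).det ≠ 0} := by
  refine isOpen_ne_fun (Continuous.matrix_det ?_) continuous_const
  exact continuous_matrix fun i j =>
    ((continuous_apply j).comp ((continuous_apply i).comp (continuous_fst.comp (continuous_apply k))))

theorem isOpen_det_ne_zero : IsOpen {x : Ambient N n | ∀ k, (matG x k).det ≠ 0} := by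
  simp only [Set.ofPred_forall]
  exact isOpen_iInter_of_finite isOpen_det_matG_ne_zero

section Calculus

attribute [local instance] Matrix.linftyOpNormedRing Matrix.linftyOpNormedAlgebra

theorem analyticAt_thetaHat {x : Ambient N n} (hx : ∀ k, (matG x k).det ≠ 0) (w : Ambient N n) :
    AnalyticAt ℂ (fun y => thetaHat y ![w]) x :=
  Finset.analyticAt_fun_sum _ fun k _ => analyticAt_trace ((analyticAt_matL x k).mul
    (((analyticAt_matrix_inv (hx k)).comp_of_eq (analyticAt_matG x k) rfl).mul analyticAt_const))

theorem fderiv_thetaHat {x : Ambient N n} (hx : ∀ k, (matG x k).det ≠ 0) (v w : Ambient N n) :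
    fderiv ℂ (fun y => thetaHat y ![w]) x v
      = ∑ k, ((matL v k * ((matG x k)⁻¹ * matG w k)).trace
        - (matL x k * (((matG x k)⁻¹ * matG v k) * ((matG x k)⁻¹ * matG w k))).trace) := by
  refine fderiv_apply_of_hasDerivAt (analyticAt_thetaHat hx w).differentiableAt
    (by simp : x + (0 : ℂ) • v = x) (hasDerivAt_line x v) ?_
  refine HasDerivAt.fun_sum fun k _ => ?_
  have h0 : x + (0 : ℂ) • v = x := by simp
  have h1 := hasDerivAt_trace ((hasDerivAt_matL (hasDerivAt_line x v) k).mul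
    ((hasDerivAt_matrix_inv (by simpa using hx k)
      (hasDerivAt_matG (hasDerivAt_line x v) k)).mul_const (matG w k)))
  rw [h0] at h1
  have e : (matL v k * ((matG x k)⁻¹ * matG w k)).trace
      - (matL x k * (((matG x k)⁻¹ * matG v k) * ((matG x k)⁻¹ * matG w k))).trace
      = (matL v k * ((matG x k)⁻¹ * matG w k)
        + matL x k * (-((matG x k)⁻¹ * matG v k * (matG x k)⁻¹) * matG w k)).trace := by
    rw [← Matrix.trace_sub, sub_eq_add_neg]
    simp only [neg_mul, mul_neg, Matrix.mul_assoc]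
  rw [e]
  exact h1

end Calculus

theorem analyticAt_thetaCLM {x : Ambient N n} (hx : ∀ k, (matG x k).det ≠ 0) :
    AnalyticAt ℂ (thetaCLM : Ambient N n → _) x := by
  have h : ContDiffOn ℂ ω (thetaCLM : Ambient N n → _) {x | ∀ k, (matG x k).det ≠ 0} := by
    refine contDiffOn_clm_apply.mpr fun w y hy => ?_
    exact (analyticAt_thetaHat hy w).contDiffAt.contDiffWithinAt
  exact (h.contDiffAt (isOpen_det_ne_zero.mem_nhds hx)).analyticAt

theorem analyticAt_thetaForm {x : Ambient N n} (hx : ∀ k, (matG x k).det ≠ 0) :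
    AnalyticAt ℂ (thetaForm : Ambient N n → _) x :=
  ((ContinuousAlternatingMap.ofSubsingletonLIE (𝕜 := ℂ) (E := Ambient N n) (F := ℂ)
    (i := (0 : Fin 1))).toContinuousLinearEquiv.toContinuousLinearMap.analyticAt _).comp
      (analyticAt_thetaCLM hx)

/-- `omegaHat` is the exterior derivative of `thetaHat`. -/
theorem extDeriv_thetaForm {x : Ambient N n} (hx : ∀ k, (matG x k).det ≠ 0)
    (v : Fin 2 → Ambient N n) : extDeriv thetaForm x v = omegaHat x v := by
  rw [extDeriv_apply (analyticAt_thetaForm hx).differentiableAt, Fin.sum_univ_two]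
  have h : ∀ u : Fin 1 → Ambient N n, (fun y => thetaForm y u) = fun y => thetaHat y ![u 0] := by
    intro u
    funext y
    rw [thetaForm_apply]
    congr 1
    funext i
    fin_cases i
    rfl
  rw [h, h, fderiv_thetaHat hx, fderiv_thetaHat hx, omegaHat]
  simp only [Fin.val_zero, Fin.val_one, pow_zero, pow_one, one_smul, neg_smul]
  rw [← sub_eq_add_neg, ← Finset.sum_sub_distrib]
  refine Finset.sum_congr rfl fun k _ => ?_
  have e1 : Fin.removeNth (0 : Fin 2) v 0 = v 1 := rfl
  have e2 : Fin.removeNth (1 : Fin 2) v 0 = v 0 := rfl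
  rw [e1, e2, Matrix.trace_sub, Matrix.mul_sub, Matrix.trace_sub]
  ring

/-! ### Complex manifolds inside a normed space -/

section Embedded

variable {d : ℕ} {M : Type} [TopologicalSpace M]
  {E : Type} [NormedAddCommGroup E] [NormedSpace ℂ E]

/-- A chart `e` of `M` is analytic for the map `i` into a normed space if its inverse, composed with
`i`, is analytic, and `e` extends locally to an analytic map on the normed space. -/
structure IsAnalyticChart (i : M → E) (e : OpenPartialHomeomorph M (Fin d → ℂ)) : Prop where
  analyticOnNhd_symm : AnalyticOnNhd ℂ (fun u => i (e.symm u)) e.target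
  exists_extension : ∀ p ∈ e.source, ∃ C : E → Fin d → ℂ,
    AnalyticAt ℂ C (i p) ∧ ∀ᶠ q in 𝓝 p, e q = C (i q)

/-- The charted space structure whose atlas consists of all charts that are analytic for `i`. -/
@[reducible] def analyticChartedSpace (i : M → E)
    (h : ∀ p, ∃ e : OpenPartialHomeomorph M (Fin d → ℂ), p ∈ e.source ∧ IsAnalyticChart i e) :
    ChartedSpace (Fin d → ℂ) M where
  atlas := {e | IsAnalyticChart i e}
  chartAt p := (h p).choose
  mem_chart_source p := (h p).choose_spec.1
  chart_mem_atlas p := (h p).choose_spec.2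

/-- The transition map of two analytic charts factors through the ambient space and is therefore
analytic. -/
theorem IsAnalyticChart.analyticAt_transition {i : M → E}
    {e e' : OpenPartialHomeomorph M (Fin d → ℂ)} (he : IsAnalyticChart i e)
    (he' : IsAnalyticChart i e') {u : Fin d → ℂ} (hu : u ∈ e.target) (hu' : e.symm u ∈ e'.source) :
    AnalyticAt ℂ (fun v => e' (e.symm v)) u := by
  obtain ⟨C, hC, hCe⟩ := he'.exists_extension _ hu'
  refine (hC.comp_of_eq (he.analyticOnNhd_symm u hu) rfl).congr ?_
  filter_upwards [(e.continuousAt_symm hu).eventually hCe] with v hv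
  exact hv.symm

variable [ChartedSpace (Fin d → ℂ) M]

theorem isManifold_of_isAnalyticChart {i : M → E}
    (hA : ∀ e ∈ atlas (Fin d → ℂ) M, IsAnalyticChart i e) :
    IsManifold 𝓘(ℂ, Fin d → ℂ) ω M := by
  refine isManifold_of_contDiffOn _ _ _ fun e e' he he' => ?_
  rintro u ⟨hu, -⟩
  have hu : u ∈ e.target ∧ e.symm u ∈ e'.source := by simpa using hu
  exact ((hA e he).analyticAt_transition (hA e' he') hu.1 hu.2).contDiffAt.contDiffWithinAt

/-- The differential of the inclusion, with values in the normed space. -/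
def inclusionDeriv (d : ℕ) {M : Type} [TopologicalSpace M] [ChartedSpace (Fin d → ℂ) M]
    (i : M → E) (p : M) : TangentSpace 𝓘(ℂ, Fin d → ℂ) p →L[ℂ] E :=
  mfderiv 𝓘(ℂ, Fin d → ℂ) 𝓘(ℂ, E) i p

/-- The pullback to `M` of a differential form on the normed space. -/
def pullbackForm {k : ℕ} (i : M → E) (η : E → E [⋀^Fin k]→L[ℂ] ℂ) : FormField d M k :=
  fun p => (η (i p)).compContinuousLinearMap (inclusionDeriv d i p)

theorem pullbackForm_apply {k : ℕ} (i : M → E) (η : E → E [⋀^Fin k]→L[ℂ] ℂ) (p : M)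
    (v : Fin k → TangentSpace 𝓘(ℂ, Fin d → ℂ) p) :
    pullbackForm i η p v = η (i p) (fun j => inclusionDeriv d i p (v j)) := rfl

theorem IsExteriorDerivative.isHolomorphicForm {k : ℕ} {η : FormField d M k}
    {ζ : FormField d M (k + 1)} (h : IsExteriorDerivative η ζ) (hη : IsHolomorphicForm η) :
    IsHolomorphicForm ζ := by
  intro e he u hu
  have h0 := ContinuousLinearMap.analyticAt (𝕜 := ℂ) (F := (Fin d → ℂ) [⋀^Fin (k + 1)]→L[ℂ] ℂ)
    (ContinuousAlternatingMap.alternatizeUncurryFinCLM (n := k) ℂ (Fin d → ℂ) ℂ)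
    (fderiv ℂ (chartForm η e) u)
  have h1 : AnalyticAt ℂ (extDeriv (chartForm η e)) u := h0.comp (hη e he u hu).fderiv
  refine h1.congr ?_
  filter_upwards [e.open_target.mem_nhds hu] with v hv
  exact h e he v hv

/-- An exterior derivative is closed. -/
theorem IsExteriorDerivative.closed {k : ℕ} {η : FormField d M k}
    {ζ : FormField d M (k + 1)} (h : IsExteriorDerivative η ζ) (hη : IsHolomorphicForm η) :
    IsExteriorDerivative ζ (fun _ => 0) := by
  intro e he u hu
  have h1 : chartForm ζ e =ᶠ[𝓝 u] extDeriv (chartForm η e) := by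
    filter_upwards [e.open_target.mem_nhds hu] with v hv
    exact (h e he v hv).symm
  rw [h1.extDeriv_eq, extDeriv_extDeriv_apply (hη e he u hu).contDiffAt (r := ω) le_top]
  rfl

variable [IsManifold 𝓘(ℂ, Fin d → ℂ) ω M]

theorem contMDiffAt_chart {e : OpenPartialHomeomorph M (Fin d → ℂ)} (he : e ∈ atlas (Fin d → ℂ) M)
    {p : M} (hp : p ∈ e.source) : ContMDiffAt 𝓘(ℂ, Fin d → ℂ) 𝓘(ℂ, Fin d → ℂ) ω e p :=
  contMDiffAt_of_mem_maximalAtlas (IsManifold.subset_maximalAtlas he) hp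

theorem contMDiffAt_chart_symm {e : OpenPartialHomeomorph M (Fin d → ℂ)}
    (he : e ∈ atlas (Fin d → ℂ) M) {u : Fin d → ℂ} (hu : u ∈ e.target) :
    ContMDiffAt 𝓘(ℂ, Fin d → ℂ) 𝓘(ℂ, Fin d → ℂ) ω e.symm u :=
  contMDiffAt_symm_of_mem_maximalAtlas (IsManifold.subset_maximalAtlas he) hu

/-- A continuous map into `M` is holomorphic if its composition with the inclusion is. -/
theorem contMDiffAt_of_comp_inclusion {i : M → E}
    (hA : ∀ e ∈ atlas (Fin d → ℂ) M, IsAnalyticChart i e)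
    {X : Type} [NormedAddCommGroup X] [NormedSpace ℂ X] {g : X → M} {u : X}
    (hg : ContinuousAt g u) (h : AnalyticAt ℂ (fun v => i (g v)) u) :
    ContMDiffAt 𝓘(ℂ, X) 𝓘(ℂ, Fin d → ℂ) ω g u := by
  have hp := mem_chart_source (Fin d → ℂ) (g u)
  have he := chart_mem_atlas (Fin d → ℂ) (g u)
  set e := chartAt (Fin d → ℂ) (g u)
  obtain ⟨C, hC, hCe⟩ := (hA e he).exists_extension _ hp
  have h1 : AnalyticAt ℂ (fun v => e (g v)) u := by
    refine (hC.comp_of_eq h rfl).congr ?_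
    filter_upwards [hg.eventually hCe] with v hv
    exact hv.symm
  have h2 := (contMDiffAt_chart_symm he (e.map_source hp)).comp u h1.contDiffAt.contMDiffAt
  refine h2.congr_of_eventuallyEq ?_
  filter_upwards [hg.eventually_mem (e.open_source.mem_nhds hp)] with v hv
  simp [e.left_inv hv]

/-- The local representative of a holomorphic function in a chart is analytic. -/
theorem analyticAt_comp_chart_symm {e : OpenPartialHomeomorph M (Fin d → ℂ)}
    (he : e ∈ atlas (Fin d → ℂ) M) {f : M → ℂ} {u : Fin d → ℂ} (hu : u ∈ e.target)
    (hf : ContMDiffAt 𝓘(ℂ, Fin d → ℂ) 𝓘(ℂ, ℂ) ω f (e.symm u)) :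
    AnalyticAt ℂ (fun v => f (e.symm v)) u :=
  (contMDiffAt_iff_contDiffAt.mp (hf.comp u (contMDiffAt_chart_symm he hu))).analyticAt

/-- A holomorphic function on `M` extends locally to an analytic function on the normed space. -/
theorem exists_analytic_extension {i : M → E}
    (hA : ∀ e ∈ atlas (Fin d → ℂ) M, IsAnalyticChart i e) {f : M → ℂ} {p : M}
    (hf : ContMDiffAt 𝓘(ℂ, Fin d → ℂ) 𝓘(ℂ, ℂ) ω f p) :
    ∃ F : E → ℂ, AnalyticAt ℂ F (i p) ∧ ∀ᶠ q in 𝓝 p, f q = F (i q) := by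
  have hp := mem_chart_source (Fin d → ℂ) p
  have he := chart_mem_atlas (Fin d → ℂ) p
  set e := chartAt (Fin d → ℂ) p
  obtain ⟨C, hC, hCe⟩ := (hA e he).exists_extension _ hp
  have h1 : AnalyticAt ℂ (fun v => f (e.symm v)) (e p) :=
    analyticAt_comp_chart_symm he (e.map_source hp) (by rwa [e.left_inv hp])
  refine ⟨fun x => f (e.symm (C x)), h1.comp_of_eq hC hCe.self_of_nhds.symm, ?_⟩
  filter_upwards [hCe, e.open_source.mem_nhds hp] with q hq hqs
  rw [← hq, e.left_inv hqs]

variable [CompleteSpace E]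

theorem contMDiffAt_inclusion {i : M → E} (hA : ∀ e ∈ atlas (Fin d → ℂ) M, IsAnalyticChart i e)
    (p : M) : ContMDiffAt 𝓘(ℂ, Fin d → ℂ) 𝓘(ℂ, E) ω i p := by
  have hp := mem_chart_source (Fin d → ℂ) p
  have he := chart_mem_atlas (Fin d → ℂ) p
  set e := chartAt (Fin d → ℂ) p
  have h1 : ContMDiffAt 𝓘(ℂ, Fin d → ℂ) 𝓘(ℂ, E) ω (fun u => i (e.symm u)) (e p) :=
    ((hA e he).analyticOnNhd_symm _ (e.map_source hp)).contDiffAt.contMDiffAt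
  refine (h1.comp p (contMDiffAt_chart he hp)).congr_of_eventuallyEq ?_
  filter_upwards [e.open_source.mem_nhds hp] with q hq
  simp [e.left_inv hq]

theorem mdifferentiableAt_inclusion {i : M → E}
    (hA : ∀ e ∈ atlas (Fin d → ℂ) M, IsAnalyticChart i e) (p : M) :
    MDifferentiableAt 𝓘(ℂ, Fin d → ℂ) 𝓘(ℂ, E) i p :=
  (contMDiffAt_inclusion hA p).mdifferentiableAt (by simp)

theorem contMDiffAt_of_eventuallyEq_inclusion {i : M → E}
    (hA : ∀ e ∈ atlas (Fin d → ℂ) M, IsAnalyticChart i e) {f : M → ℂ} {F : E → ℂ} {p : M}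
    (hF : AnalyticAt ℂ F (i p)) (h : ∀ᶠ q in 𝓝 p, f q = F (i q)) :
    ContMDiffAt 𝓘(ℂ, Fin d → ℂ) 𝓘(ℂ, ℂ) ω f p :=
  (hF.contDiffAt.contMDiffAt.comp p (contMDiffAt_inclusion hA p)).congr_of_eventuallyEq h

/-- A chart factors locally through the inclusion, so the latter is an immersion. -/
theorem inclusionDeriv_injective {i : M → E}
    (hA : ∀ e ∈ atlas (Fin d → ℂ) M, IsAnalyticChart i e) (p : M) :
    Function.Injective (inclusionDeriv d i p) := by
  have hp := mem_chart_source (Fin d → ℂ) p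
  have he := chart_mem_atlas (Fin d → ℂ) p
  set e := chartAt (Fin d → ℂ) p
  obtain ⟨C, hC, hCe⟩ := (hA e he).exists_extension _ hp
  have : IsManifold 𝓘(ℂ, Fin d → ℂ) 1 M := IsManifold.of_le (n := ω) le_top
  have h1 : Function.Injective (mfderiv 𝓘(ℂ, Fin d → ℂ) 𝓘(ℂ, Fin d → ℂ) e p) :=
    ((mdifferentiable_of_mem_atlas he).mfderiv hp).injective
  have h2 : mfderiv 𝓘(ℂ, Fin d → ℂ) 𝓘(ℂ, Fin d → ℂ) e p
      = (mfderiv 𝓘(ℂ, E) 𝓘(ℂ, Fin d → ℂ) C (i p)).comp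
          (mfderiv 𝓘(ℂ, Fin d → ℂ) 𝓘(ℂ, E) i p) := by
    rw [← mfderiv_comp p (hC.contDiffAt.contMDiffAt.mdifferentiableAt (by simp : (ω : WithTop ℕ∞) ≠ 0))
      (mdifferentiableAt_inclusion hA p)]
    exact Filter.EventuallyEq.mfderiv_eq hCe
  intro v w hvw
  apply h1
  rw [h2]
  exact congrArg (mfderiv 𝓘(ℂ, E) 𝓘(ℂ, Fin d → ℂ) C (i p)) hvw

/-- The chain rule for the composition of a map into `M` with the inclusion. -/
theorem inclusionDeriv_comp {i : M → E}
    (hA : ∀ e ∈ atlas (Fin d → ℂ) M, IsAnalyticChart i e)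
    {X : Type} [NormedAddCommGroup X] [NormedSpace ℂ X] {g : X → M} {u : X}
    (hg : MDifferentiableAt 𝓘(ℂ, X) 𝓘(ℂ, Fin d → ℂ) g u) (v : X) :
    inclusionDeriv d i (g u) (mfderiv 𝓘(ℂ, X) 𝓘(ℂ, Fin d → ℂ) g u v)
      = fderiv ℂ (fun w => i (g w)) u v := by
  have := mfderiv_comp u (mdifferentiableAt_inclusion hA (g u)) hg
  rw [mfderiv_eq_fderiv] at this
  exact (congrArg (fun A : X →L[ℂ] E => A v) this).symm

/-- The differential of a function that extends to the normed space. -/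
theorem dAt_of_eventuallyEq {i : M → E}
    (hA : ∀ e ∈ atlas (Fin d → ℂ) M, IsAnalyticChart i e) {f : M → ℂ} {F : E → ℂ} {p : M}
    (hF : DifferentiableAt ℂ F (i p)) (h : ∀ᶠ q in 𝓝 p, f q = F (i q))
    (v : TangentSpace 𝓘(ℂ, Fin d → ℂ) p) :
    dAt f p v = fderiv ℂ F (i p) (inclusionDeriv d i p v) := by
  have h1 : mfderiv 𝓘(ℂ, Fin d → ℂ) 𝓘(ℂ, ℂ) f p
      = mfderiv 𝓘(ℂ, Fin d → ℂ) 𝓘(ℂ, ℂ) (F ∘ i) p := Filter.EventuallyEq.mfderiv_eq h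
  rw [mfderiv_comp p hF.mdifferentiableAt (mdifferentiableAt_inclusion hA p),
    mfderiv_eq_fderiv] at h1
  exact congrArg (fun A : (Fin d → ℂ) →L[ℂ] ℂ => A v) h1

theorem chartForm_pullbackForm {k : ℕ} {i : M → E}
    (hA : ∀ e ∈ atlas (Fin d → ℂ) M, IsAnalyticChart i e) (η : E → E [⋀^Fin k]→L[ℂ] ℂ)
    {e : OpenPartialHomeomorph M (Fin d → ℂ)} (he : e ∈ atlas (Fin d → ℂ) M) {u : Fin d → ℂ}
    (hu : u ∈ e.target) :
    chartForm (pullbackForm i η) e u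
      = (η (i (e.symm u))).compContinuousLinearMap (fderiv ℂ (fun v => i (e.symm v)) u) := by
  ext v
  show η (i (e.symm u)) _ = η (i (e.symm u)) _
  congr 1
  funext j
  exact inclusionDeriv_comp hA ((contMDiffAt_chart_symm he hu).mdifferentiableAt (by simp)) (v j)

/-- The exterior derivative commutes with the pullback to `M`. -/
theorem isExteriorDerivative_pullbackForm {k : ℕ} {i : M → E}
    (hA : ∀ e ∈ atlas (Fin d → ℂ) M, IsAnalyticChart i e) {η : E → E [⋀^Fin k]→L[ℂ] ℂ}
    (hη : ∀ p : M, DifferentiableAt ℂ η (i p)) :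
    IsExteriorDerivative (M := M) (d := d) (pullbackForm i η) (pullbackForm i (extDeriv η)) := by
  intro e he u hu
  have h : chartForm (pullbackForm i η) e =ᶠ[𝓝 u] fun u =>
      (η (i (e.symm u))).compContinuousLinearMap (fderiv ℂ (fun v => i (e.symm v)) u) := by
    filter_upwards [e.open_target.mem_nhds hu] with v hv
    exact chartForm_pullbackForm hA η he hv
  rw [h.extDeriv_eq, chartForm_pullbackForm hA _ he hu]
  exact extDeriv_pullback (hη _) ((hA e he).analyticOnNhd_symm u hu).contDiffAt (r := ω) le_top

theorem isHolomorphicForm_pullbackForm_one {i : M → E}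
    (hA : ∀ e ∈ atlas (Fin d → ℂ) M, IsAnalyticChart i e) {α : E → E →L[ℂ] ℂ}
    (hα : ∀ p : M, AnalyticAt ℂ α (i p)) :
    IsHolomorphicForm (M := M) (d := d)
      (pullbackForm i fun x => ContinuousAlternatingMap.ofSubsingleton ℂ E ℂ (0 : Fin 1) (α x)) := by
  intro e he u hu
  have h1 := (hA e he).analyticOnNhd_symm u hu
  have h2 : AnalyticAt ℂ (fun u => (α (i (e.symm u))).comp (fderiv ℂ (fun v => i (e.symm v)) u)) u :=
    (((hα (e.symm u)).comp_of_eq h1 rfl).contDiffAt.clm_comp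
      (h1.contDiffAt.fderiv_right (m := ω) le_top)).analyticAt
  have h3 := ((ContinuousAlternatingMap.ofSubsingletonLIE (𝕜 := ℂ) (E := Fin d → ℂ) (F := ℂ)
    (i := (0 : Fin 1))).toContinuousLinearEquiv.toContinuousLinearMap.analyticAt _).comp h2
  refine h3.congr ?_
  filter_upwards [e.open_target.mem_nhds hu] with v hv
  rw [chartForm_pullbackForm hA _ he hv]
  rfl

end Embedded

/-! ### The Poisson structure of a symplectic form -/

section Linear

theorem update_pair_zero {V : Type} (v w x : V) : Function.update ![v, w] 0 x = ![x, w] := by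
  ext j; fin_cases j <;> rfl

theorem update_pair_one {V : Type} (v w x : V) : Function.update ![v, w] 1 x = ![v, x] := by
  ext j; fin_cases j <;> rfl

variable {V : Type} [NormedAddCommGroup V] [NormedSpace ℂ V]

/-- Non-degeneracy of a two-form on a vector space. -/
def FormNondegenerate (s : V [⋀^Fin 2]→L[ℂ] ℂ) : Prop := ∀ v, (∀ w, s ![v, w] = 0) → v = 0

theorem FormNondegenerate.compContinuousLinearMap {s : V [⋀^Fin 2]→L[ℂ] ℂ}
    (hs : FormNondegenerate s) {A : V →L[ℂ] V} (hA : Function.Bijective A) :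
    FormNondegenerate (s.compContinuousLinearMap A) := by
  intro v hv
  refine (map_eq_zero_iff A hA.1).mp (hs _ fun w => ?_)
  obtain ⟨w, rfl⟩ := hA.2 w
  rw [← hv w, ContinuousAlternatingMap.compContinuousLinearMap_apply]
  congr 1
  ext j
  fin_cases j <;> rfl

variable [FiniteDimensional ℂ V]

/-- The map `v ↦ s(v, ·)` of a two-form `s`. -/
def flat (s : V [⋀^Fin 2]→L[ℂ] ℂ) : V →L[ℂ] V →L[ℂ] ℂ :=
  LinearMap.toContinuousLinearMap
    { toFun := fun v => LinearMap.toContinuousLinearMap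
        { toFun := fun w => s ![v, w]
          map_add' := fun w w' => by
            simpa only [update_pair_one] using s.map_update_add ![v, 0] 1 w w'
          map_smul' := fun c w => by
            simpa only [update_pair_one, RingHom.id_apply] using s.map_update_smul ![v, 0] 1 c w }
      map_add' := fun v v' => by
        ext w
        change s ![v + v', w] = s ![v, w] + s ![v', w]
        simpa only [update_pair_zero] using s.map_update_add ![0, w] 0 v v'
      map_smul' := fun c v => by
        ext w
        change s ![c • v, w] = c • s ![v, w]
        simpa only [update_pair_zero] using s.map_update_smul ![0, w] 0 c v }

theorem flat_apply (s : V [⋀^Fin 2]→L[ℂ] ℂ) (v w : V) : flat s v w = s ![v, w] := rfl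

theorem flat_self (s : V [⋀^Fin 2]→L[ℂ] ℂ) (v : V) : flat s v v = 0 :=
  s.map_eq_zero_of_eq ![v, v] (i := 0) (j := 1) rfl (by decide)

theorem flat_swap (s : V [⋀^Fin 2]→L[ℂ] ℂ) (v w : V) : flat s v w = -flat s w v := by
  have h := flat_self s (v + w)
  simp only [map_add, add_apply, flat_self, zero_add, add_zero] at h
  linear_combination h

/-- The inverse of `flat s`; it is zero if `s` is degenerate. -/
def formSharp (s : V [⋀^Fin 2]→L[ℂ] ℂ) : (V →L[ℂ] ℂ) →L[ℂ] V := (flat s).inverse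

/-- The bilinear form on covectors that is inverse to the two-form `s`. -/
def poissonTensor (s : V [⋀^Fin 2]→L[ℂ] ℂ) : (V →L[ℂ] ℂ) →ₗ[ℂ] (V →L[ℂ] ℂ) →ₗ[ℂ] ℂ :=
  LinearMap.mk₂ ℂ (fun α β => α (formSharp s β)) (fun _ _ _ => rfl) (fun _ _ _ => rfl)
    (fun α β β' => by rw [map_add, map_add]) (fun c α β => by rw [map_smul, map_smul])

theorem poissonTensor_apply (s : V [⋀^Fin 2]→L[ℂ] ℂ) (α β : V →L[ℂ] ℂ) :
    poissonTensor s α β = α (formSharp s β) := rfl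

theorem FormNondegenerate.exists_equiv {s : V [⋀^Fin 2]→L[ℂ] ℂ} (hs : FormNondegenerate s) :
    ∃ B : V ≃L[ℂ] (V →L[ℂ] ℂ), (B : V →L[ℂ] V →L[ℂ] ℂ) = flat s := by
  have hinj : Function.Injective (flat s : V →ₗ[ℂ] V →L[ℂ] ℂ) := by
    refine (injective_iff_map_eq_zero _).mpr fun v hv => hs v fun w => ?_
    rw [← flat_apply]
    exact congrArg (fun A : V →L[ℂ] ℂ => A w) hv
  have hdim : Module.finrank ℂ V = Module.finrank ℂ (V →L[ℂ] ℂ) := by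
    rw [← (LinearMap.toContinuousLinearMap (𝕜 := ℂ) (E := V) (F' := ℂ)).finrank_eq]
    exact (Subspace.dual_finrank_eq (K := ℂ) (V := V)).symm
  refine ⟨(LinearEquiv.ofInjectiveOfFinrankEq _ hinj hdim).toContinuousLinearEquiv, ?_⟩
  ext v w
  rfl

theorem FormNondegenerate.form_sharp {s : V [⋀^Fin 2]→L[ℂ] ℂ} (hs : FormNondegenerate s)
    (α : V →L[ℂ] ℂ) (w : V) : flat s (formSharp s α) w = α w := by
  obtain ⟨B, hB⟩ := hs.exists_equiv
  rw [formSharp, ← hB, ContinuousLinearMap.inverse_equiv]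
  simp

theorem FormNondegenerate.eq_sharp {s : V [⋀^Fin 2]→L[ℂ] ℂ} (hs : FormNondegenerate s)
    {α : V →L[ℂ] ℂ} {v : V} (h : ∀ w, flat s v w = α w) : formSharp s α = v := by
  refine (sub_eq_zero.mp (hs _ fun w => ?_))
  rw [← flat_apply, map_sub, sub_apply, hs.form_sharp, h, sub_self]

theorem FormNondegenerate.poissonTensor_eq {s : V [⋀^Fin 2]→L[ℂ] ℂ} (hs : FormNondegenerate s)
    (α β : V →L[ℂ] ℂ) : poissonTensor s α β = flat s (formSharp s α) (formSharp s β) := by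
  rw [hs.form_sharp, poissonTensor_apply]

theorem FormNondegenerate.poissonTensor_self {s : V [⋀^Fin 2]→L[ℂ] ℂ} (hs : FormNondegenerate s)
    (α : V →L[ℂ] ℂ) : poissonTensor s α α = 0 := by
  rw [hs.poissonTensor_eq, flat_self]

theorem FormNondegenerate.eq_zero_of_poissonTensor {s : V [⋀^Fin 2]→L[ℂ] ℂ}
    (hs : FormNondegenerate s) {α : V →L[ℂ] ℂ} (h : ∀ β, poissonTensor s α β = 0) : α = 0 := by
  ext w
  have h2 : formSharp s (flat s w) = w := hs.eq_sharp fun u => rfl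
  simpa only [poissonTensor_apply, h2, zero_apply] using h (flat s w)

theorem flat_compContinuousLinearMap (s : V [⋀^Fin 2]→L[ℂ] ℂ) (A : V →L[ℂ] V) (v w : V) :
    flat (s.compContinuousLinearMap A) v w = flat s (A v) (A w) := by
  rw [flat_apply, flat_apply, ContinuousAlternatingMap.compContinuousLinearMap_apply]
  congr 1
  ext j
  fin_cases j <;> rfl

/-- The inverse of a two-form is natural with respect to isomorphisms. -/
theorem FormNondegenerate.poissonTensor_comp {s : V [⋀^Fin 2]→L[ℂ] ℂ}
    (hs : FormNondegenerate s) {A : V →L[ℂ] V} (hA : Function.Bijective A) (α β : V →L[ℂ] ℂ) :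
    poissonTensor (s.compContinuousLinearMap A) (α.comp A) (β.comp A) = poissonTensor s α β := by
  obtain ⟨v, hv⟩ := hA.2 (formSharp s β)
  have h : formSharp (s.compContinuousLinearMap A) (β.comp A) = v := by
    refine (hs.compContinuousLinearMap hA).eq_sharp fun w => ?_
    rw [flat_compContinuousLinearMap, hv, hs.form_sharp]
    rfl
  rw [poissonTensor_apply, poissonTensor_apply, h, ContinuousLinearMap.comp_apply, hv]

end Linear

section Coordinates

variable {V : Type} [NormedAddCommGroup V] [NormedSpace ℂ V] [FiniteDimensional ℂ V]

theorem analyticAt_flat {s : V → V [⋀^Fin 2]→L[ℂ] ℂ} {u : V} (hs : AnalyticAt ℂ s u) :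
    AnalyticAt ℂ (fun v => flat (s v)) u := by
  obtain ⟨O, hO, hOo, huO⟩ := eventually_nhds_iff.mp hs.eventually_analyticAt
  have h : ContDiffOn ℂ ω (fun v => flat (s v)) O := by
    refine contDiffOn_clm_apply.mpr fun v => contDiffOn_clm_apply.mpr fun w y hy => ?_
    exact (((ContinuousLinearMap.analyticAt (𝕜 := ℂ) (E := V [⋀^Fin 2]→L[ℂ] ℂ)
      (ContinuousAlternatingMap.apply ℂ V ℂ ![v, w]) (s y)).comp
        (hO y hy)).contDiffAt).contDiffWithinAt
  exact (h.contDiffAt (hOo.mem_nhds huO)).analyticAt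

/-- The vector field `X` with `s(X, ·) = df`. -/
def hamField (s : V → V [⋀^Fin 2]→L[ℂ] ℂ) (f : V → ℂ) (u : V) : V :=
  formSharp (s u) (fderiv ℂ f u)

/-- The Poisson bracket of the symplectic form `s`. -/
def coordBracket (s : V → V [⋀^Fin 2]→L[ℂ] ℂ) (f g : V → ℂ) (u : V) : ℂ :=
  poissonTensor (s u) (fderiv ℂ f u) (fderiv ℂ g u)

variable {s : V → V [⋀^Fin 2]→L[ℂ] ℂ} {u : V}

theorem analyticAt_hamField (hs : AnalyticAt ℂ s u) (hn : FormNondegenerate (s u)) {f : V → ℂ}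
    (hf : AnalyticAt ℂ f u) : AnalyticAt ℂ (hamField s f) u := by
  obtain ⟨B, hB⟩ := hn.exists_equiv
  have h1 : ContDiffAt ℂ ω (fun v => formSharp (s v)) u := by
    have h2 : ContDiffAt ℂ ω (ContinuousLinearMap.inverse : (V →L[ℂ] V →L[ℂ] ℂ) → _)
        (flat (s u)) := by
      rw [← hB]
      exact contDiffAt_map_inverse B
    exact h2.comp u (analyticAt_flat hs).contDiffAt
  exact (h1.clm_apply hf.fderiv.contDiffAt).analyticAt

theorem analyticAt_coordBracket (hs : AnalyticAt ℂ s u) (hn : FormNondegenerate (s u))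
    {f g : V → ℂ} (hf : AnalyticAt ℂ f u) (hg : AnalyticAt ℂ g u) :
    AnalyticAt ℂ (coordBracket s f g) u :=
  (hf.fderiv.contDiffAt.clm_apply (analyticAt_hamField hs hn hg).contDiffAt).analyticAt

/-- The derivative of a Poisson bracket in terms of the second derivatives of the functions and the
derivative of the two-form, by differentiation of `s(X_h, ·) = dh`. -/
theorem fderiv_coordBracket (hs : AnalyticAt ℂ s u) (hn : ∀ᶠ v in 𝓝 u, FormNondegenerate (s v))
    {g h : V → ℂ} (hg : AnalyticAt ℂ g u) (hh : AnalyticAt ℂ h u) (w : V) :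
    fderiv ℂ (coordBracket s g h) u w
      = fderiv ℂ (fderiv ℂ g) u w (hamField s h u) - fderiv ℂ (fderiv ℂ h) u w (hamField s g u)
        + fderiv ℂ (fun v => flat (s v)) u w (hamField s h u) (hamField s g u) := by
  have hnu := hn.self_of_nhds
  have hX := (analyticAt_hamField hs hnu hh).differentiableAt.hasFDerivAt
  have hB := (analyticAt_flat hs).differentiableAt.hasFDerivAt
  have h1 : fderiv ℂ (coordBracket s g h) u w
      = fderiv ℂ g u (fderiv ℂ (hamField s h) u w)
        + fderiv ℂ (fderiv ℂ g) u w (hamField s h u) := by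
    have := (hg.fderiv.differentiableAt.hasFDerivAt.clm_apply hX).fderiv
    exact congrArg (fun A : V →L[ℂ] ℂ => A w) this
  have h2 : fderiv ℂ (fderiv ℂ h) u w
      = flat (s u) (fderiv ℂ (hamField s h) u w)
        + fderiv ℂ (fun v => flat (s v)) u w (hamField s h u) := by
    have h3 : fderiv ℂ h =ᶠ[𝓝 u] fun v => flat (s v) (hamField s h v) := by
      filter_upwards [hn] with v hv
      ext c
      exact (hv.form_sharp _ _).symm
    rw [h3.fderiv_eq]
    exact congrArg (fun A : V →L[ℂ] V →L[ℂ] ℂ => A w) (hB.clm_apply hX).fderiv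
  have h4 : fderiv ℂ g u (fderiv ℂ (hamField s h) u w)
      = -flat (s u) (fderiv ℂ (hamField s h) u w) (hamField s g u) := by
    rw [← flat_swap]
    exact (hnu.form_sharp _ _).symm
  rw [h1, h4, h2, add_apply]
  ring

/-- The Jacobi identity for the Poisson bracket of a closed two-form. The second derivatives of the
functions cancel by symmetry, and the derivatives of the two-form add up to the value of its
exterior derivative on the three Hamiltonian vectors. -/
theorem coordBracket_jacobi (hs : AnalyticAt ℂ s u) (hn : ∀ᶠ v in 𝓝 u, FormNondegenerate (s v))
    (hclosed : extDeriv s u = 0) {f g h : V → ℂ} (hf : AnalyticAt ℂ f u) (hg : AnalyticAt ℂ g u)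
    (hh : AnalyticAt ℂ h u) :
    coordBracket s f (coordBracket s g h) u + coordBracket s g (coordBracket s h f) u
      + coordBracket s h (coordBracket s f g) u = 0 := by
  have hnu := hn.self_of_nhds
  have hsymm : ∀ k : V → ℂ, AnalyticAt ℂ k u → ∀ v w, fderiv ℂ (fderiv ℂ k) u v w
      = fderiv ℂ (fderiv ℂ k) u w v := fun k hk v w =>
    (hk.contDiffAt (n := ω)).isSymmSndFDerivAt le_top v w
  have hder : ∀ k l : V → ℂ, coordBracket s k l u = -fderiv ℂ l u (hamField s k u) := by
    intro k l
    rw [coordBracket, hnu.poissonTensor_eq, flat_swap, hnu.form_sharp]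
    rfl
  have hcl : fderiv ℂ (fun v => flat (s v)) u (hamField s f u) (hamField s g u) (hamField s h u)
      - fderiv ℂ (fun v => flat (s v)) u (hamField s g u) (hamField s f u) (hamField s h u)
      + fderiv ℂ (fun v => flat (s v)) u (hamField s h u) (hamField s f u) (hamField s g u)
      = 0 := by
    have h1 := extDeriv_apply hs.differentiableAt
      ![hamField s f u, hamField s g u, hamField s h u]
    rw [hclosed, Fin.sum_univ_three] at h1
    have h2 : ∀ v w c : V, fderiv ℂ (fun y => flat (s y)) u v w c
        = fderiv ℂ (fun y => s y ![w, c]) u v := by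
      intro v w c
      have hB := (analyticAt_flat hs).differentiableAt.hasFDerivAt
      have := ((hB.clm_apply (hasFDerivAt_const w u)).clm_apply (hasFDerivAt_const c u)).fderiv
      have := congrArg (fun A : V →L[ℂ] ℂ => A v) this
      simp at this
      exact this.symm
    have r0 : ∀ a b c : V, Fin.removeNth (0 : Fin 3) ![a, b, c] = ![b, c] := fun a b c => by
      ext j; fin_cases j <;> rfl
    have r1 : ∀ a b c : V, Fin.removeNth (1 : Fin 3) ![a, b, c] = ![a, c] := fun a b c => by
      ext j; fin_cases j <;> rfl
    have r2 : ∀ a b c : V, Fin.removeNth (2 : Fin 3) ![a, b, c] = ![a, b] := fun a b c => by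
      ext j; fin_cases j <;> rfl
    rw [h2, h2, h2]
    simp only [r0, r1, r2] at h1
    simp at h1
    linear_combination -h1
  have hskew : ∀ v w c : V, fderiv ℂ (fun y => flat (s y)) u v w c
      = -fderiv ℂ (fun y => flat (s y)) u v c w := by
    intro v w c
    have hB := (analyticAt_flat hs).differentiableAt.hasFDerivAt
    have h1 := (hB.clm_apply (hasFDerivAt_const w u)).clm_apply (hasFDerivAt_const c u)
    have h2 := ((hB.clm_apply (hasFDerivAt_const c u)).clm_apply (hasFDerivAt_const w u)).neg
    have h3 : (fun y => flat (s y) w c) = fun y => -flat (s y) c w :=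
      funext fun y => flat_swap _ _ _
    rw [h3] at h1
    have := congrArg (fun A : V →L[ℂ] ℂ => A v) (h1.unique h2)
    simpa using this
  rw [hder, hder, hder, fderiv_coordBracket hs hn hg hh, fderiv_coordBracket hs hn hh hf,
    fderiv_coordBracket hs hn hf hg]
  rw [hsymm f hf (hamField s g u) (hamField s h u), hsymm g hg (hamField s f u) (hamField s h u),
    hsymm h hh (hamField s f u) (hamField s g u)]
  rw [hskew (hamField s f u) (hamField s h u), hskew (hamField s h u) (hamField s g u)]
  linear_combination hcl

end Coordinates

section Manifold

variable {d : ℕ} {M : Type} [TopologicalSpace M] [ChartedSpace (Fin d → ℂ) M]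

/-- The field of bilinear forms on the cotangent spaces that is inverse to a two-form. -/
def poissonOfForm (sigma : FormField d M 2) : CotangentPairing d M :=
  fun p => poissonTensor (V := Fin d → ℂ) (sigma p)

/-- Pointwise non-degeneracy of a field of two-forms. -/
def FieldNondegenerate (sigma : FormField d M 2) : Prop :=
  ∀ p : M, FormNondegenerate (V := Fin d → ℂ) (sigma p)

variable {sigma : FormField d M 2}

theorem corresponds_poissonOfForm (hs : FieldNondegenerate sigma) :
    Corresponds (poissonOfForm sigma) sigma := by
  intro p v w α β hα hβ
  have h1 : formSharp (V := Fin d → ℂ) (sigma p) α = v :=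
    (hs p).eq_sharp fun u => (hα u).symm
  have h2 : formSharp (V := Fin d → ℂ) (sigma p) β = w :=
    (hs p).eq_sharp fun u => (hβ u).symm
  have h3 := (hs p).poissonTensor_eq α β
  rw [h1, h2] at h3
  exact h3

theorem poissonNondegenerate_poissonOfForm (hs : FieldNondegenerate sigma) :
    PoissonNondegenerate (poissonOfForm sigma) := by
  intro p α h
  exact (hs p).eq_zero_of_poissonTensor h

variable [IsManifold 𝓘(ℂ, Fin d → ℂ) ω M]

/-- The differential of the inverse of a chart. -/
def chartSymmDeriv (e : OpenPartialHomeomorph M (Fin d → ℂ)) (u : Fin d → ℂ) :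
    (Fin d → ℂ) →L[ℂ] (Fin d → ℂ) :=
  mfderiv 𝓘(ℂ, Fin d → ℂ) 𝓘(ℂ, Fin d → ℂ) e.symm u

theorem chartSymmDeriv_bijective {e : OpenPartialHomeomorph M (Fin d → ℂ)}
    (he : e ∈ atlas (Fin d → ℂ) M) {u : Fin d → ℂ} (hu : u ∈ e.target) :
    Function.Bijective (chartSymmDeriv e u) := by
  have : IsManifold 𝓘(ℂ, Fin d → ℂ) 1 M := IsManifold.of_le (n := ω) le_top
  exact ((mdifferentiable_of_mem_atlas he).symm.mfderiv hu).bijective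

theorem fderiv_comp_chart_symm {e : OpenPartialHomeomorph M (Fin d → ℂ)}
    (he : e ∈ atlas (Fin d → ℂ) M) {u : Fin d → ℂ} (hu : u ∈ e.target) {f : M → ℂ}
    (hf : MDifferentiableAt 𝓘(ℂ, Fin d → ℂ) 𝓘(ℂ, ℂ) f (e.symm u)) :
    fderiv ℂ (fun v => f (e.symm v)) u
      = ((dAt f (e.symm u) : (Fin d → ℂ) →L[ℂ] ℂ)).comp (chartSymmDeriv e u) := by
  have := mfderiv_comp u hf ((contMDiffAt_chart_symm he hu).mdifferentiableAt (by simp))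
  rw [mfderiv_eq_fderiv] at this
  exact this

theorem nondegenerate_chartForm (hs : FieldNondegenerate sigma)
    {e : OpenPartialHomeomorph M (Fin d → ℂ)} (he : e ∈ atlas (Fin d → ℂ) M) {u : Fin d → ℂ}
    (hu : u ∈ e.target) : FormNondegenerate (chartForm sigma e u) :=
  (hs (e.symm u)).compContinuousLinearMap (chartSymmDeriv_bijective he hu)

/-- The bracket on `M`, expressed in a chart. -/
theorem pbracket_chart (hs : FieldNondegenerate sigma)
    {e : OpenPartialHomeomorph M (Fin d → ℂ)} (he : e ∈ atlas (Fin d → ℂ) M) {u : Fin d → ℂ}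
    (hu : u ∈ e.target) {f g : M → ℂ}
    (hf : MDifferentiableAt 𝓘(ℂ, Fin d → ℂ) 𝓘(ℂ, ℂ) f (e.symm u))
    (hg : MDifferentiableAt 𝓘(ℂ, Fin d → ℂ) 𝓘(ℂ, ℂ) g (e.symm u)) :
    pbracket (poissonOfForm sigma) f g (e.symm u)
      = coordBracket (chartForm sigma e) (fun v => f (e.symm v)) (fun v => g (e.symm v)) u := by
  rw [coordBracket, fderiv_comp_chart_symm he hu hf, fderiv_comp_chart_symm he hu hg]
  exact ((hs (e.symm u)).poissonTensor_comp (chartSymmDeriv_bijective he hu) _ _).symm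

/-- The inverse of a symplectic form is a Poisson structure. -/
theorem isPoisson_poissonOfForm (hs : FieldNondegenerate sigma) (hol : IsHolomorphicForm sigma)
    (hcl : IsExteriorDerivative sigma (fun _ => 0)) : IsPoisson (poissonOfForm sigma) := by
  have hmd : ∀ {U : Set M}, IsOpen U → ∀ {f : M → ℂ},
      ContMDiffOn 𝓘(ℂ, Fin d → ℂ) 𝓘(ℂ, ℂ) ω f U → ∀ {q}, q ∈ U →
      ContMDiffAt 𝓘(ℂ, Fin d → ℂ) 𝓘(ℂ, ℂ) ω f q :=
    fun hU _ hf _ hq => hf.contMDiffAt (hU.mem_nhds hq)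
  have hmd' : ∀ {f : M → ℂ} {q}, ContMDiffAt 𝓘(ℂ, Fin d → ℂ) 𝓘(ℂ, ℂ) ω f q →
      MDifferentiableAt 𝓘(ℂ, Fin d → ℂ) 𝓘(ℂ, ℂ) f q := fun h => h.mdifferentiableAt (by simp)
  -- the bracket of holomorphic functions near a point of a chart domain
  have hloc : ∀ {U : Set M}, IsOpen U → ∀ {f g : M → ℂ},
      ContMDiffOn 𝓘(ℂ, Fin d → ℂ) 𝓘(ℂ, ℂ) ω f U → ContMDiffOn 𝓘(ℂ, Fin d → ℂ) 𝓘(ℂ, ℂ) ω g U →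
      ∀ {e : OpenPartialHomeomorph M (Fin d → ℂ)}, e ∈ atlas (Fin d → ℂ) M → ∀ {u}, u ∈ e.target →
      e.symm u ∈ U → (fun v => pbracket (poissonOfForm sigma) f g (e.symm v)) =ᶠ[𝓝 u]
        coordBracket (chartForm sigma e) (fun v => f (e.symm v)) (fun v => g (e.symm v)) := by
    intro U hU f g hf hg e he u hu huU
    filter_upwards [e.open_target.mem_nhds hu,
      (e.continuousAt_symm hu).eventually_mem (hU.mem_nhds huU)] with v hv hvU
    exact pbracket_chart hs he hv (hmd' (hmd hU hf hvU)) (hmd' (hmd hU hg hvU))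
  have hhol : ∀ U : Set M, IsOpen U → ∀ f g : M → ℂ,
    ContMDiffOn 𝓘(ℂ, Fin d → ℂ) 𝓘(ℂ, ℂ) ω f U → ContMDiffOn 𝓘(ℂ, Fin d → ℂ) 𝓘(ℂ, ℂ) ω g U →
    ContMDiffOn 𝓘(ℂ, Fin d → ℂ) 𝓘(ℂ, ℂ) ω (pbracket (poissonOfForm sigma) f g) U := by
    intro U hU f g hf hg p hpU
    have hp := mem_chart_source (Fin d → ℂ) p
    have he := chart_mem_atlas (Fin d → ℂ) p
    set e := chartAt (Fin d → ℂ) p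
    have hu := e.map_source hp
    have hpe : e.symm (e p) = p := e.left_inv hp
    have hbr := hloc hU hf hg he hu (by rwa [hpe])
    have han := analyticAt_coordBracket (hol e he _ hu) (nondegenerate_chartForm hs he hu)
      (analyticAt_comp_chart_symm he hu (by rw [hpe]; exact hmd hU hf hpU))
      (analyticAt_comp_chart_symm he hu (by rw [hpe]; exact hmd hU hg hpU))
    have h1 := (han.congr hbr.symm).contDiffAt.contMDiffAt.comp p (contMDiffAt_chart he hp)
    refine (h1.congr_of_eventuallyEq ?_).contMDiffWithinAt
    filter_upwards [e.open_source.mem_nhds hp] with q hq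
    simp [e.left_inv hq]
  refine ⟨fun p α => ?_, hhol, ?_⟩
  · exact (hs p).poissonTensor_self α
  · intro U hU f g h hf hg hh p hpU
    have hp := mem_chart_source (Fin d → ℂ) p
    have he := chart_mem_atlas (Fin d → ℂ) p
    set e := chartAt (Fin d → ℂ) p
    have hu := e.map_source hp
    have hpe : e.symm (e p) = p := e.left_inv hp
    have hpU' : e.symm (e p) ∈ U := by rwa [hpe]
    have key : ∀ {k l m : M → ℂ}, ContMDiffOn 𝓘(ℂ, Fin d → ℂ) 𝓘(ℂ, ℂ) ω k U →
        ContMDiffOn 𝓘(ℂ, Fin d → ℂ) 𝓘(ℂ, ℂ) ω l U → ContMDiffOn 𝓘(ℂ, Fin d → ℂ) 𝓘(ℂ, ℂ) ω m U →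
        pbracket (poissonOfForm sigma) k (pbracket (poissonOfForm sigma) l m) p
          = coordBracket (chartForm sigma e) (fun v => k (e.symm v))
            (coordBracket (chartForm sigma e) (fun v => l (e.symm v)) (fun v => m (e.symm v)))
            (e p) := by
      intro k l m hk hl hm
      have h1 := (hloc hU hk (hhol U hU l m hl hm) he hu hpU').self_of_nhds
      simp only [hpe] at h1
      rw [h1, coordBracket, coordBracket, (hloc hU hl hm he hu hpU').fderiv_eq]
    rw [key hf hg hh, key hg hh hf, key hh hf hg]
    have hex : extDeriv (chartForm sigma e) (e p) = 0 := by
      rw [hcl e he _ hu]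
      rfl
    refine coordBracket_jacobi (hol e he _ hu) ?_ hex
      (analyticAt_comp_chart_symm he hu (hmd hU hf hpU'))
      (analyticAt_comp_chart_symm he hu (hmd hU hg hpU'))
      (analyticAt_comp_chart_symm he hu (hmd hU hh hpU'))
    filter_upwards [e.open_target.mem_nhds hu] with v hv
    exact nondegenerate_chartForm hs he hv

end Manifold

/-! ### Charts of a regular level set -/

section RegularLevel

variable {E Y : Type} [NormedAddCommGroup E] [NormedSpace ℂ E] [FiniteDimensional ℂ E]
  [NormedAddCommGroup Y] [NormedSpace ℂ Y] [FiniteDimensional ℂ Y]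

/-- A surjective linear map is completed by linear coordinates on its kernel to an isomorphism. -/
theorem exists_complementary_coordinates {d : ℕ} {L : E →L[ℂ] Y} (hL : Function.Surjective L)
    (hd : Module.finrank ℂ E = d + Module.finrank ℂ Y) :
    ∃ (A : E →L[ℂ] Fin d → ℂ) (B : E ≃L[ℂ] (Fin d → ℂ) × Y),
      (B : E →L[ℂ] (Fin d → ℂ) × Y) = A.prod L := by
  let K := LinearMap.ker (L : E →ₗ[ℂ] Y)
  have hK : Module.finrank ℂ K = d := by
    have h1 : Module.finrank ℂ (LinearMap.range (L : E →ₗ[ℂ] Y)) + Module.finrank ℂ K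
        = Module.finrank ℂ E := LinearMap.finrank_range_add_finrank_ker (L : E →ₗ[ℂ] Y)
    rw [LinearMap.range_eq_top.mpr hL, finrank_top] at h1
    omega
  obtain ⟨pr, hpr⟩ := LinearMap.exists_leftInverse_of_injective K.subtype K.ker_subtype
  let κ : K ≃ₗ[ℂ] (Fin d → ℂ) := LinearEquiv.ofFinrankEq _ _ (by simpa using hK)
  let A : E →L[ℂ] Fin d → ℂ := LinearMap.toContinuousLinearMap (κ.toLinearMap ∘ₗ pr)
  have hinj : Function.Injective ((A.prod L : E →L[ℂ] (Fin d → ℂ) × Y) : E →ₗ[ℂ] (Fin d → ℂ) × Y) := by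
    refine (injective_iff_map_eq_zero _).mpr fun v hv => ?_
    have h1 : κ (pr v) = 0 := congrArg Prod.fst hv
    have h2 : L v = 0 := congrArg Prod.snd hv
    have h3 : pr v = ⟨v, h2⟩ := LinearMap.congr_fun hpr ⟨v, h2⟩
    rw [h3, LinearEquiv.map_eq_zero_iff] at h1
    exact congrArg Subtype.val h1
  refine ⟨A, (LinearEquiv.ofInjectiveOfFinrankEq _ hinj (by simp [hd])).toContinuousLinearEquiv, ?_⟩
  ext v <;> rfl

/-- A topologically embedded subset of `E` that is near one of its points the zero set of a
submersion `Ψ` has an analytic chart at this point. -/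
theorem exists_analyticChart {d : ℕ} {M : Type} [TopologicalSpace M] {i : M → E}
    (hi : Topology.IsEmbedding i) {Ψ : E → Y} {p : M} (hΨ : AnalyticAt ℂ Ψ (i p))
    (hsurj : Function.Surjective (fderiv ℂ Ψ (i p)))
    (hd : Module.finrank ℂ E = d + Module.finrank ℂ Y)
    {O : Set E} (hO : IsOpen O) (hpO : i p ∈ O) (hrange : ∀ x ∈ O, x ∈ Set.range i ↔ Ψ x = 0) :
    ∃ e : OpenPartialHomeomorph M (Fin d → ℂ), p ∈ e.source ∧ IsAnalyticChart i e := by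
  have : CompleteSpace E := FiniteDimensional.complete ℂ E
  have : Nonempty M := ⟨p⟩
  -- `Ψ`, completed by linear coordinates `A`, is a local isomorphism `h` near `i p`; the chart is
  -- the restriction of `A`, and its inverse is `h⁻¹` on the plane of vectors `(u, 0)`
  obtain ⟨A, B, hB⟩ := exists_complementary_coordinates hsurj hd
  let f : E → (Fin d → ℂ) × Y := fun y => (A y, Ψ y)
  have hf : AnalyticAt ℂ f (i p) := (A.analyticAt _).prod hΨ
  have hf' : HasStrictFDerivAt f (B : E →L[ℂ] (Fin d → ℂ) × Y) (i p) := by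
    rw [hB]
    exact A.hasStrictFDerivAt.prodMk hΨ.hasStrictFDerivAt
  let h := hf'.toOpenPartialHomeomorph f
  have hcoe : ∀ y, h y = f y := fun y => congrFun (hf'.toOpenPartialHomeomorph_coe) y
  have hpS : i p ∈ h.source := hf'.mem_toOpenPartialHomeomorph_source
  have hpT : f (i p) ∈ h.target := by rw [← hcoe]; exact h.map_source hpS
  have hsymm : h.symm (f (i p)) = i p := by rw [← hcoe, h.left_inv hpS]
  have han : AnalyticAt ℂ h.symm (f (i p)) := by
    have h1 : HasFDerivAt h (B : E →L[ℂ] (Fin d → ℂ) × Y) (h.symm (f (i p))) := by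
      rw [hsymm]; exact hf'.hasFDerivAt
    have h2 : ContDiffAt ℂ ω h (h.symm (f (i p))) := by
      rw [hsymm]; exact hf.contDiffAt
    exact (h.contDiffAt_symm hpT h1 h2).analyticAt
  -- on the open set `T` the inverse of `h` is analytic, with values in `O`
  obtain ⟨T, hT, hTo, hpT'⟩ := eventually_nhds_iff.mp ((han.eventually_analyticAt.and
    (h.open_target.mem_nhds hpT)).and
      (han.continuousAt.eventually_mem (by rw [hsymm]; exact hO.mem_nhds hpO)))
  have hΨ0 : ∀ q, i q ∈ O → Ψ (i q) = 0 := fun q hq => (hrange _ hq).mp ⟨q, rfl⟩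
  let T' : Set (Fin d → ℂ) := {u | (u, (0 : Y)) ∈ T}
  have hT'o : IsOpen T' := hTo.preimage (by fun_prop)
  let inv : (Fin d → ℂ) → M := fun u => Function.invFun i (h.symm (u, 0))
  have hTf : ∀ y ∈ T, f (h.symm y) = y := fun y hy => by rw [← hcoe, h.right_inv (hT y hy).1.2]
  have hinv : ∀ u ∈ T', i (inv u) = h.symm (u, 0) := by
    intro u hu
    have h1 : h.symm (u, 0) ∈ Set.range i := by
      refine (hrange _ (hT _ hu).2).mpr ?_
      exact congrArg Prod.snd (hTf _ hu)
    exact Function.invFun_eq h1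
  have hfi : ∀ q, i q ∈ h.source → f (i q) ∈ T → f (i q) = (A (i q), 0) := by
    intro q hq hqT
    have h1 : i q ∈ O := by
      have := (hT _ hqT).2
      rwa [← hcoe, h.left_inv hq] at this
    rw [← hΨ0 q h1]
  have hopen : IsOpen (i ⁻¹' (h.source ∩ h ⁻¹' T)) :=
    (h.isOpen_inter_preimage hTo).preimage hi.continuous
  have hcont : ContinuousOn (fun u : Fin d → ℂ => h.symm (u, (0 : Y))) T' :=
    h.symm.continuousOn.comp (by fun_prop) fun u hu => (hT _ hu).1.2
  let e : OpenPartialHomeomorph M (Fin d → ℂ) :=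
    { toFun := fun q => A (i q)
      invFun := inv
      source := i ⁻¹' (h.source ∩ h ⁻¹' T)
      target := T'
      map_source' := by
        rintro q ⟨hq, hqT⟩
        rw [Set.mem_preimage, hcoe] at hqT
        show (A (i q), (0 : Y)) ∈ T
        rwa [← hfi q hq hqT]
      map_target' := by
        intro u hu
        rw [Set.mem_preimage, hinv u hu]
        refine ⟨h.map_target (hT _ hu).1.2, ?_⟩
        rw [Set.mem_preimage, hcoe, hTf _ hu]
        exact hu
      left_inv' := by
        rintro q ⟨hq, hqT⟩
        rw [Set.mem_preimage, hcoe] at hqT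
        show Function.invFun i (h.symm (A (i q), 0)) = q
        rw [← hfi q hq hqT, ← hcoe, h.left_inv hq]
        exact Function.leftInverse_invFun hi.injective q
      right_inv' := by
        intro u hu
        show A (i (inv u)) = u
        rw [hinv u hu]
        exact congrArg Prod.fst (hTf _ hu)
      open_source := hopen
      open_target := hT'o
      continuousOn_toFun := (A.continuous.comp hi.continuous).continuousOn
      continuousOn_invFun := by
        rw [hi.isInducing.continuousOn_iff]
        exact hcont.congr hinv }
  refine ⟨e, ⟨hpS, ?_⟩, ?_, ?_⟩
  · rw [Set.mem_preimage, hcoe]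
    exact hpT'
  · intro u hu
    have h1 : AnalyticAt ℂ (fun u : Fin d → ℂ => h.symm (u, (0 : Y))) u :=
      (hT _ hu).1.1.comp_of_eq (analyticAt_id.prod analyticAt_const) rfl
    refine h1.congr ?_
    filter_upwards [hT'o.mem_nhds hu] with v hv
    exact (hinv v hv).symm
  · intro q _
    exact ⟨A, A.analyticAt _, Filter.Eventually.of_forall fun _ => rfl⟩

end RegularLevel

/-- The tangent space of a regular level set is the kernel of the differential of its equation. -/
theorem exists_inclusionDeriv_eq {d : ℕ} {M E Y : Type} [TopologicalSpace M]
    [NormedAddCommGroup E] [NormedSpace ℂ E] [FiniteDimensional ℂ E]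
    [NormedAddCommGroup Y] [NormedSpace ℂ Y] [FiniteDimensional ℂ Y]
    [ChartedSpace (Fin d → ℂ) M] [IsManifold 𝓘(ℂ, Fin d → ℂ) ω M] {i : M → E}
    (hA : ∀ e ∈ atlas (Fin d → ℂ) M, IsAnalyticChart i e) {Ψ : E → Y} {p : M}
    (hΨ : DifferentiableAt ℂ Ψ (i p)) (hsurj : Function.Surjective (fderiv ℂ Ψ (i p)))
    (hd : Module.finrank ℂ E = d + Module.finrank ℂ Y) (hzero : ∀ q, Ψ (i q) = 0) :
    (∀ v, fderiv ℂ Ψ (i p) (inclusionDeriv d i p v) = 0) ∧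
    ∀ V, fderiv ℂ Ψ (i p) V = 0 → ∃ v, inclusionDeriv d i p v = V := by
  have : CompleteSpace E := FiniteDimensional.complete ℂ E
  let J : (Fin d → ℂ) →L[ℂ] E := inclusionDeriv d i p
  have hJ : Function.Injective J := inclusionDeriv_injective hA p
  have hJ0 : ∀ v, fderiv ℂ Ψ (i p) (J v) = 0 := by
    have h1 := mfderiv_comp p hΨ.mdifferentiableAt (mdifferentiableAt_inclusion hA p)
    have h2 : mfderiv 𝓘(ℂ, Fin d → ℂ) 𝓘(ℂ, Y) (Ψ ∘ i) p = 0 := by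
      rw [show Ψ ∘ i = fun _ => (0 : Y) from funext hzero]
      exact mfderiv_const
    rw [h2, mfderiv_eq_fderiv] at h1
    intro v
    exact (congrArg (fun A : (Fin d → ℂ) →L[ℂ] Y => A v) h1).symm
  refine ⟨hJ0, ?_⟩
  let K : Submodule ℂ E := LinearMap.ker (fderiv ℂ Ψ (i p) : E →ₗ[ℂ] Y)
  have hle : LinearMap.range (J : (Fin d → ℂ) →ₗ[ℂ] E) ≤ K := by
    rintro _ ⟨v, rfl⟩
    exact hJ0 v
  have hK : Module.finrank ℂ K = d := by
    have h1 : Module.finrank ℂ (LinearMap.range (fderiv ℂ Ψ (i p) : E →ₗ[ℂ] Y))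
        + Module.finrank ℂ K = Module.finrank ℂ E := LinearMap.finrank_range_add_finrank_ker _
    rw [LinearMap.range_eq_top.mpr hsurj, finrank_top] at h1
    omega
  have hr : Module.finrank ℂ (LinearMap.range (J : (Fin d → ℂ) →ₗ[ℂ] E)) = d := by
    rw [LinearMap.finrank_range_of_inj hJ, Module.finrank_fin_fun]
  have heq := Submodule.eq_of_le_of_finrank_eq hle (by rw [hr, hK])
  intro V hV
  have : V ∈ LinearMap.range (J : (Fin d → ℂ) →ₗ[ℂ] E) := by rw [heq]; exact hV
  exact this

/-! ### The slice `G_0 = 1` -/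

section Ambient

section Calculus

attribute [local instance] Matrix.linftyOpNormedRing Matrix.linftyOpNormedAlgebra

theorem analyticAt_entry {E : Type*} [NormedAddCommGroup E] [NormedSpace ℂ E]
    {A : E → Matrix (Fin n) (Fin n) ℂ} {u : E} (h : AnalyticAt ℂ A u) (i j : Fin n) :
    AnalyticAt ℂ (fun v => A v i j) u :=
  ((LinearMap.toContinuousLinearMap (Matrix.entryLinearMap ℂ ℂ i j)).analyticAt _).comp h

theorem analyticAt_eig (x : Ambient N n) (k : Fin N) : AnalyticAt ℂ (fun y => eig y k) x :=
  ((ContinuousLinearMap.snd ℂ _ _).comp (ContinuousLinearMap.proj k :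
    Ambient N n →L[ℂ] _)).analyticAt x

end Calculus

theorem trace_moment {x : Ambient N n} (hx : ∀ k, (matG x k).det ≠ 0) :
    (moment x).trace = ∑ k, ∑ i, eig x k i := by
  rw [moment, Matrix.trace_sum]
  refine Finset.sum_congr rfl fun k _ => ?_
  rw [Matrix.trace_mul_comm, Matrix.nonsing_inv_mul_cancel_left _ _
    (isUnit_iff_ne_zero.mpr (hx k)), matL, Matrix.trace_diagonal]

theorem eig_injective {x : Ambient N n} (hx : NonResonant x) (k : Fin N) :
    Function.Injective (eig x k) := by
  intro i j hij
  by_contra hne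
  exact hx k i j hne 0 (by simp [hij])

theorem dMoment_add (x V W : Ambient N n) : dMoment x (V + W) = dMoment x V + dMoment x W := by
  simp only [dMoment, ← Finset.sum_add_distrib]
  refine Finset.sum_congr rfl fun k _ => ?_
  simp only [matG_add, matL_add, add_mul, mul_add]
  abel

theorem dMoment_mkAmbient {x : Ambient N n} (hx : ∀ k, (matG x k).det = 1)
    (g : Fin N → Matrix (Fin n) (Fin n) ℂ) (l : Fin N → Fin n → ℂ) :
    dMoment x (mkAmbient (fun k => matG x k * g k) l)
      = ∑ k, matG x k * (g k * matL x k - matL x k * g k + Matrix.diagonal (l k))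
        * (matG x k)⁻¹ := by
  rw [dMoment]
  refine Finset.sum_congr rfl fun k _ => ?_
  have hu : IsUnit (matG x k).det := by rw [hx k]; exact isUnit_one
  rw [matG_mkAmbient, matL_mkAmbient, Matrix.nonsing_inv_mul_cancel_left _ _ hu]
  simp only [mul_add, mul_sub, add_mul, sub_mul, Matrix.mul_assoc]
  abel

/-- Commutators with a diagonal matrix with distinct eigenvalues, together with diagonal matrices,
give all matrices. -/
theorem exists_commutator_add_diagonal {lam : Fin n → ℂ} (h : Function.Injective lam)
    (Q : Matrix (Fin n) (Fin n) ℂ) :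
    ∃ g : Matrix (Fin n) (Fin n) ℂ, g.trace = 0 ∧
      g * Matrix.diagonal lam - Matrix.diagonal lam * g + Matrix.diagonal (fun i => Q i i) = Q := by
  refine ⟨Matrix.of fun i j => if i = j then 0 else Q i j / (lam j - lam i), ?_, ?_⟩
  · simp [Matrix.trace]
  · ext i j
    rw [Matrix.add_apply, Matrix.sub_apply, Matrix.mul_diagonal, Matrix.diagonal_mul,
      Matrix.of_apply]
    by_cases hij : i = j
    · subst hij; simp
    · have : lam j - lam i ≠ 0 := sub_ne_zero.mpr fun h' => hij (h h').symm
      rw [if_neg hij, Matrix.diagonal_apply_ne _ hij]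
      field_simp
      ring

end Ambient

section Slice

variable [NeZero N]

/-- The space of values of the equations of the slice: matrices for `G_0` and `m`, scalars for
`det G_k` and `tr L_k` with `k ≠ 0`. -/
abbrev SliceTarget (N n : ℕ) [NeZero N] : Type :=
  (Fin n → Fin n → ℂ) × ({k : Fin N // k ≠ 0} → ℂ) × ({k : Fin N // k ≠ 0} → ℂ)
    × (Fin n → Fin n → ℂ)

/-- The equations `G_0 = 1`, `det G_k = 1` and `tr L_k = 0` for `k ≠ 0`, and `m = 0`. The equations
`det G_0 = 1` and `tr L_0 = 0` follow from these; without them the equations are independent. -/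
def sliceEq (x : Ambient N n) : SliceTarget N n :=
  (fun i j => matG x 0 i j - (1 : Matrix (Fin n) (Fin n) ℂ) i j,
    fun k => (matG x k).det - 1, fun k => ∑ i, eig x k i, fun i j => moment x i j)

/-- The differential of `sliceEq` where all `det G_k = 1`. -/
def dSliceEq (x V : Ambient N n) : SliceTarget N n :=
  (fun i j => matG V 0 i j, fun k => ((matG x k)⁻¹ * matG V k).trace,
    fun k => ∑ i, eig V k i, fun i j => dMoment x V i j)

section Calculus

attribute [local instance] Matrix.linftyOpNormedRing Matrix.linftyOpNormedAlgebra

theorem analyticAt_sliceEq {x : Ambient N n} (hx : ∀ k, (matG x k).det ≠ 0) :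
    AnalyticAt ℂ (sliceEq : Ambient N n → _) x := by
  refine AnalyticAt.prod ?_ (AnalyticAt.prod ?_ (AnalyticAt.prod ?_ ?_))
  · exact analyticAt_pi_iff.mpr fun i => analyticAt_pi_iff.mpr fun j =>
      (analyticAt_entry (analyticAt_matG x 0) i j).sub analyticAt_const
  · exact analyticAt_pi_iff.mpr fun k =>
      ((analyticAt_det _).comp_of_eq (analyticAt_matG x k) rfl).sub analyticAt_const
  · exact analyticAt_pi_iff.mpr fun k => Finset.analyticAt_fun_sum _ fun i _ =>
      analyticAt_pi_iff.mp (analyticAt_eig x k) i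
  · exact analyticAt_pi_iff.mpr fun i => analyticAt_pi_iff.mpr fun j =>
      analyticAt_entry (analyticAt_moment hx) i j

theorem fderiv_sliceEq {x : Ambient N n} (hx : ∀ k, (matG x k).det = 1) (V : Ambient N n) :
    fderiv ℂ sliceEq x V = dSliceEq x V := by
  have hx' : ∀ k, (matG x k).det ≠ 0 := fun k => by rw [hx k]; exact one_ne_zero
  refine fderiv_apply_of_hasDerivAt (analyticAt_sliceEq hx').differentiableAt
    (by simp : x + (0 : ℂ) • V = x) (hasDerivAt_line x V) ?_
  have hG := fun k => hasDerivAt_matG (hasDerivAt_line x V) k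
  have hL := fun k => hasDerivAt_eig (hasDerivAt_line x V) k
  refine HasDerivAt.prodMk ?_ (HasDerivAt.prodMk ?_ (HasDerivAt.prodMk ?_ ?_))
  · exact hasDerivAt_pi.mpr fun i => hasDerivAt_pi.mpr fun j =>
      (hasDerivAt_matrix_iff.mp (hG 0) i j).sub_const _
  · refine hasDerivAt_pi.mpr fun k => ?_
    have := (hasDerivAt_det (by simpa using hx' k) (hG k)).sub_const 1
    simp only [zero_smul, add_zero, hx, one_mul] at this
    exact this
  · exact hasDerivAt_pi.mpr fun k => HasDerivAt.fun_sum fun i _ => hasDerivAt_pi.mp (hL k) i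
  · refine hasDerivAt_pi.mpr fun i => hasDerivAt_pi.mpr fun j => ?_
    have := hasDerivAt_matrix_iff.mp (hasDerivAt_moment (hasDerivAt_line x V)
      (by simpa using hx')) i j
    simp only [zero_smul, add_zero] at this
    exact this

end Calculus

theorem sum_eq_apply_zero {a : Fin N → ℂ} (h : ∀ k, k ≠ 0 → a k = 0) : ∑ k, a k = a 0 :=
  Finset.sum_eq_single 0 (fun k _ hk => h k hk) (by simp)

/-- Among the non-resonant points, the slice equations cut out the points of the zero level set with
`G_0 = 1`. The omitted equation `tr L_0 = 0` follows from `tr m = ∑ tr L_k`. -/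
theorem sliceEq_eq_zero_iff {x : Ambient N n} (hx : NonResonant x) :
    sliceEq x = 0 ↔ matG x 0 = 1 ∧ x ∈ phaseSpace N n ∧ moment x = 0 := by
  constructor
  · intro h
    have h1 : matG x 0 = 1 := by
      ext i j
      exact sub_eq_zero.mp (congrFun (congrFun (congrArg Prod.fst h) i) j)
    have h2 : ∀ k, (matG x k).det = 1 := by
      intro k
      by_cases hk : k = 0
      · rw [hk, h1, Matrix.det_one]
      · exact sub_eq_zero.mp (congrFun (congrArg (fun y => y.2.1) h) ⟨k, hk⟩)
    have h4 : moment x = 0 := by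
      ext i j
      exact congrFun (congrFun (congrArg (fun y => y.2.2.2) h) i) j
    have h3 : ∀ k, k ≠ 0 → ∑ i, eig x k i = 0 := fun k hk =>
      congrFun (congrArg (fun y => y.2.2.1) h) ⟨k, hk⟩
    have h5 := trace_moment (x := x) fun k => by rw [h2 k]; exact one_ne_zero
    rw [h4, Matrix.trace_zero, sum_eq_apply_zero h3] at h5
    refine ⟨h1, fun k => ⟨h2 k, ?_, eig_injective hx k⟩, h4⟩
    by_cases hk : k = 0
    · rw [hk, ← h5]
    · exact h3 k hk
  · rintro ⟨h1, h2, h3⟩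
    refine Prod.ext ?_ (Prod.ext ?_ (Prod.ext ?_ ?_))
    · funext i j
      simp [sliceEq, h1]
    · funext k
      simp [sliceEq, (h2 k).1]
    · funext k
      exact (h2 k).2.1
    · funext i j
      simp [sliceEq, h3]

theorem dSliceEq_eq_zero_iff {x : Ambient N n} (hx : ∀ k, (matG x k).det = 1) (V : Ambient N n) :
    dSliceEq x V = 0 ↔ matG V 0 = 0 ∧ PhaseTangent x V ∧ dMoment x V = 0 := by
  constructor
  · intro h
    have h1 : matG V 0 = 0 := by
      ext i j
      exact congrFun (congrFun (congrArg Prod.fst h) i) j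
    have h4 : dMoment x V = 0 := by
      ext i j
      exact congrFun (congrFun (congrArg (fun y => y.2.2.2) h) i) j
    have h3 : ∀ k, k ≠ 0 → ∑ i, eig V k i = 0 := fun k hk =>
      congrFun (congrArg (fun y => y.2.2.1) h) ⟨k, hk⟩
    have h5 := trace_dMoment (x := x) (fun k => by rw [hx k]; exact one_ne_zero) V
    rw [h4, Matrix.trace_zero, sum_eq_apply_zero h3] at h5
    refine ⟨h1, fun k => ?_, h4⟩
    by_cases hk : k = 0
    · rw [hk, ← h5, h1, mul_zero, Matrix.trace_zero]
      exact ⟨rfl, rfl⟩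
    · exact ⟨congrFun (congrArg (fun y => y.2.1) h) ⟨k, hk⟩, h3 k hk⟩
  · rintro ⟨h1, h2, h3⟩
    refine Prod.ext ?_ (Prod.ext ?_ (Prod.ext ?_ ?_))
    · funext i j
      simp [dSliceEq, h1]
    · funext k
      exact (h2 k).1
    · funext k
      exact (h2 k).2
    · funext i j
      simp [dSliceEq, h3]

/-- The slice equations are independent at the points of the slice. Varying one pair `(G_k, L_k)`
with `k ≠ 0` already accounts for the trace free part of the moment map; without such `k`, the
matrices have size one. -/
theorem dSliceEq_surjective (hn : 1 ≤ n) {x : Ambient N n} (hr : NonResonant x)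
    (hx : sliceEq x = 0) : Function.Surjective (dSliceEq x) := by
  obtain ⟨h1, h2, h3⟩ := (sliceEq_eq_zero_iff hr).mp hx
  have hdet : ∀ k, (matG x k).det = 1 := fun k => (h2 k).1
  have hu : ∀ k, IsUnit (matG x k).det := fun k => by rw [hdet k]; exact isUnit_one
  have hn0 : (n : ℂ) ≠ 0 := by exact_mod_cast (by omega : n ≠ 0)
  -- a tangent vector with vanishing first three components and prescribed moment
  have key : ∀ R : Matrix (Fin n) (Fin n) ℂ, ∃ V : Ambient N n, matG V 0 = 0 ∧
      (∀ k, k ≠ 0 → ((matG x k)⁻¹ * matG V k).trace = 0 ∧ ∑ i, eig V k i = 0) ∧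
      dMoment x V = R := by
    intro R
    obtain ⟨c, hc⟩ : ∃ c : ℂ, (R - c • (1 : Matrix (Fin n) (Fin n) ℂ)).trace = 0 :=
      ⟨R.trace / n, by
        rw [Matrix.trace_sub, Matrix.trace_smul, Matrix.trace_one, Fintype.card_fin, smul_eq_mul,
          div_mul_cancel₀ _ hn0, sub_self]⟩
    by_cases hk : ∃ k₁ : Fin N, k₁ ≠ 0
    · obtain ⟨k₁, hk₁⟩ := hk
      obtain ⟨g, hg, hgQ⟩ := exists_commutator_add_diagonal (h2 k₁).2.2
        ((matG x k₁)⁻¹ * (R - c • (1 : Matrix (Fin n) (Fin n) ℂ)) * matG x k₁)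
      set Q := (matG x k₁)⁻¹ * (R - c • (1 : Matrix (Fin n) (Fin n) ℂ)) * matG x k₁ with hQ
      have hQt : ∑ i, Q i i = 0 := by
        have : Q.trace = 0 := by
          rw [hQ, Matrix.trace_mul_comm, Matrix.mul_nonsing_inv_cancel_left _ _ (hu k₁), hc]
        exact this
      refine ⟨mkAmbient (fun k => matG x k * (if k = k₁ then g else 0))
        (fun k => if k = k₁ then fun i => Q i i else if k = 0 then fun _ => c else 0), ?_, ?_, ?_⟩
      · simp [hk₁.symm]
      · intro k hk
        rw [matG_mkAmbient, eig_mkAmbient, Matrix.nonsing_inv_mul_cancel_left _ _ (hu k)]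
        by_cases hkk : k = k₁
        · simp [hkk, hg, hQt]
        · simp [hkk, hk]
      · rw [dMoment_mkAmbient hdet, Finset.sum_eq_add (0 : Fin N) k₁ hk₁.symm]
        · rw [if_neg hk₁.symm, if_neg hk₁.symm, if_pos rfl, if_pos rfl, if_pos rfl, matL, matL, hgQ,
            h1, inv_one]
          have e1 : Matrix.diagonal (fun _ : Fin n => c) = c • (1 : Matrix (Fin n) (Fin n) ℂ) := by
            rw [Matrix.smul_one_eq_diagonal]
          have e2 : matG x k₁ * Q * (matG x k₁)⁻¹ = R - c • (1 : Matrix (Fin n) (Fin n) ℂ) := by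
            rw [hQ, ← Matrix.mul_assoc, Matrix.mul_nonsing_inv_cancel_left _ _ (hu k₁),
              Matrix.mul_assoc, Matrix.mul_nonsing_inv _ (hu k₁), mul_one]
          rw [e2, e1]
          simp
        · rintro k - ⟨hk, hk'⟩
          simp [hk, hk']
        · simp
        · simp
    · push Not at hk
      -- with a single index, `L_0 = m = 0` has distinct entries only in size one
      have hL : matL x 0 = 0 := by
        have : moment x = matL x 0 := by
          rw [moment, Finset.sum_eq_single 0 (fun k _ hk' => absurd (hk k) hk') (by simp), h1]
          simp
        rw [← this, h3]
      have hsub : ∀ i j : Fin n, i = j := fun i j => (h2 0).2.2 (by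
        have e : ∀ i, eig x 0 i = 0 := fun i => by
          have := congrFun (congrFun hL i) i
          simpa [matL] using this
        rw [e, e])
      refine ⟨mkAmbient (fun k => matG x k * 0) (fun _ _ => c), by simp,
        fun k hk' => absurd (hk k) hk', ?_⟩
      rw [dMoment_mkAmbient hdet, Finset.sum_eq_single 0 (fun k _ hk' => absurd (hk k) hk') (by simp),
        h1]
      have e0 : R - c • (1 : Matrix (Fin n) (Fin n) ℂ) = 0 := by
        ext i j
        obtain rfl := hsub i j
        rw [Matrix.trace, Fintype.sum_eq_single i (fun j hj => absurd (hsub j i) hj)] at hc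
        exact hc
      rw [sub_eq_zero.mp e0, Matrix.smul_one_eq_diagonal]
      simp
  -- `V₀` realises the first three components, and a vector from `key` corrects the last one
  rintro ⟨A, δ, τ, R⟩
  let V₀ : Ambient N n := mkAmbient
    (fun k => matG x k * (if h : k = 0 then Matrix.of A else (δ ⟨k, h⟩ / n) • 1))
    (fun k => if h : k = 0 then 0 else fun _ => τ ⟨k, h⟩ / n)
  obtain ⟨V, hV1, hV2, hV3⟩ := key (Matrix.of R - dMoment x V₀)
  refine ⟨V₀ + V, Prod.ext ?_ (Prod.ext ?_ (Prod.ext ?_ ?_))⟩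
  · funext i j
    simp [dSliceEq, hV1, V₀, h1]
  · funext k
    obtain ⟨k, hk⟩ := k
    simp only [dSliceEq, matG_add, mul_add, Matrix.trace_add, (hV2 k hk).1, add_zero, V₀,
      matG_mkAmbient, Matrix.nonsing_inv_mul_cancel_left _ _ (hu k), dif_neg hk, Matrix.trace_smul,
      Matrix.trace_one, Fintype.card_fin, smul_eq_mul]
    field_simp
  · funext k
    obtain ⟨k, hk⟩ := k
    simp only [dSliceEq, eig_add, Pi.add_apply, Finset.sum_add_distrib, (hV2 k hk).2, add_zero, V₀,
      eig_mkAmbient, dif_neg hk, Finset.sum_const, Finset.card_univ, Fintype.card_fin, nsmul_eq_mul]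
    field_simp
  · funext i j
    simp [dSliceEq, dMoment_add, hV3]

end Slice

/-! ### The reduced space as the slice -/

section Gauge

theorem isOpen_nonResonant : IsOpen {x : Ambient N n | NonResonant x} := by
  have h : {x : Ambient N n | NonResonant x} = ⋂ k : Fin N, ⋂ i : Fin n, ⋂ j : Fin n,
      ⋂ _ : i ≠ j, {x : Ambient N n | eig x k i - eig x k j ∈ (Set.range ((↑) : ℤ → ℂ))ᶜ} := by
    ext x
    simp [NonResonant, eq_comm]
  rw [h]
  refine isOpen_iInter_of_finite fun k => isOpen_iInter_of_finite fun i =>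
    isOpen_iInter_of_finite fun j => isOpen_iInter_of_finite fun _ => ?_
  have h1 : ∀ i, Continuous fun x : Ambient N n => eig x k i := fun i =>
    (continuous_apply i).comp (continuous_snd.comp (continuous_apply k))
  exact Complex.isClosed_range_intCast.isOpen_compl.preimage ((h1 i).sub (h1 j))

/-- The left multiplication action on the zero level set. -/
def levelMul (S : Matrix.SpecialLinearGroup (Fin n) ℂ) (z : ZeroLevel N n) : ZeroLevel N n :=
  ⟨leftMul (S : Matrix (Fin n) (Fin n) ℂ) z, leftMul_mem_phaseSpace z.2.1 S, z.2.2.1, by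
    rw [moment_leftMul, z.2.2.2, mul_zero, zero_mul]⟩

theorem proj_levelMul (S : Matrix.SpecialLinearGroup (Fin n) ℂ) (z : ZeroLevel N n) :
    proj (levelMul S z) = proj z :=
  (Quotient.sound (s := orbitSetoid N n) ⟨S, rfl⟩ : proj z = proj (levelMul S z)).symm

theorem continuous_proj : Continuous (proj : ZeroLevel N n → Reduced N n) := continuous_quot_mk

/-- Left multiplication as a continuous linear map. -/
def leftMulCLM (S : Matrix (Fin n) (Fin n) ℂ) : Ambient N n →L[ℂ] Ambient N n :=
  LinearMap.toContinuousLinearMap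
    { toFun := leftMul S
      map_add' := fun x y => ambient_ext (fun k => by simp [mul_add]) (fun k => by simp)
      map_smul' := fun c x => ambient_ext (fun k => by simp) (fun k => by simp) }

variable [NeZero N]

/-- The point of the orbit with `G_0 = 1` (where `G_0` is invertible). -/
def gauge (x : Ambient N n) : Ambient N n := leftMul (matG x 0)⁻¹ x

theorem gauge_leftMul {S : Matrix (Fin n) (Fin n) ℂ} (hS : S.det ≠ 0) (x : Ambient N n) :
    gauge (leftMul S x) = gauge x := by
  rw [gauge, gauge, leftMul_leftMul, matG_leftMul, Matrix.mul_inv_rev, Matrix.mul_assoc,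
    Matrix.nonsing_inv_mul _ (isUnit_iff_ne_zero.mpr hS), mul_one]

/-- The matrix `G_0` of a point of the zero level set. -/
def frame (z : ZeroLevel N n) : Matrix.SpecialLinearGroup (Fin n) ℂ :=
  ⟨matG (z : Ambient N n) 0, (z.2.1 0).1⟩

/-- The matrix `G_0⁻¹` of a point of the zero level set. -/
def frameInv (z : ZeroLevel N n) : Matrix.SpecialLinearGroup (Fin n) ℂ :=
  ⟨(matG (z : Ambient N n) 0)⁻¹, by rw [Matrix.det_nonsing_inv, (z.2.1 0).1, Ring.inverse_one]⟩

section Calculus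

attribute [local instance] Matrix.linftyOpNormedRing Matrix.linftyOpNormedAlgebra

theorem analyticAt_gauge {x : Ambient N n} (hx : (matG x 0).det ≠ 0) :
    AnalyticAt ℂ (gauge : Ambient N n → _) x :=
  analyticAt_ambient (fun k => ((analyticAt_matrix_inv hx).comp_of_eq (analyticAt_matG x 0) rfl).mul
    (analyticAt_matG x k)) (fun k => analyticAt_eig x k)

/-- The derivative of `gauge` along a curve differs from the left translate of the velocity by an
infinitesimal action. -/
theorem hasDerivAt_gauge {γ : ℂ → Ambient N n} {V : Ambient N n} {t : ℂ}
    (hγ : HasDerivAt γ V t) (hx : (matG (γ t) 0).det ≠ 0) :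
    HasDerivAt (fun s => gauge (γ s))
      (leftMul (matG (γ t) 0)⁻¹ (V - infAction (matG V 0 * (matG (γ t) 0)⁻¹) (γ t))) t := by
  have h := hasDerivAt_leftMul (hasDerivAt_matrix_inv hx (hasDerivAt_matG hγ 0)) hγ
  have e : mkAmbient (fun k => -((matG (γ t) 0)⁻¹ * matG V 0 * (matG (γ t) 0)⁻¹) * matG (γ t) k
      + (matG (γ t) 0)⁻¹ * matG V k) (eig V)
      = leftMul (matG (γ t) 0)⁻¹ (V - infAction (matG V 0 * (matG (γ t) 0)⁻¹) (γ t)) := by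
    refine ambient_ext (fun k => ?_) (fun k => ?_)
    · simp only [matG_mkAmbient, matG_leftMul, matG_sub, matG_infAction, mul_sub, neg_mul,
        Matrix.mul_assoc]
      abel
    · simp
  rw [← e]
  exact h

end Calculus

/-- The representative with `G_0 = 1` of a point of the reduced space. -/
def slicePoint : Reduced N n → ZeroLevel N n :=
  Quotient.lift (fun z : ZeroLevel N n => levelMul (frameInv z) z) (by
    rintro z w ⟨S, hS⟩
    refine Subtype.ext ?_
    show gauge (z : Ambient N n) = gauge (w : Ambient N n)
    rw [hS, gauge_leftMul (by rw [S.det_coe]; exact one_ne_zero)])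

theorem proj_slicePoint (p : Reduced N n) : proj (slicePoint p) = p := by
  obtain ⟨z, rfl⟩ := Quotient.exists_rep p
  exact proj_levelMul _ z

/-- The inclusion of the reduced space into the ambient space as the slice. -/
def sliceIncl (p : Reduced N n) : Ambient N n := slicePoint p

theorem sliceIncl_proj (z : ZeroLevel N n) : sliceIncl (proj z) = gauge (z : Ambient N n) := rfl

theorem matG_sliceIncl (p : Reduced N n) : matG (sliceIncl p) 0 = 1 := by
  obtain ⟨z, rfl⟩ := Quotient.exists_rep p
  show (matG (z : Ambient N n) 0)⁻¹ * matG (z : Ambient N n) 0 = 1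
  exact Matrix.nonsing_inv_mul _ (isUnit_iff_ne_zero.mpr (det_ne_zero_of_mem z.2.1 0))

theorem det_sliceIncl (p : Reduced N n) (k : Fin N) : (matG (sliceIncl p) k).det = 1 :=
  ((slicePoint p).2.1 k).1

theorem det_sliceIncl_ne_zero (p : Reduced N n) (k : Fin N) : (matG (sliceIncl p) k).det ≠ 0 :=
  det_ne_zero_of_mem (slicePoint p).2.1 k

theorem gauge_eq_self {x : Ambient N n} (hx : matG x 0 = 1) : gauge x = x := by
  rw [gauge, hx, inv_one, leftMul_one]

theorem continuous_slicePoint : Continuous (slicePoint : Reduced N n → ZeroLevel N n) := by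
  refine continuous_quot_lift _ ?_
  refine Continuous.subtype_mk (f := fun z : ZeroLevel N n => gauge (z : Ambient N n)) ?_ _
  exact continuous_iff_continuousAt.mpr fun z => ContinuousAt.comp (g := gauge)
    (analyticAt_gauge (det_ne_zero_of_mem z.2.1 0)).continuousAt continuous_subtype_val.continuousAt

/-- The slice is a continuous section of the projection, hence an embedding. -/
theorem isEmbedding_sliceIncl :
    Topology.IsEmbedding (sliceIncl : Reduced N n → Ambient N n) :=
  Topology.IsEmbedding.subtypeVal.comp
    (Function.LeftInverse.isEmbedding proj_slicePoint continuous_proj continuous_slicePoint)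

theorem sliceEq_sliceIncl (p : Reduced N n) : sliceEq (sliceIncl p) = 0 :=
  (sliceEq_eq_zero_iff (slicePoint p).2.2.1).mpr
    ⟨matG_sliceIncl p, (slicePoint p).2.1, (slicePoint p).2.2.2⟩

theorem mem_range_sliceIncl {x : Ambient N n} (hx : NonResonant x) :
    x ∈ Set.range sliceIncl ↔ sliceEq x = 0 := by
  constructor
  · rintro ⟨p, rfl⟩
    exact sliceEq_sliceIncl p
  · intro h
    obtain ⟨h1, h2, h3⟩ := (sliceEq_eq_zero_iff hx).mp h
    exact ⟨proj ⟨x, h2, hx, h3⟩, gauge_eq_self h1⟩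

theorem fderiv_sliceEq_surjective (hn : 1 ≤ n) (p : Reduced N n) :
    Function.Surjective (fderiv ℂ sliceEq (sliceIncl p)) := by
  have h : ⇑(fderiv ℂ sliceEq (sliceIncl p)) = dSliceEq (sliceIncl p) :=
    funext (fderiv_sliceEq (det_sliceIncl p))
  rw [h]
  exact dSliceEq_surjective hn (slicePoint p).2.2.1 (sliceEq_sliceIncl p)

/-- The dimension of the reduced space. If the latter is empty, the slice equations need not be
independent, and the value has no meaning. -/
def reducedDim (N n : ℕ) [NeZero N] : ℕ :=
  Module.finrank ℂ (Ambient N n) - Module.finrank ℂ (SliceTarget N n)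

theorem finrank_ambient (hn : 1 ≤ n) (p : Reduced N n) :
    Module.finrank ℂ (Ambient N n) = reducedDim N n + Module.finrank ℂ (SliceTarget N n) := by
  have h := LinearMap.finrank_le_finrank_of_surjective (f :=
    (fderiv ℂ sliceEq (sliceIncl p) : Ambient N n →ₗ[ℂ] SliceTarget N n))
    (fderiv_sliceEq_surjective hn p)
  rw [reducedDim]
  omega

theorem exists_sliceChart (hn : 1 ≤ n) (p : Reduced N n) :
    ∃ e : OpenPartialHomeomorph (Reduced N n) (Fin (reducedDim N n) → ℂ),
      p ∈ e.source ∧ IsAnalyticChart sliceIncl e :=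
  exists_analyticChart isEmbedding_sliceIncl (analyticAt_sliceEq (det_sliceIncl_ne_zero p))
    (fderiv_sliceEq_surjective hn p) (finrank_ambient hn p) isOpen_nonResonant
    (slicePoint p).2.2.1 fun _ hx => mem_range_sliceIncl hx

end Gauge

/-! ### Reduction of tangent vectors -/

section Reduction

/-- `omegaHat` is bilinear, being the value of a differential form. -/
theorem omegaHat_eq_flat {x : Ambient N n} (hx : ∀ k, (matG x k).det ≠ 0) (V W : Ambient N n) :
    omegaHat x ![V, W] = flat (extDeriv thetaForm x) V W := (extDeriv_thetaForm hx _).symm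

theorem dMoment_leftMul {S : Matrix (Fin n) (Fin n) ℂ} (hS : S.det ≠ 0) (x V : Ambient N n) :
    dMoment (leftMul S x) (leftMul S V) = S * dMoment x V * S⁻¹ := by
  have h := body_leftMul hS x V
  simp only [dMoment, Matrix.mul_sum, Matrix.sum_mul]
  refine Finset.sum_congr rfl fun k _ => ?_
  rw [h k]
  simp only [matG_leftMul, matL_leftMul, Matrix.mul_inv_rev, mul_add, mul_sub, add_mul, sub_mul,
    Matrix.mul_assoc]

theorem PhaseTangent.leftMul {S : Matrix (Fin n) (Fin n) ℂ} (hS : S.det ≠ 0) {x V : Ambient N n}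
    (h : PhaseTangent x V) : PhaseTangent (leftMul S x) (leftMul S V) := by
  intro k
  rw [body_leftMul hS, eig_leftMul]
  exact h k

theorem PhaseTangent.sub {x V W : Ambient N n} (hV : PhaseTangent x V) (hW : PhaseTangent x W) :
    PhaseTangent x (V - W) := by
  intro k
  simp [mul_sub, hV k, hW k]

/-- On the zero level set the infinitesimal action lies in the kernel of `thetaHat`. -/
theorem thetaHat_sub_infAction {x : Ambient N n} (hm : moment x = 0) (V : Fin 1 → Ambient N n)
    (X : Fin 1 → Matrix (Fin n) (Fin n) ℂ) :
    thetaHat x (fun i => V i - infAction (X i) x) = thetaHat x V := by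
  have h : thetaCLM x (infAction (X 0) x) = 0 := by
    rw [thetaCLM_apply, thetaHat_infAction, hm, mul_zero, Matrix.trace_zero]
  rw [← thetaForm_apply, ← thetaForm_apply]
  show thetaCLM x (V 0 - infAction (X 0) x) = thetaCLM x (V 0)
  rw [map_sub, h, sub_zero]

/-- The tangent spaces of the orbits in the zero level set lie in the kernel of the restriction of
`omegaHat` to that set. -/
theorem omegaHat_sub_infAction {x : Ambient N n} (hx : ∀ k, (matG x k).det ≠ 0)
    (hm : moment x = 0) {V : Fin 2 → Ambient N n} (hV : ∀ i, dMoment x (V i) = 0)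
    (X : Fin 2 → Matrix (Fin n) (Fin n) ℂ) :
    omegaHat x (fun i => V i - infAction (X i) x) = omegaHat x V := by
  have h : ∀ Y U, dMoment x U = 0 → flat (extDeriv thetaForm x) (infAction Y x) U = 0 := by
    intro Y U hU
    rw [← omegaHat_eq_flat hx, omegaHat_infAction Y hx, hU, mul_zero, Matrix.trace_zero, neg_zero]
  have h' : ∀ Y, dMoment x (infAction Y x) = 0 := by
    intro Y
    rw [dMoment_infAction Y hx, hm, mul_zero, zero_mul, sub_zero]
  have e : ∀ U : Fin 2 → Ambient N n,
      omegaHat x U = flat (extDeriv thetaForm x) (U 0) (U 1) := by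
    intro U
    rw [← omegaHat_eq_flat hx]
    congr 1
    funext j
    fin_cases j <;> rfl
  rw [e, e, map_sub, map_sub, sub_apply, sub_apply, h _ _ (hV 1), h _ _ (h' _), 
    flat_swap _ (V 0) (infAction (X 1) x), h _ _ (hV 0)]
  ring

/-- The Hamiltonian vector of a covector that vanishes on the orbit is tangent to the level set of
the moment map. -/
theorem dMoment_sharp_eq_zero (hn : 1 ≤ n) {x : Ambient N n} (hx : x ∈ phaseSpace N n)
    {α : Ambient N n →L[ℂ] ℂ}
    (hα : ∀ X : Matrix (Fin n) (Fin n) ℂ, X.trace = 0 → α (infAction X x) = 0) :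
    dMoment x (sharp x α) = 0 := by
  have hd := det_ne_zero_of_mem hx
  have htr : (dMoment x (sharp x α)).trace = 0 := by
    rw [trace_dMoment hd]
    exact Finset.sum_eq_zero fun k _ => (phaseTangent_sharp hn hd α k).2
  have h0 : ∀ X : Matrix (Fin n) (Fin n) ℂ, X.trace = 0 →
      (X * dMoment x (sharp x α)).trace = 0 := by
    intro X hX
    rw [← fderiv_trace_mul_moment hd, ← bivector_eq_sharp, bivector_neg_symm, bivector_eq_sharp,
      sharp_fderiv_moment hn hx hX, hα X hX, neg_zero]
  -- the trace pairing is non-degenerate, and scalar matrices pair to zero by `htr`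
  refine Matrix.ext_iff_trace_mul_left.mpr fun X => ?_
  have hn' : (n : ℂ) ≠ 0 := Nat.cast_ne_zero.mpr (by omega)
  have h1 := h0 (X - (X.trace / n) • 1) (by
    rw [Matrix.trace_sub, Matrix.trace_smul, Matrix.trace_one, Fintype.card_fin, smul_eq_mul,
      div_mul_cancel₀ _ hn', sub_self])
  rw [sub_mul, smul_mul_assoc, one_mul, Matrix.trace_sub, Matrix.trace_smul, htr, smul_zero,
    sub_zero] at h1
  rw [h1, mul_zero, Matrix.trace_zero]

theorem trace_mul_inv_eq_zero {x V : Ambient N n} (hV : PhaseTangent x V) (k : Fin N) :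
    (matG V k * (matG x k)⁻¹).trace = 0 := by
  rw [Matrix.trace_mul_comm]
  exact (hV k).1

section Calculus

attribute [local instance] Matrix.linftyOpNormedRing Matrix.linftyOpNormedAlgebra

/-- The velocities of maps into the zero level set are annihilated by `dMoment`. -/
theorem dMoment_fderiv_eq_zero {E : Type*} [NormedAddCommGroup E] [NormedSpace ℂ E]
    {φ : E → ZeroLevel N n} {u : E} (hφ : DifferentiableAt ℂ (fun w => (φ w : Ambient N n)) u)
    (v : E) :
    dMoment (φ u : Ambient N n) (fderiv ℂ (fun w => (φ w : Ambient N n)) u v) = 0 := by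
  have hγ : HasDerivAt (fun t : ℂ => (φ (u + t • v) : Ambient N n))
      (fderiv ℂ (fun w => (φ w : Ambient N n)) u v) 0 := hφ.hasFDerivAt.hasLineDerivAt v
  have h1 := hasDerivAt_moment hγ fun k => det_ne_zero_of_mem (φ _).2.1 k
  have h2 : (fun t : ℂ => moment (φ (u + t • v) : Ambient N n)) = fun _ => 0 :=
    funext fun t => (φ _).2.2.2
  rw [h2] at h1
  have h3 := h1.unique (hasDerivAt_const (0 : ℂ) (0 : Matrix (Fin n) (Fin n) ℂ))
  simpa using h3

end Calculus

variable [NeZero N]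

theorem fderiv_gauge {x : Ambient N n} (hx : (matG x 0).det ≠ 0) (V : Ambient N n) :
    fderiv ℂ gauge x V
      = leftMul (matG x 0)⁻¹ (V - infAction (matG V 0 * (matG x 0)⁻¹) x) := by
  have h0 : x + (0 : ℂ) • V = x := by simp
  have h := hasDerivAt_gauge (hasDerivAt_line x V) (by rwa [h0])
  rw [h0] at h
  exact fderiv_apply_of_hasDerivAt (analyticAt_gauge hx).differentiableAt h0
    (hasDerivAt_line x V) h

/-- A linear functional of `gauge` is an invariant function. -/
theorem isInvariantHolomorphic_gauge (l : Ambient N n →L[ℂ] ℂ) :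
    IsInvariantHolomorphic {x : Ambient N n | (matG x 0).det ≠ 0} fun x => l (gauge x) := by
  refine ⟨fun x hx => (l.analyticAt _).comp (analyticAt_gauge hx), fun x _ S _ _ => ?_⟩
  show l (gauge _) = l (gauge _)
  rw [gauge_leftMul (by rw [S.det_coe]; exact one_ne_zero)]

variable {d : ℕ} [ChartedSpace (Fin d → ℂ) (Reduced N n)]

/-- The differential of the inclusion of the reduced space as the slice. -/
def sliceDeriv (d : ℕ) [ChartedSpace (Fin d → ℂ) (Reduced N n)] (p : Reduced N n) :
    (Fin d → ℂ) →L[ℂ] Ambient N n := inclusionDeriv d sliceIncl p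

theorem leftMul_sliceIncl_proj (x : ZeroLevel N n) :
    leftMul (matG (x : Ambient N n) 0) (sliceIncl (proj x)) = x := by
  rw [sliceIncl_proj, gauge, leftMul_leftMul, Matrix.mul_nonsing_inv _
    (isUnit_iff_ne_zero.mpr (det_ne_zero_of_mem x.2.1 0)), leftMul_one]

/-- The one-form on the reduced space: the restriction of `thetaHat` to the slice. -/
def reducedTheta (d : ℕ) (N n : ℕ) [NeZero N] [ChartedSpace (Fin d → ℂ) (Reduced N n)] :
    FormField d (Reduced N n) 1 := pullbackForm sliceIncl thetaForm

/-- The two-form on the reduced space: the restriction to the slice of the exterior derivative of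
`thetaHat`. -/
def reducedOmega (d : ℕ) (N n : ℕ) [NeZero N] [ChartedSpace (Fin d → ℂ) (Reduced N n)] :
    FormField d (Reduced N n) 2 := pullbackForm sliceIncl (extDeriv thetaForm)

/-- The value of the reduced two-form, computed at an arbitrary point of the orbit. -/
theorem flat_reducedOmega (x : ZeroLevel N n) (v w : Fin d → ℂ) :
    flat (V := Fin d → ℂ) (reducedOmega d N n (proj x)) v w
      = omegaHat (x : Ambient N n)
          ![leftMul (matG (x : Ambient N n) 0) (sliceDeriv d (proj x) v),
            leftMul (matG (x : Ambient N n) 0) (sliceDeriv d (proj x) w)] := by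
  have h1 : flat (V := Fin d → ℂ) (reducedOmega d N n (proj x)) v w
      = extDeriv thetaForm (sliceIncl (proj x))
          (fun j => sliceDeriv d (proj x) ((![v, w] : Fin 2 → Fin d → ℂ) j)) := rfl
  rw [h1, extDeriv_thetaForm (det_sliceIncl_ne_zero _),
    ← omegaHat_leftMul (det_ne_zero_of_mem x.2.1 0), leftMul_sliceIncl_proj]
  congr 1
  funext j
  fin_cases j <;> rfl

variable [IsManifold 𝓘(ℂ, Fin d → ℂ) ω (Reduced N n)]

/-- The tangent vectors of the slice. -/
theorem exists_sliceDeriv_eq_iff (hn : 1 ≤ n) (hd : d = reducedDim N n)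
    (hA : ∀ e ∈ atlas (Fin d → ℂ) (Reduced N n), IsAnalyticChart sliceIncl e)
    (p : Reduced N n) (V : Ambient N n) : (∃ v, sliceDeriv d p v = V) ↔
      matG V 0 = 0 ∧ PhaseTangent (sliceIncl p) V ∧ dMoment (sliceIncl p) V = 0 := by
  obtain ⟨h1, h2⟩ := exists_inclusionDeriv_eq hA (p := p)
    (analyticAt_sliceEq (det_sliceIncl_ne_zero p)).differentiableAt
    (fderiv_sliceEq_surjective hn p) (by rw [hd]; exact finrank_ambient hn p) sliceEq_sliceIncl
  rw [← dSliceEq_eq_zero_iff (det_sliceIncl p), ← fderiv_sliceEq (det_sliceIncl p)]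
  exact ⟨by rintro ⟨v, rfl⟩; exact h1 v, h2 V⟩

/-- A tangent vector of the zero level set is the sum of a translate of a tangent vector of the
slice and of a tangent vector of the orbit. -/
theorem exists_sliceDeriv_add_infAction (hn : 1 ≤ n) (hd : d = reducedDim N n)
    (hA : ∀ e ∈ atlas (Fin d → ℂ) (Reduced N n), IsAnalyticChart sliceIncl e)
    (x : ZeroLevel N n) {V : Ambient N n} (hV : PhaseTangent (x : Ambient N n) V)
    (hV' : dMoment (x : Ambient N n) V = 0) :
    ∃ (v : Fin d → ℂ) (Y : Matrix (Fin n) (Fin n) ℂ), Y.trace = 0 ∧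
      V = leftMul (matG (x : Ambient N n) 0) (sliceDeriv d (proj x) v)
        + infAction Y (x : Ambient N n) := by
  have hdet := det_ne_zero_of_mem x.2.1
  have hu := isUnit_iff_ne_zero.mpr (hdet 0)
  obtain ⟨G, hG⟩ : ∃ G, G = matG (x : Ambient N n) 0 := ⟨_, rfl⟩
  -- the action of `Y` accounts for the component of `V` along `G_0`
  obtain ⟨Y, hY⟩ : ∃ Y, Y = matG V 0 * G⁻¹ := ⟨_, rfl⟩
  rw [← hG] at hu ⊢
  have hYt : Y.trace = 0 := by
    rw [hY, hG]
    exact trace_mul_inv_eq_zero hV 0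
  have hS : G⁻¹.det ≠ 0 := by
    rw [hG]
    exact det_inv_ne_zero_of_mem x.2.1 0
  have hT : PhaseTangent (x : Ambient N n) (V - infAction Y x) :=
    hV.sub (phaseTangent_infAction hYt hdet)
  have hM : dMoment (x : Ambient N n) (V - infAction Y x) = 0 := by
    have h1 := dMoment_add (x : Ambient N n) (V - infAction Y x) (infAction Y x)
    rw [sub_add_cancel, hV', dMoment_infAction Y hdet, x.2.2.2, mul_zero, zero_mul, sub_zero,
      add_zero] at h1
    exact h1.symm
  have hU : matG (leftMul G⁻¹ (V - infAction Y (x : Ambient N n))) 0 = 0 := by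
    rw [matG_leftMul, matG_sub, matG_infAction, ← hG, hY, Matrix.mul_assoc,
      Matrix.nonsing_inv_mul _ hu, mul_one, sub_self, mul_zero]
  have hx : sliceIncl (proj x) = leftMul G⁻¹ (x : Ambient N n) := by
    rw [sliceIncl_proj, gauge, hG]
  have hex := (exists_sliceDeriv_eq_iff hn hd hA (proj x)
    (leftMul G⁻¹ (V - infAction Y (x : Ambient N n)))).mpr
    ⟨hU, by rw [hx]; exact hT.leftMul hS, by
      rw [hx, dMoment_leftMul hS, hM, mul_zero, zero_mul]⟩
  obtain ⟨v, hv⟩ := hex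
  refine ⟨v, Y, hYt, ?_⟩
  rw [hv, leftMul_leftMul, Matrix.mul_nonsing_inv _ hu, leftMul_one, sub_add_cancel]

/-- The translates of the tangent vectors of the slice are tangent to the zero level set. -/
theorem phaseTangent_leftMul_sliceDeriv (hn : 1 ≤ n) (hd : d = reducedDim N n)
    (hA : ∀ e ∈ atlas (Fin d → ℂ) (Reduced N n), IsAnalyticChart sliceIncl e)
    (x : ZeroLevel N n) (v : Fin d → ℂ) :
    PhaseTangent (x : Ambient N n)
        (leftMul (matG (x : Ambient N n) 0) (sliceDeriv d (proj x) v)) ∧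
      dMoment (x : Ambient N n) (leftMul (matG (x : Ambient N n) 0) (sliceDeriv d (proj x) v))
        = 0 := by
  have hdet := det_ne_zero_of_mem x.2.1 0
  obtain ⟨-, h1, h2⟩ := (exists_sliceDeriv_eq_iff hn hd hA (proj x) _).mp ⟨v, rfl⟩
  have h3 := h1.leftMul hdet
  have h4 := dMoment_leftMul hdet (sliceIncl (proj x)) (sliceDeriv d (proj x) v)
  rw [leftMul_sliceIncl_proj] at h3 h4
  exact ⟨h3, by rw [h4, h2, mul_zero, zero_mul]⟩

/-! ### The reduced forms -/

theorem isHolomorphicForm_reducedTheta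
    (hA : ∀ e ∈ atlas (Fin d → ℂ) (Reduced N n), IsAnalyticChart sliceIncl e) :
    IsHolomorphicForm (reducedTheta d N n) :=
  isHolomorphicForm_pullbackForm_one hA fun p => analyticAt_thetaCLM (det_sliceIncl_ne_zero p)

theorem isExteriorDerivative_reducedTheta
    (hA : ∀ e ∈ atlas (Fin d → ℂ) (Reduced N n), IsAnalyticChart sliceIncl e) :
    IsExteriorDerivative (reducedTheta d N n) (reducedOmega d N n) :=
  isExteriorDerivative_pullbackForm hA fun p =>
    (analyticAt_thetaForm (det_sliceIncl_ne_zero p)).differentiableAt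

/-- A criterion for the pullback of a form from the slice to the zero level set. The projection,
followed by the inclusion of the slice, is `gauge`, so that it suffices to compare the values on
vectors tangent to the level set and on their images under the derivative of `gauge`. -/
theorem pullsBackTo_pullbackForm {k : ℕ}
    (hA : ∀ e ∈ atlas (Fin d → ℂ) (Reduced N n), IsAnalyticChart sliceIncl e)
    {η : Ambient N n → Ambient N n [⋀^Fin k]→L[ℂ] ℂ}
    {ηhat : Ambient N n → (Fin k → Ambient N n) → ℂ}
    (hη : ∀ (z : ZeroLevel N n) (V : Fin k → Ambient N n),
      (∀ i, dMoment (z : Ambient N n) (V i) = 0) →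
      η (gauge (z : Ambient N n)) (fun i => leftMul (matG (z : Ambient N n) 0)⁻¹
        (V i - infAction (matG (V i) 0 * (matG (z : Ambient N n) 0)⁻¹) z)) = ηhat z V) :
    PullsBackTo (d := d) (pullbackForm sliceIncl η) ηhat := by
  intro m V hV φ hφ u hu v
  have hφu := hφ u hu
  have hdet := det_ne_zero_of_mem (φ u).2.1 0
  have hcont : ContinuousAt φ u :=
    Topology.IsInducing.subtypeVal.continuousAt_iff.mpr hφu.continuousAt
  have hg : MDifferentiableAt 𝓘(ℂ, Fin m → ℂ) 𝓘(ℂ, Fin d → ℂ) (fun u' => proj (φ u')) u :=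
    (contMDiffAt_of_comp_inclusion hA (continuous_proj.continuousAt.comp hcont)
      ((analyticAt_gauge hdet).comp_of_eq hφu rfl)).mdifferentiableAt (by simp)
  rw [← hη (φ u) _ fun i => ?_, pullbackForm_apply]
  · show η (gauge (φ u : Ambient N n)) _ = η (gauge (φ u : Ambient N n)) _
    congr 1
    funext i
    rw [inclusionDeriv_comp hA hg, ← fderiv_gauge hdet]
    have := fderiv_comp u (analyticAt_gauge hdet).differentiableAt hφu.differentiableAt
    exact congrArg (fun A : (Fin m → ℂ) →L[ℂ] Ambient N n => A (v i)) this
  · exact dMoment_fderiv_eq_zero hφu.differentiableAt (v i)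

theorem pullsBackTo_reducedTheta
    (hA : ∀ e ∈ atlas (Fin d → ℂ) (Reduced N n), IsAnalyticChart sliceIncl e) :
    PullsBackTo (reducedTheta d N n) thetaHat :=
  pullsBackTo_pullbackForm hA fun z V _ => by
    rw [thetaForm_apply, gauge, thetaHat_leftMul (det_inv_ne_zero_of_mem z.2.1 0),
      thetaHat_sub_infAction z.2.2.2]

theorem pullsBackTo_reducedOmega
    (hA : ∀ e ∈ atlas (Fin d → ℂ) (Reduced N n), IsAnalyticChart sliceIncl e) :
    PullsBackTo (reducedOmega d N n) omegaHat :=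
  pullsBackTo_pullbackForm hA fun z V hV => by
    have hS := det_inv_ne_zero_of_mem z.2.1 0
    rw [extDeriv_thetaForm fun k => ?_, gauge, omegaHat_leftMul hS,
      omegaHat_sub_infAction (det_ne_zero_of_mem z.2.1) z.2.2.2 hV]
    rw [gauge, matG_leftMul, Matrix.det_mul]
    exact mul_ne_zero hS (det_ne_zero_of_mem z.2.1 k)

/-! ### The reduced Poisson structure -/

/-- The differential of a function on the reduced space that is induced by an invariant function. -/
theorem dAt_of_invariant
    (hA : ∀ e ∈ atlas (Fin d → ℂ) (Reduced N n), IsAnalyticChart sliceIncl e)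
    {W : Set (Ambient N n)} (hW : IsOpen W) {F : Ambient N n → ℂ} (hF : AnalyticOnNhd ℂ F W)
    {f : Reduced N n → ℂ} (hf : ∀ z : ZeroLevel N n, (z : Ambient N n) ∈ W → f (proj z) = F z)
    {x : ZeroLevel N n} (hx : (x : Ambient N n) ∈ W) (v : Fin d → ℂ) :
    dAt f (proj x) v
      = fderiv ℂ F x (leftMul (matG (x : Ambient N n) 0) (sliceDeriv d (proj x) v)) := by
  have hx' := leftMul_sliceIncl_proj x
  set L := leftMulCLM (N := N) (matG (x : Ambient N n) 0) with hL
  have hLx : L (sliceIncl (proj x)) = x := hx'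
  have hFx : DifferentiableAt ℂ F (L (sliceIncl (proj x))) := by
    rw [hLx]; exact (hF x hx).differentiableAt
  have hcont : Continuous fun q : Reduced N n => L (sliceIncl q) :=
    L.continuous.comp isEmbedding_sliceIncl.continuous
  have h : ∀ᶠ q in 𝓝 (proj x), f q = F (L (sliceIncl q)) := by
    filter_upwards [hcont.continuousAt.eventually_mem (hW.mem_nhds (by rw [hLx]; exact hx))]
      with q hq
    have := hf (levelMul (frame x) (slicePoint q)) hq
    rw [proj_levelMul, proj_slicePoint] at this
    exact this
  have h1 := dAt_of_eventuallyEq hA (F := fun y => F (L y)) (hFx.comp _ L.differentiableAt) h v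
  have h2 := fderiv_comp (sliceIncl (proj x)) hFx L.differentiableAt
  rw [L.fderiv, hLx] at h2
  exact h1.trans (congrArg (fun A : Ambient N n →L[ℂ] ℂ => A (sliceDeriv d (proj x) v)) h2)

/-- The Hamiltonian vector of an invariant function projects to the Hamiltonian vector of the
induced function with respect to the reduced two-form. -/
theorem exists_reduced_sharp (hn : 1 ≤ n) (hd : d = reducedDim N n)
    (hA : ∀ e ∈ atlas (Fin d → ℂ) (Reduced N n), IsAnalyticChart sliceIncl e)
    {W : Set (Ambient N n)} (hW : IsOpen W) {F : Ambient N n → ℂ} (hF : IsInvariantHolomorphic W F)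
    {f : Reduced N n → ℂ} (hf : ∀ z : ZeroLevel N n, (z : Ambient N n) ∈ W → f (proj z) = F z)
    {x : ZeroLevel N n} (hx : (x : Ambient N n) ∈ W) :
    ∃ (v : Fin d → ℂ) (Y : Matrix (Fin n) (Fin n) ℂ), Y.trace = 0 ∧
      sharp (x : Ambient N n) (fderiv ℂ F x)
        = leftMul (matG (x : Ambient N n) 0) (sliceDeriv d (proj x) v)
          + infAction Y (x : Ambient N n) ∧
      ∀ w : Fin d → ℂ, flat (V := Fin d → ℂ) (reducedOmega d N n (proj x)) v w
        = -dAt f (proj x) w := by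
  have hdet := det_ne_zero_of_mem x.2.1
  obtain ⟨v, Y, hY, h⟩ := exists_sliceDeriv_add_infAction hn hd hA x
    (phaseTangent_sharp hn hdet (fderiv ℂ F x))
    (dMoment_sharp_eq_zero hn x.2.1 fun X hX => fderiv_infAction_eq_zero hn hW hF hx x.2.1 hX)
  refine ⟨v, Y, hY, h, fun w => ?_⟩
  obtain ⟨h1, h2⟩ := phaseTangent_leftMul_sliceDeriv hn hd hA x w
  have h3 := omegaHat_sharp hdet (fun k => (x.2.1 k).2.2) (fderiv ℂ F x) h1
  rw [omegaHat_eq_flat hdet, h, map_add, add_apply, ← omegaHat_eq_flat hdet,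
    ← omegaHat_eq_flat hdet, omegaHat_infAction Y hdet, h2, mul_zero, Matrix.trace_zero, neg_zero,
    add_zero] at h3
  rw [flat_reducedOmega, h3, dAt_of_invariant hA hW hF.1 hf hx]

/-- The differentials of linear functions restricted to the slice. -/
theorem dAt_comp_sliceIncl
    (hA : ∀ e ∈ atlas (Fin d → ℂ) (Reduced N n), IsAnalyticChart sliceIncl e)
    (l : Ambient N n →L[ℂ] ℂ) (p : Reduced N n) (v : Fin d → ℂ) :
    dAt (fun q : Reduced N n => l (sliceIncl q)) p v = l (sliceDeriv d p v) := by
  have := dAt_of_eventuallyEq hA (F := l) (p := p) l.differentiableAt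
    (Filter.Eventually.of_forall fun q => rfl) v
  rw [l.fderiv] at this
  exact this

/-- The reduced two-form is non-degenerate: a vector `v` in its kernel is annihilated by the
differentials of the functions `l ∘ sliceIncl`, since these are contractions of the form. -/
theorem fieldNondegenerate_reducedOmega (hn : 1 ≤ n) (hd : d = reducedDim N n)
    (hA : ∀ e ∈ atlas (Fin d → ℂ) (Reduced N n), IsAnalyticChart sliceIncl e) :
    FieldNondegenerate (reducedOmega d N n) := by
  intro p v hv
  obtain ⟨x, rfl⟩ := Quotient.exists_rep p
  refine (map_eq_zero_iff (sliceDeriv d (proj x)) (inclusionDeriv_injective hA (proj x))).mp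
    (covector_separates fun l => ?_)
  obtain ⟨w, -, -, -, hw⟩ := exists_reduced_sharp hn hd hA (isOpen_det_matG_ne_zero 0)
    (isInvariantHolomorphic_gauge l) (f := fun q => l (sliceIncl q)) (fun z _ => rfl)
    (det_ne_zero_of_mem x.2.1 0)
  have h1 := hw v
  have h2 : flat (V := Fin d → ℂ) (reducedOmega d N n (proj x)) w v = 0 := by
    have h3 : flat (V := Fin d → ℂ) (reducedOmega d N n (proj x)) w v
        = -flat (V := Fin d → ℂ) (reducedOmega d N n (proj x)) v w := flat_swap (V := Fin d → ℂ) _ _ _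
    exact h3.trans (neg_eq_zero.mpr (hv w))
  rw [h2, dAt_comp_sliceIncl hA] at h1
  rw [map_zero]
  exact neg_eq_zero.mp h1.symm

/-- The inverse of the reduced two-form is induced by the bracket on the phase space. -/
theorem isReducedPoisson_poissonOfForm (hn : 1 ≤ n) (hd : d = reducedDim N n)
    (hA : ∀ e ∈ atlas (Fin d → ℂ) (Reduced N n), IsAnalyticChart sliceIncl e) :
    IsReducedPoisson (poissonOfForm (reducedOmega d N n)) := by
  intro W hW F H hF hH f h hf hh x hx
  obtain ⟨v, -, -, -, hv⟩ := exists_reduced_sharp hn hd hA hW hF hf hx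
  obtain ⟨w, Y, hY, hw, hw'⟩ := exists_reduced_sharp hn hd hA hW hH hh hx
  -- with the sign of `exists_reduced_sharp`, the covectors `df` and `dh` are dual to `-v` and `-w`
  have hs := fieldNondegenerate_reducedOmega hn hd hA (proj x)
  have h1 := hs.eq_sharp (α := dAt f (proj x)) (v := -v) fun u => by
    have := hv u
    rw [map_neg, neg_apply, this, neg_neg]
    rfl
  have h2 := hs.eq_sharp (α := dAt h (proj x)) (v := -w) fun u => by
    have := hw' u
    rw [map_neg, neg_apply, this, neg_neg]
    rfl
  have h3 := hs.poissonTensor_eq (dAt f (proj x)) (dAt h (proj x))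
  rw [h1, h2, map_neg, map_neg, neg_apply, neg_neg, hv, dAt_of_invariant hA hW hF.1 hf hx] at h3
  refine h3.trans ?_
  have h4 := congrArg (fderiv ℂ F (x : Ambient N n)) hw
  rw [map_add, fderiv_infAction_eq_zero hn hW hF hx x.2.1 hY, add_zero] at h4
  rw [bracket, bivector_neg_symm, bivector_eq_sharp, h4]

/-- The reduced bracket is determined by the differentials of the functions `l ∘ sliceIncl`, which
span the cotangent spaces. -/
theorem IsReducedPoisson.unique
    (hA : ∀ e ∈ atlas (Fin d → ℂ) (Reduced N n), IsAnalyticChart sliceIncl e)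
    {P P' : CotangentPairing d (Reduced N n)} (hP : IsReducedPoisson P)
    (hP' : IsReducedPoisson P') : P' = P := by
  funext p
  have hcov : ∀ α : (Fin d → ℂ) →L[ℂ] ℂ, ∃ l : Ambient N n →L[ℂ] ℂ,
      dAt (fun q : Reduced N n => l (sliceIncl q)) p = α := by
    intro α
    obtain ⟨g, hg⟩ := LinearMap.exists_leftInverse_of_injective
      (sliceDeriv d p : (Fin d → ℂ) →ₗ[ℂ] Ambient N n)
      (LinearMap.ker_eq_bot.mpr (inclusionDeriv_injective hA p))
    refine ⟨α.comp (LinearMap.toContinuousLinearMap g), ContinuousLinearMap.ext fun v => ?_⟩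
    refine (dAt_comp_sliceIncl hA _ p v).trans ?_
    exact congrArg α (LinearMap.congr_fun hg v)
  refine LinearMap.ext₂ fun α β => ?_
  obtain ⟨l, hl⟩ := hcov α
  obtain ⟨l', hl'⟩ := hcov β
  have key : ∀ Q : CotangentPairing d (Reduced N n), IsReducedPoisson Q →
      Q p α β = bracket (fun x => l (gauge x)) (fun x => l' (gauge x)) (sliceIncl p) := by
    intro Q hQ
    have := hQ _ (isOpen_det_matG_ne_zero 0) _ _ (isInvariantHolomorphic_gauge l)
      (isInvariantHolomorphic_gauge l') (fun q => l (sliceIncl q)) (fun q => l' (sliceIncl q))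
      (fun z _ => rfl) (fun z _ => rfl) (slicePoint p) (det_sliceIncl_ne_zero p 0)
    rw [proj_slicePoint, pbracket] at this
    rw [← hl, ← hl']
    exact this
  rw [key P hP, key P' hP']

/-! ### The complex structure of the reduced space -/

theorem isQuotientManifold
    (hA : ∀ e ∈ atlas (Fin d → ℂ) (Reduced N n), IsAnalyticChart sliceIncl e) :
    IsQuotientManifold N n d := by
  refine ⟨isEmbedding_sliceIncl.t2Space, isEmbedding_sliceIncl.secondCountableTopology,
    inferInstance, fun U hU f => ⟨fun hf x hx => ?_, fun hf p hp => ?_⟩⟩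
  -- a local extension of `f` from the slice, composed with `gauge`, extends the pullback of `f`
  · obtain ⟨F, hF, hfF⟩ := exists_analytic_extension hA (hf.contMDiffAt (hU.mem_nhds hx))
    refine ⟨fun y => F (gauge y),
      hF.comp_of_eq (analyticAt_gauge (det_ne_zero_of_mem x.2.1 0)) rfl, ?_⟩
    exact continuous_proj.continuousAt.eventually hfF
  · obtain ⟨F, hF, hfF⟩ := hf (slicePoint p) (by rwa [proj_slicePoint])
    refine (contMDiffAt_of_eventuallyEq_inclusion hA hF ?_).contMDiffWithinAt
    filter_upwards [continuous_slicePoint.continuousAt.eventually hfF] with q hq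
    rw [proj_slicePoint] at hq
    exact hq

end Reduction

end GLReduction

end

theorem mainTheorem4 (N n : ℕ) (hN : 1 ≤ N) (hn : 1 ≤ n) :
    IsMomentMap N n ∧
    ∃ (d : ℕ) (_ : ChartedSpace (Fin d → ℂ) (Reduced N n)), IsQuotientManifold N n d ∧
      ∃ (P : CotangentPairing d (Reduced N n))
        (omegaA : FormField d (Reduced N n) 2) (thetaA : FormField d (Reduced N n) 1),
        (IsReducedPoisson P ∧ ∀ P', IsReducedPoisson P' → P' = P) ∧
        IsPoisson P ∧ PoissonNondegenerate P ∧
        IsSymplecticForm omegaA ∧ Corresponds P omegaA ∧ PullsBackTo omegaA omegaHat ∧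
        IsHolomorphicForm thetaA ∧ PullsBackTo thetaA thetaHat ∧
        IsExteriorDerivative thetaA omegaA := by
  have : NeZero N := ⟨by omega⟩
  let cs : ChartedSpace (Fin (reducedDim N n) → ℂ) (Reduced N n) :=
    analyticChartedSpace sliceIncl (exists_sliceChart hn)
  have hA : ∀ e ∈ atlas (Fin (reducedDim N n) → ℂ) (Reduced N n), IsAnalyticChart sliceIncl e :=
    fun _ he => he
  have : IsManifold 𝓘(ℂ, Fin (reducedDim N n) → ℂ) ω (Reduced N n) :=
    isManifold_of_isAnalyticChart hA
  have hex := isExteriorDerivative_reducedTheta hA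
  have hth := isHolomorphicForm_reducedTheta hA
  have hol := hex.isHolomorphicForm hth
  have hcl := hex.closed hth
  have hnd := fieldNondegenerate_reducedOmega hn rfl hA
  have hP := isReducedPoisson_poissonOfForm hn rfl hA
  exact ⟨isMomentMap hn, _, cs, isQuotientManifold hA, poissonOfForm _, _, _,
    ⟨hP, fun _ => hP.unique hA⟩, isPoisson_poissonOfForm hnd hol hcl,
    poissonNondegenerate_poissonOfForm hnd, ⟨hol, hcl, hnd⟩, corresponds_poissonOfForm hnd,
    pullsBackTo_reducedOmega hA, hth, pullsBackTo_reducedTheta hA, hex⟩
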